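/- Let $K$ be a non-archimedean local field with residue field $\mathbb F_q$ and uniformizer $\varpi$, let $\breve K$ be the completion of a maximal unramified extension of $K$, with ring of integers $\mathcal O$, maximal ideal $\mathfrak p$, normalized valuation $\mathrm{ord}$ and Frobenius $\sigma$ over $K$, and let $L=\breve K^{\sigma^n}$ be the unramified extension of $K$ of degree $n$, where $n\ge 1$. Let $0\le\kappa<n$ and let $b\in \mathrm{GL}_n(\breve K)$ be basic (its Newton point is central) with $\mathrm{ord}\det b=\kappa$. Put $V=\breve K^n$ and $G=J_b(K)=\{g\in \mathrm{GL}_n(\breve K): g^{-1}b\sigma(g)=b\}$. Let $b_0$ be the permutation matrix $e_1\mapsto e_2\mapsto\cdots\mapsto e_n\mapsto e_1$, let $w$ be its image in the Weyl group (a Coxeter element), and for $r\ge0$ let $\dot w_r=b_0\cdot\mathrm{diag}(\varpi^{-r},\dots,\varpi^{-r},\varpi^{\kappa+(n-1)r})$. Let $T_w(K)$ be the group of diagonal $t\in \mathrm{GL}_n(\breve K)$ with $t^{-1}b_0\sigma(t)=b_0$, and $T_w(\mathcal O_K)$ its subgroup of elements with entries in $\mathcal O^\times$. For $x\in V$ let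 $g_{b,r}(x)$ be the matrix whose $i$-th column is $\varpi^{r(i-1)}(b\sigma)^{i-1}(x)$, put $g_b=g_{b,0}$, and let $V_b^{\rm adm}=\{x:\det g_b(x)\ne0\}$, $V_b^{\rm adm,rat}=\{x:\det g_b(x)\in K^\times\}$. Let $B$ be the group of upper triangular matrices in $\mathrm{GL}_n(\breve K)$ and $U$ its unipotent radical. For $m\ge 0$ let $I^m\subseteq \mathrm{GL}_n(\mathcal O)$ consist of the matrices with entries in $\mathfrak p^m$ above and in $\mathfrak p^{m+1}$ below the diagonal, and let $\dot I^m\subseteq I^m$ consist of those whose diagonal entries are $\equiv1$ modulo $\mathfrak p^{m+1}$. Put $$X_w^{DL}(b)=\{gB: g^{-1}b\sigma(g)\in B\dot w_0B\},\qquad \dot X_w^{DL}(b)=\{gU: g^{-1}b\sigma(g)\in U\dot w_0U\},$$ $$X^m_{\dot w_r}(b)=\{gI^m: g^{-1}b\sigma(g)\in I^m\dot w_rI^m\},\qquad \dot X^m_{\dot w_r}(b)=\{g\dot I^m: g^{-1}b\sigma(g)\in \dot I^m\dot w_r\dot I^m\}.$$ The group $G$ acts on all these sets by left multiplication; $T_w(K)$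 acts on $\dot X_w^{DL}(b)$ and $T_w(\mathcal O_K)$ on the sets $\dot X^m_{\dot w_r}(b)$ by right multiplication. Then the following hold. 1. For $r'\ge r$, $m'\ge m$, $r'>m'\ge0$, $r>m\ge0$, the rule $g_{b,r'}(x)\mapsto g_{b,r}(x)$, for $x\in V_b^{\rm adm}$, induces well-defined maps $X^{m'}_{\dot w_{r'}}(b)\to X^m_{\dot w_r}(b)$ and $\dot X^{m'}_{\dot w_{r'}}(b)\to \dot X^m_{\dot w_r}(b)$. Let $X_w^\infty(b)=\varprojlim_{r>m}X^m_{\dot w_r}(b)$ and $\dot X_w^\infty(b)=\varprojlim_{r>m}\dot X^m_{\dot w_r}(b)$ be the inverse limits along these maps, with the induced actions of $G$, and of $T_w(\mathcal O_K)$ on the second. 2. $t\mapsto t_{11}$ is an isomorphism $T_w(K)\cong L^\times$ which identifies $T_w(\mathcal O_K)$ with $\mathcal O_L^\times$. The set $V_b^{\rm adm,rat}$ is stable under $G$ (acting linearly on $V$) and under $T_w(K)=L^\times$ (acting by scaling). 3. There is a commutative diagram of sets with $G$-equivariant maps $$\begin{array}{ccccc}\dot X_w^{DL}(b)&\xleftarrow{\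 \sim\ }&V_b^{\rm adm,rat}&\xrightarrow{\hspace{4em}\sim\hspace{4em}}&\dot X_w^\infty(b)\\ \downarrow&&\downarrow&&\downarrow\\ X_w^{DL}(b)&\xleftarrow{\ \sim\ }&V_b^{\rm adm}/\breve K^\times&\leftarrow\ V_b^{\rm adm}/\mathcal O^\times\ \xrightarrow{\ \sim\ }&X_w^\infty(b)\end{array}$$ in which the arrows marked $\sim$ are bijections, the unmarked arrows are the natural ones, and the right-hand part commutes already with the natural map $V_b^{\rm adm,rat}\to V_b^{\rm adm}/\mathcal O^\times$. The lower bijections are $x\mapsto g_b(x)B$ and $x\mapsto(g_{b,r}(x)I^m)_{r>m}$; the upper ones are $x\mapsto g_b(cx)U$ and $x\mapsto (g_{b,r}(cx)\dot I^m)_{r>m}$ for a constant $c\in\mathcal O^\times$, with $c=1$ if $\det b=\det\dot w_0$. The left vertical map is a $T_w(K)$-torsor, the right vertical map is a $T_w(\mathcal O_K)$-torsor, and $V_b^{\rm adm}/\mathcal O^\times\to V_b^{\rm adm}/\breve K^\times$ is a torsor under $\varpi^{\mathbb Z}\cong\mathbb Z$. 4. The upper left bijection is $T_w(K)$-equivariant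 and the upper right one is $T_w(\mathcal O_K)$-equivariant. The action of $T_w(\mathcal O_K)$ on $\dot X_w^\infty(b)$ extends to an action of $T_w(K)\cong L^\times$ which commutes with $G$ and for which the upper right bijection is $T_w(K)$-equivariant. -/

import Mathlib

open ValuativeRel Matrix

noncomputable section

namespace CoxeterDL

/-! ### The field `K̆`, its Frobenius, and uniformizers -/

section Fields

variable (K : Type*) [Field K] [ValuativeRel K]
variable {Kb : Type*} [Field Kb] [ValuativeRel Kb] [Algebra K Kb]

/-- `Kb` is the completion of a maximal unramified extension of the local field `K`.
The elements of `Kb` which are algebraic over `K` form an algebraic extension `Kur` of `K`.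
The first two conditions say that `Kur / K` is unramified (no new values; the residue field of
`K` is perfect) and maximal with this property (its residue field is algebraically closed), since
a valued field has the same value group and residue field as its completion; the last two
say that `Kb` is the completion of `Kur`. -/
structure IsCompletedMaximalUnramified (Kb : Type*) [Field Kb] [ValuativeRel Kb] [Algebra K Kb]
    [ValuativeExtension K Kb] : Prop where
  unramified : ∀ x : Kb, ∃ y : K, valuation Kb x = valuation Kb (algebraMap K Kb y)
  maximal : IsAlgClosed 𝓀[Kb]
  dense : ∀ (x : Kb) (y : K), y ≠ 0 →
    ∃ a : Kb, IsAlgebraic K a ∧ valuation Kb (x - a) ≤ valuation Kb (algebraMap K Kb y)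
  complete : IsAdicComplete 𝓂[Kb] 𝒪[Kb]

/-- `σ` is the Frobenius of `Kb / K`: the `K`-automorphism which lifts `x ↦ x ^ q` on the residue
field, where `q` is the cardinality of the residue field of `K`. -/
def IsFrobenius (σ : Kb ≃ₐ[K] Kb) : Prop :=
  ∀ x : Kb, valuation Kb x ≤ 1 → valuation Kb (σ x - x ^ Nat.card 𝓀[K]) < 1

/-- `ϖ ∈ Kb` is (the image of) a uniformizer of `K`. -/
def IsUniformizerOf [ValuativeRel.IsDiscrete K] (ϖ : Kbˣ) : Prop :=
  ∃ p : K, algebraMap K Kb p = ϖ ∧ valuation K p = ValuativeRel.uniformizer K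

end Fields

/-! ### Iwahori level subgroups of `GL_n` over a ring -/

section Iwahori

variable {R : Type*} [CommRing R] {n : ℕ}

/-- Matrices with entries in `𝔭 ^ m` above the diagonal and in `𝔭 ^ (m + 1)` below it. -/
def iwahoriOrder (𝔭 : Ideal R) (m : ℕ) : Subalgebra R (Matrix (Fin n) (Fin n) R) where
  carrier := {A | (∀ i j, i < j → A i j ∈ 𝔭 ^ m) ∧ (∀ i j, j < i → A i j ∈ 𝔭 ^ (m + 1))}
  add_mem' := fun ha hb =>
    ⟨fun i j h => Ideal.add_mem _ (ha.1 i j h) (hb.1 i j h),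
      fun i j h => Ideal.add_mem _ (ha.2 i j h) (hb.2 i j h)⟩
  mul_mem' := by
    intro A B ha hb
    refine ⟨fun i j h => ?_, fun i j h => ?_⟩
    · rw [Matrix.mul_apply]
      refine Ideal.sum_mem _ fun k _ => ?_
      by_cases hk : i < k
      · exact Ideal.mul_mem_right _ _ (ha.1 i k hk)
      · exact Ideal.mul_mem_left _ _ (hb.1 k j (lt_of_le_of_lt (not_lt.1 hk) h))
    · rw [Matrix.mul_apply]
      refine Ideal.sum_mem _ fun k _ => ?_
      by_cases hk : k < i
      · exact Ideal.mul_mem_right _ _ (ha.2 i k hk)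
      · exact Ideal.mul_mem_left _ _ (hb.2 k j (lt_of_lt_of_le h (not_lt.1 hk)))
  algebraMap_mem' := by
    intro r
    refine ⟨fun i j h => ?_, fun i j h => ?_⟩
    · simp [Matrix.algebraMap_matrix_apply, h.ne]
    · simp [Matrix.algebraMap_matrix_apply, h.ne']

/-- A subalgebra of a matrix algebra is closed under the inverses which exist. -/
theorem inv_mem_of_mem (S : Subalgebra R (Matrix (Fin n) (Fin n) R)) (g : GL (Fin n) R)
    (hg : (g : Matrix (Fin n) (Fin n) R) ∈ S) :
    ((g⁻¹ : GL (Fin n) R) : Matrix (Fin n) (Fin n) R) ∈ S := by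
  set A : Matrix (Fin n) (Fin n) R := g.val with hA
  have hdet : IsUnit A.det := (Matrix.isUnit_iff_isUnit_det A).1 g.isUnit
  obtain ⟨u, hu⟩ : IsUnit (A.charpoly.coeff 0) := by
    have h := A.det_eq_sign_charpoly_coeff
    rw [h] at hdet
    exact isUnit_of_mul_isUnit_right hdet
  have hCH := A.aeval_self_charpoly
  rw [← Polynomial.divX_mul_X_add A.charpoly, map_add, map_mul, Polynomial.aeval_X,
    Polynomial.aeval_C, ← hu] at hCH
  set D := Polynomial.aeval A A.charpoly.divX with hD
  have hDS : D ∈ S := by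
    exact Algebra.adjoin_le (Set.singleton_subset_iff.2 hg)
      (Polynomial.aeval_mem_adjoin_singleton R A)
  have h1 : D * A = -algebraMap R _ (u : R) := eq_neg_of_add_eq_zero_left hCH
  have h2 : ((g⁻¹ : GL (Fin n) R) : Matrix (Fin n) (Fin n) R)
      = -(((u⁻¹ : Rˣ) : R) • D) := by
    have h3 : -(((u⁻¹ : Rˣ) : R) • D) * A = 1 := by
      rw [neg_mul, smul_mul_assoc, h1, smul_neg, neg_neg, Algebra.algebraMap_eq_smul_one,
        smul_smul, Units.inv_mul, one_smul]
    calc ((g⁻¹ : GL (Fin n) R) : Matrix (Fin n) (Fin n) R)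
        = (-(((u⁻¹ : Rˣ) : R) • D) * A) * ((g⁻¹ : GL (Fin n) R) : Matrix (Fin n) (Fin n) R) := by
          rw [h3, one_mul]
      _ = -(((u⁻¹ : Rˣ) : R) • D) := by
          rw [mul_assoc, hA, ← Units.val_mul, mul_inv_cancel, Units.val_one, mul_one]
  rw [h2]
  exact S.neg_mem (S.smul_mem hDS _)

/-- The invertible matrices over `R` which modulo `𝔭 ^ (m + 1)` are upper triangular with entries
above the diagonal in `𝔭 ^ m`. -/
def iwahori (𝔭 : Ideal R) (m : ℕ) : Subgroup (GL (Fin n) R) where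
  carrier := {g | (∀ i j, i < j → g i j ∈ 𝔭 ^ m) ∧ (∀ i j, j < i → g i j ∈ 𝔭 ^ (m + 1))}
  one_mem' := (iwahoriOrder 𝔭 m).one_mem
  mul_mem' := fun ha hb => (iwahoriOrder 𝔭 m).mul_mem ha hb
  inv_mem' := fun {g} hg => inv_mem_of_mem (iwahoriOrder 𝔭 m) g hg

theorem mul_diag_sub_mem {𝔭 : Ideal R} {m : ℕ} {g h : GL (Fin n) R}
    (hg : g ∈ iwahori 𝔭 m) (hh : h ∈ iwahori 𝔭 m) (i : Fin n) :
    (g * h) i i - g i i * h i i ∈ 𝔭 ^ (m + 1) := by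
  have : (g * h) i i = ∑ k, g i k * h k i := by
    rw [Units.val_mul, Matrix.mul_apply]
  rw [this, ← Finset.add_sum_erase _ _ (Finset.mem_univ i), add_sub_cancel_left]
  refine Ideal.sum_mem _ fun k hk => ?_
  rcases lt_or_gt_of_ne (Finset.ne_of_mem_erase hk) with h' | h'
  · exact Ideal.mul_mem_right _ _ (hg.2 i k h')
  · exact Ideal.mul_mem_left _ _ (hh.2 k i h')

/-- The elements of `iwahori 𝔭 m` whose diagonal entries are `≡ 1` modulo `𝔭 ^ (m + 1)`. -/
def iwahoriDot (𝔭 : Ideal R) (m : ℕ) : Subgroup (GL (Fin n) R) where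
  carrier := {g | g ∈ iwahori 𝔭 m ∧ ∀ i, g i i - 1 ∈ 𝔭 ^ (m + 1)}
  one_mem' := ⟨(iwahori 𝔭 m).one_mem, fun i => by simp⟩
  mul_mem' := by
    rintro g h ⟨hg, hg'⟩ ⟨hh, hh'⟩
    refine ⟨(iwahori 𝔭 m).mul_mem hg hh, fun i => ?_⟩
    have e : (g * h) i i - 1
        = ((g * h) i i - g i i * h i i) + (g i i - 1) * h i i + (h i i - 1) := by ring
    rw [e]
    exact Ideal.add_mem _ (Ideal.add_mem _ (mul_diag_sub_mem hg hh i)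
      (Ideal.mul_mem_right _ _ (hg' i))) (hh' i)
  inv_mem' := by
    rintro g ⟨hg, hg'⟩
    refine ⟨(iwahori 𝔭 m).inv_mem hg, fun i => ?_⟩
    have h := mul_diag_sub_mem hg ((iwahori 𝔭 m).inv_mem hg) i
    rw [mul_inv_cancel] at h
    have e : g⁻¹ i i - 1
        = -(((1 : GL (Fin n) R) i i - g i i * g⁻¹ i i) + (g i i - 1) * g⁻¹ i i) := by
      simp only [Units.val_one, Matrix.one_apply_eq]
      ring
    rw [e]
    exact neg_mem (Ideal.add_mem _ h (Ideal.mul_mem_right _ _ (hg' i)))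

end Iwahori

/-- A surjection `π : A → B` is a torsor under a group `T` acting on `A`, if `T` preserves the
fibres of `π` and acts simply transitively on each of them. -/
def IsTorsor (T : Type*) [Group T] {A B : Type*} [MulAction T A] (π : A → B) : Prop :=
  Function.Surjective π ∧ (∀ (t : T) (a : A), π (t • a) = π a) ∧
    ∀ a a' : A, π a = π a' → ∃! t : T, a' = t • a

section Main

variable {K Kb : Type*} [Field K] [Field Kb] [Algebra K Kb] {n : ℕ}

/-- The degree `n` unramified extension `L` of `K`, as the fixed field of `σ ^ n` in `Kb`. -/
def unramifiedExt (σ : Kb ≃ₐ[K] Kb) (n : ℕ) : IntermediateField K Kb :=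
  IntermediateField.fixedField (Subgroup.zpowers (σ ^ n))

/-! ### Subgroups and elements of `GL_n(K̆)` -/

/-- The action of `σ` on `GL_n(K̆)`. -/
def frob (σ : Kb ≃ₐ[K] Kb) : GL (Fin n) Kb →* GL (Fin n) Kb :=
  Matrix.GeneralLinearGroup.map (σ : Kb →+* Kb)

theorem frob_apply (σ : Kb ≃ₐ[K] Kb) (g : GL (Fin n) Kb) (i j : Fin n) :
    frob σ g i j = σ (g i j) := rfl

/-- The diagonal torus `(K̆ˣ)ⁿ → GL_n(K̆)`. -/
def diagGL : (Fin n → Kbˣ) →* GL (Fin n) Kb :=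
  (Units.map (Matrix.diagonalRingHom (Fin n) Kb).toMonoidHom).comp
    (MulEquiv.piUnits (M := fun _ : Fin n => Kb)).symm.toMonoidHom

theorem coe_diagGL (t : Fin n → Kbˣ) :
    (diagGL t : Matrix (Fin n) (Fin n) Kb) = Matrix.diagonal fun i => (t i : Kb) := rfl

theorem coe_diagGL_inv (t : Fin n → Kbˣ) :
    (((diagGL t)⁻¹ : GL (Fin n) Kb) : Matrix (Fin n) (Fin n) Kb)
      = Matrix.diagonal fun i => (((t i)⁻¹ : Kbˣ) : Kb) := by
  rw [← map_inv, coe_diagGL]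
  rfl

theorem diagGL_conj_apply (t : Fin n → Kbˣ) (h : GL (Fin n) Kb) (i j : Fin n) :
    ((diagGL t)⁻¹ * h * diagGL t) i j = ((t i)⁻¹ : Kbˣ) * h i j * t j := by
  rw [Units.val_mul, Units.val_mul, coe_diagGL_inv, coe_diagGL, Matrix.mul_diagonal,
    Matrix.diagonal_mul]

/-- The Borel subgroup of upper triangular matrices. -/
def upperBorel : Subgroup (GL (Fin n) Kb) where
  carrier := {g | ∀ i j, j < i → g i j = 0}
  one_mem' := fun i j h => by simp [h.ne']
  mul_mem' := fun {g h} hg hh i j hij => by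
    rw [Units.val_mul, Matrix.mul_apply]
    refine Finset.sum_eq_zero fun k _ => ?_
    by_cases hk : k < i
    · rw [hg i k hk, zero_mul]
    · rw [hh k j (lt_of_lt_of_le hij (not_lt.1 hk)), mul_zero]
  inv_mem' := fun {g} hg i j hij => by
    have : Invertible g.val := g.invertible
    have h := Matrix.blockTriangular_inv_of_blockTriangular (M := g.val) (b := id)
      (fun i j h => hg i j h)
    rw [Matrix.coe_units_inv]
    exact h hij

theorem mul_diag {g h : GL (Fin n) Kb} (hg : g ∈ upperBorel) (hh : h ∈ upperBorel) (i : Fin n) :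
    (g * h) i i = g i i * h i i := by
  rw [Units.val_mul, Matrix.mul_apply]
  refine Finset.sum_eq_single i (fun k _ hk => ?_) (fun h => absurd (Finset.mem_univ i) h)
  rcases lt_or_gt_of_ne hk with h' | h'
  · rw [hg i k h', zero_mul]
  · rw [hh k i h', mul_zero]

/-- The unipotent radical of the Borel subgroup. -/
def unip : Subgroup (GL (Fin n) Kb) where
  carrier := {g | g ∈ upperBorel ∧ ∀ i, g i i = 1}
  one_mem' := ⟨one_mem _, fun i => by simp⟩
  mul_mem' := by
    rintro g h ⟨hg, hg'⟩ ⟨hh, hh'⟩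
    exact ⟨mul_mem hg hh, fun i => by rw [mul_diag hg hh, hg', hh', one_mul]⟩
  inv_mem' := by
    rintro g ⟨hg, hg'⟩
    refine ⟨inv_mem hg, fun i => ?_⟩
    have h := mul_diag hg (inv_mem hg) i
    rw [mul_inv_cancel, hg', one_mul] at h
    rw [← h]
    simp

theorem unip_le_borel : (unip : Subgroup (GL (Fin n) Kb)) ≤ upperBorel := fun _ h => h.1

theorem diagGL_conj_unip (t : Fin n → Kbˣ) {h : GL (Fin n) Kb} (hh : h ∈ unip) :
    (diagGL t)⁻¹ * h * diagGL t ∈ unip := by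
  refine ⟨fun i j hij => ?_, fun i => ?_⟩
  · rw [diagGL_conj_apply, hh.1 i j hij, mul_zero, zero_mul]
  · rw [diagGL_conj_apply, hh.2 i, mul_one, Units.inv_mul]

/-- The group `I^m`. -/
def iwahoriLevel [ValuativeRel Kb] (m : ℕ) : Subgroup (GL (Fin n) Kb) :=
  (iwahori 𝓂[Kb] m).map (Matrix.GeneralLinearGroup.map (algebraMap 𝒪[Kb] Kb))

/-- The group `İ^m`. -/
def iwahoriDotLevel [ValuativeRel Kb] (m : ℕ) : Subgroup (GL (Fin n) Kb) :=
  (iwahoriDot 𝓂[Kb] m).map (Matrix.GeneralLinearGroup.map (algebraMap 𝒪[Kb] Kb))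

theorem iwahoriDotLevel_le [ValuativeRel Kb] (m : ℕ) :
    (iwahoriDotLevel m : Subgroup (GL (Fin n) Kb)) ≤ iwahoriLevel m :=
  Subgroup.map_mono fun _ h => h.1

/-- The group of units of `𝒪 ⊆ K̆`. -/
def intUnits (Kb : Type*) [Field Kb] [ValuativeRel Kb] : Subgroup Kbˣ :=
  (valuation Kb).valuationSubring.unitGroup

theorem mem_intUnits [ValuativeRel Kb] {a : Kbˣ} : a ∈ intUnits Kb ↔ valuation Kb a = 1 :=
  Valuation.mem_unitGroup_iff _ _ _

theorem diagGL_conj_iwahoriDotLevel [ValuativeRel Kb] {m : ℕ} {t : Fin n → Kbˣ}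
    (ht : ∀ i, t i ∈ intUnits Kb) {h : GL (Fin n) Kb} (hh : h ∈ iwahoriDotLevel m) :
    (diagGL t)⁻¹ * h * diagGL t ∈ iwahoriDotLevel m := by
  obtain ⟨h, hh, rfl⟩ := hh
  have hu : ∀ i, valuation Kb (t i) = 1 := fun i => mem_intUnits.1 (ht i)
  let u : Fin n → 𝒪[Kb]ˣ := fun i =>
    { val := ⟨t i, (hu i).le⟩
      inv := ⟨((t i)⁻¹ : Kbˣ), by
        change valuation Kb _ ≤ 1
        rw [Units.val_inv_eq_inv_val, map_inv₀, hu i, inv_one]⟩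
      val_inv := Subtype.ext (Units.mul_inv (t i))
      inv_val := Subtype.ext (Units.inv_mul (t i)) }
  let d : GL (Fin n) 𝒪[Kb] :=
    { val := Matrix.diagonal fun i => (u i : 𝒪[Kb])
      inv := Matrix.diagonal fun i => (((u i)⁻¹ : 𝒪[Kb]ˣ) : 𝒪[Kb])
      val_inv := by simp
      inv_val := by simp }
  have e : ∀ i j, (d⁻¹ * h * d) i j = (((u i)⁻¹ : 𝒪[Kb]ˣ) : 𝒪[Kb]) * h i j * u j := by
    intro i j
    change ((Matrix.diagonal fun i => (((u i)⁻¹ : 𝒪[Kb]ˣ) : 𝒪[Kb])) * h.val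
      * Matrix.diagonal fun i => (u i : 𝒪[Kb])) i j = _
    rw [Matrix.mul_diagonal, Matrix.diagonal_mul]
  refine ⟨d⁻¹ * h * d, ⟨⟨fun i j hij => ?_, fun i j hij => ?_⟩, fun i => ?_⟩, ?_⟩
  · rw [e]
    exact Ideal.mul_mem_right _ _ (Ideal.mul_mem_left _ _ (hh.1.1 i j hij))
  · rw [e]
    exact Ideal.mul_mem_right _ _ (Ideal.mul_mem_left _ _ (hh.1.2 i j hij))
  · have h1 : (d⁻¹ * h * d) i i - 1 = h i i - 1 := by
      rw [e, mul_comm, ← mul_assoc, Units.mul_inv, one_mul]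
    rw [h1]
    exact hh.2 i
  · have hd : Matrix.GeneralLinearGroup.map (algebraMap 𝒪[Kb] Kb) d = diagGL t := by
      ext i j
      rw [coe_diagGL]
      change algebraMap 𝒪[Kb] Kb (Matrix.diagonal (fun i => (u i : 𝒪[Kb])) i j) = _
      by_cases hij : i = j
      · subst hij
        rw [Matrix.diagonal_apply_eq, Matrix.diagonal_apply_eq]
        rfl
      · rw [Matrix.diagonal_apply_ne _ hij, Matrix.diagonal_apply_ne _ hij, map_zero]
    rw [map_mul, map_mul, map_inv, hd]

/-- The group `J_b(K)` of `g` with `g⁻¹ b σ(g) = b`. -/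
def Jb (σ : Kb ≃ₐ[K] Kb) (b : GL (Fin n) Kb) : Subgroup (GL (Fin n) Kb) where
  carrier := {g | g⁻¹ * b * frob σ g = b}
  one_mem' := by simp
  mul_mem' := by
    intro g h hg hh
    have e : (g * h)⁻¹ * b * frob σ (g * h) = h⁻¹ * (g⁻¹ * b * frob σ g) * frob σ h := by
      rw [map_mul]; group
    change _ = _
    rw [e, hg, hh]
  inv_mem' := by
    intro g hg
    change _ = _
    have hg' : g⁻¹ * b * frob σ g = b := hg
    conv_lhs => rw [← hg']
    rw [map_inv]; group

/-- `b` is basic: its Newton point is central. In terms of Kottwitz's characterization of the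
Newton point: for some `s ≥ 1` the `σ ^ s`-linear map `(bσ) ^ s` is conjugate under `GL_n(K̆)` to
`ϖ ^ d σ ^ s` for a (central) power `ϖ ^ d`. Here `b σ(b) ⋯ σ^{s-1}(b)` is the matrix of
`(bσ) ^ s`. -/
def IsBasic (σ : Kb ≃ₐ[K] Kb) (ϖ : Kbˣ) (b : GL (Fin n) Kb) : Prop :=
  ∃ (s : ℕ) (d : ℤ) (c : GL (Fin n) Kb), 1 ≤ s ∧
    c * ((List.range s).map fun i => (frob σ)^[i] b).prod * ((frob σ)^[s] c)⁻¹
      = diagGL fun _ => ϖ ^ d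

/-- `σ(t)` for a point `t` of the torus. -/
def frobT (σ : Kb ≃ₐ[K] Kb) (t : Fin n → Kbˣ) : Fin n → Kbˣ :=
  fun i => Units.map (σ : Kb →* Kb) (t i)

theorem frob_diagGL (σ : Kb ≃ₐ[K] Kb) (t : Fin n → Kbˣ) :
    frob σ (diagGL t) = diagGL (frobT σ t) := by
  ext i k
  rw [CoxeterDL.frob_apply, coe_diagGL, coe_diagGL]
  by_cases hik : i = k
  · subst hik; simp [frobT]
  · simp [Matrix.diagonal_apply_ne _ hik]

section Coxeter

variable [NeZero n]

/-- The permutation matrix `e_1 ↦ e_2 ↦ ⋯ ↦ e_n ↦ e_1`, a lift of the Coxeter element `w`. -/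
def b₀ : GL (Fin n) Kb where
  val := Matrix.of fun i j => if i = j + 1 then 1 else 0
  inv := Matrix.of fun i j => if j = i + 1 then 1 else 0
  val_inv := by
    ext i j
    rw [Matrix.mul_apply, Finset.sum_eq_single (i - 1)]
    · simp [Matrix.one_apply, eq_comm]
    · intro k _ hk
      have : i ≠ k + 1 := fun h => hk (eq_sub_of_add_eq h.symm)
      simp [this]
    · simp
  inv_val := by
    ext i j
    rw [Matrix.mul_apply, Finset.sum_eq_single (i + 1)]
    · simp [Matrix.one_apply]
    · intro k _ hk
      simp [hk]
    · simp

/-- The element `ẇ_r = b₀ ϖ^(-r, …, -r, κ + (n-1) r)`. -/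
def wdot (ϖ : Kbˣ) (κ r : ℕ) : GL (Fin n) Kb :=
  b₀ * diagGL fun j =>
    if (j : ℕ) + 1 = n then ϖ ^ ((κ : ℤ) + ((n : ℤ) - 1) * r) else ϖ ^ (-(r : ℤ))

/-- The group `T_w(K)` of points `t ∈ (K̆ˣ)ⁿ` of the diagonal torus with `t⁻¹ ẇ σ(t) = ẇ`. -/
def Tw (σ : Kb ≃ₐ[K] Kb) : Subgroup (Fin n → Kbˣ) where
  carrier := {t | (diagGL t)⁻¹ * b₀ * frob σ (diagGL t) = b₀}
  one_mem' := by simp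
  mul_mem' := by
    intro g h hg hh
    have e : (diagGL (g * h))⁻¹ * b₀ * frob σ (diagGL (g * h))
        = (diagGL h)⁻¹ * ((diagGL g)⁻¹ * b₀ * frob σ (diagGL g)) * frob σ (diagGL h) := by
      rw [map_mul, map_mul]; group
    change _ = _
    rw [e, hg, hh]
  inv_mem' := by
    intro g hg
    change _ = _
    have hg' : (diagGL g)⁻¹ * b₀ * frob σ (diagGL g) = b₀ := hg
    conv_lhs => rw [← hg']
    rw [map_inv, map_inv]; group

/-- The group `T_w(𝒪_K)`, the points of `T_w(K)` with coordinates in `𝒪ˣ`. -/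
def TwInt [ValuativeRel Kb] (σ : Kb ≃ₐ[K] Kb) : Subgroup (Fin n → Kbˣ) :=
  Tw σ ⊓ Subgroup.pi Set.univ fun _ => intUnits Kb

theorem Tw.frob_apply {σ : Kb ≃ₐ[K] Kb} {t : Fin n → Kbˣ} (ht : t ∈ Tw σ) (j : Fin n) :
    σ (t j) = t (j + 1) := by
  have h : (diagGL t)⁻¹ * b₀ * frob σ (diagGL t) = b₀ := ht
  have h1 : b₀ * frob σ (diagGL t) = diagGL t * b₀ := by
    rw [mul_assoc, inv_mul_eq_iff_eq_mul] at h
    exact h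
  have h2 := congrArg (fun g : GL (Fin n) Kb => g.val (j + 1) j) h1
  have h3 : (frob σ (diagGL t) : Matrix (Fin n) (Fin n) Kb)
      = Matrix.diagonal fun i => σ (t i) := by
    ext i k
    rw [CoxeterDL.frob_apply, coe_diagGL]
    by_cases hik : i = k
    · subst hik; simp
    · simp [Matrix.diagonal_apply_ne _ hik]
  rw [Units.val_mul, Units.val_mul, h3, coe_diagGL, Matrix.mul_diagonal,
    Matrix.diagonal_mul] at h2
  simpa [b₀] using h2

theorem Tw.conj_wdot {σ : Kb ≃ₐ[K] Kb} {t : Fin n → Kbˣ} (ht : t ∈ Tw σ) (ϖ : Kbˣ)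
    (κ r : ℕ) : (diagGL t)⁻¹ * wdot ϖ κ r * frob σ (diagGL t) = wdot ϖ κ r := by
  have h : (diagGL t)⁻¹ * b₀ * frob σ (diagGL t) = b₀ := ht
  rw [frob_diagGL] at h ⊢
  set δ : Fin n → Kbˣ := fun j =>
    if (j : ℕ) + 1 = n then ϖ ^ ((κ : ℤ) + ((n : ℤ) - 1) * r) else ϖ ^ (-(r : ℤ)) with hδ
  have hc : diagGL δ * diagGL (frobT σ t) = diagGL (frobT σ t) * diagGL δ := by
    rw [← map_mul, ← map_mul, mul_comm δ]
  calc (diagGL t)⁻¹ * wdot ϖ κ r * diagGL (frobT σ t)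
      = (diagGL t)⁻¹ * b₀ * (diagGL δ * diagGL (frobT σ t)) := by
        simp only [wdot, mul_assoc, hδ]
    _ = ((diagGL t)⁻¹ * b₀ * diagGL (frobT σ t)) * diagGL δ := by
        rw [hc]; simp only [mul_assoc]
    _ = wdot ϖ κ r := by rw [h]; rfl

end Coxeter

/-! ### Deligne-Lusztig sets -/

/-- For `H ≤ GL_n(K̆)`, the set of `gH ∈ GL_n(K̆)/H` with `g⁻¹ b σ(g) ∈ H x H`. -/
def dlSet (σ : Kb ≃ₐ[K] Kb) (H : Subgroup (GL (Fin n) Kb)) (x b : GL (Fin n) Kb) :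
    Set (GL (Fin n) Kb ⧸ H) :=
  {P | ∃ g : GL (Fin n) Kb, (g : GL (Fin n) Kb ⧸ H) = P ∧
    g⁻¹ * b * frob σ g ∈ DoubleCoset.doubleCoset x (H : Set (GL (Fin n) Kb)) H}

/-- `J_b(K)` acts on Deligne-Lusztig sets by left multiplication. -/
instance (σ : Kb ≃ₐ[K] Kb) (H : Subgroup (GL (Fin n) Kb)) (x b : GL (Fin n) Kb) :
    MulAction (Jb σ b) (dlSet σ H x b) where
  smul j P := ⟨(j : GL (Fin n) Kb) • P.1, by
    obtain ⟨g, hg, hx⟩ := P.2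
    refine ⟨j * g, by rw [← hg]; rfl, ?_⟩
    have hj : (j : GL (Fin n) Kb)⁻¹ * b * frob σ j = b := j.2
    have e : ((j : GL (Fin n) Kb) * g)⁻¹ * b * frob σ ((j : GL (Fin n) Kb) * g)
        = g⁻¹ * ((j : GL (Fin n) Kb)⁻¹ * b * frob σ j) * frob σ g := by
      rw [map_mul]; group
    rw [e, hj]
    exact hx⟩
  one_smul P := Subtype.ext (one_smul _ P.1)
  mul_smul j k P := Subtype.ext (mul_smul (j : GL (Fin n) Kb) (k : GL (Fin n) Kb) P.1)

/-- The projection `gH ↦ gH'` for `H ≤ H'`. -/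
def dlProj (σ : Kb ≃ₐ[K] Kb) {H H' : Subgroup (GL (Fin n) Kb)} (h : H ≤ H')
    (x b : GL (Fin n) Kb) (P : dlSet σ H x b) : dlSet σ H' x b :=
  ⟨Subgroup.quotientMapOfLE h P.1, by
    obtain ⟨g, hg, hx⟩ := P.2
    refine ⟨g, by rw [← hg]; rfl, ?_⟩
    obtain ⟨u, hu, v, hv, e⟩ := DoubleCoset.mem_doubleCoset.1 hx
    exact DoubleCoset.mem_doubleCoset.2 ⟨u, h hu, v, h hv, e⟩⟩

/-- Right multiplication `gH ↦ gtH` by an element `t` normalizing `H`. -/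
def rightMul {H : Subgroup (GL (Fin n) Kb)} (t : GL (Fin n) Kb)
    (ht : ∀ h ∈ H, t⁻¹ * h * t ∈ H) : GL (Fin n) Kb ⧸ H → GL (Fin n) Kb ⧸ H :=
  Quotient.map' (fun g => g * t) fun g g' h => by
    rw [QuotientGroup.leftRel_apply] at h ⊢
    have e : (g * t)⁻¹ * (g' * t) = t⁻¹ * (g⁻¹ * g') * t := by group
    rw [e]
    exact ht _ h

theorem rightMul_mem {σ : Kb ≃ₐ[K] Kb} {H : Subgroup (GL (Fin n) Kb)} {x b t : GL (Fin n) Kb}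
    (ht : ∀ h ∈ H, t⁻¹ * h * t ∈ H) (ht' : ∀ h ∈ H, (frob σ t)⁻¹ * h * frob σ t ∈ H)
    (hx : t⁻¹ * x * frob σ t = x) {P : GL (Fin n) Kb ⧸ H} (hP : P ∈ dlSet σ H x b) :
    rightMul t ht P ∈ dlSet σ H x b := by
  obtain ⟨g, rfl, h⟩ := hP
  obtain ⟨u, hu, v, hv, e⟩ := DoubleCoset.mem_doubleCoset.1 h
  refine ⟨g * t, rfl, DoubleCoset.mem_doubleCoset.2
    ⟨t⁻¹ * u * t, ht u hu, (frob σ t)⁻¹ * v * frob σ t, ht' v hv, ?_⟩⟩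
  have e1 : (g * t)⁻¹ * b * frob σ (g * t) = t⁻¹ * (g⁻¹ * b * frob σ g) * frob σ t := by
    rw [map_mul]; group
  rw [e1, e]
  conv_rhs => rw [← hx]
  group

/-! ### The admissible subset of the isocrystal `(V, bσ)` -/

/-- The operator `bσ` on `V = K̆ⁿ`. -/
def bsig (σ : Kb ≃ₐ[K] Kb) (b : GL (Fin n) Kb) (x : Fin n → Kb) : Fin n → Kb :=
  b.val *ᵥ fun i => σ (x i)

/-- The matrix `g_b(x)` with columns `x, bσ(x), …, (bσ)^(n-1)(x)`. -/
def gb (σ : Kb ≃ₐ[K] Kb) (b : GL (Fin n) Kb) (x : Fin n → Kb) : Matrix (Fin n) (Fin n) Kb :=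
  Matrix.of fun i j => ((bsig σ b)^[j] x) i

/-- `V_b^adm`. -/
def Vadm (σ : Kb ≃ₐ[K] Kb) (b : GL (Fin n) Kb) : Set (Fin n → Kb) :=
  {x | (gb σ b x).det ≠ 0}

/-- `V_b^{adm,rat}`. -/
def VadmRat (σ : Kb ≃ₐ[K] Kb) (b : GL (Fin n) Kb) : Set (Fin n → Kb) :=
  {x | ∃ d : K, d ≠ 0 ∧ (gb σ b x).det = algebraMap K Kb d}

theorem VadmRat_subset (σ : Kb ≃ₐ[K] Kb) (b : GL (Fin n) Kb) : VadmRat σ b ⊆ Vadm σ b := by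
  rintro x ⟨d, hd, h⟩
  change (gb σ b x).det ≠ 0
  rw [h]
  exact (map_ne_zero _).2 hd

/-- The inclusion of `V_b^{adm,rat}` in `V_b^adm`. -/
def VadmRat.toVadm {σ : Kb ≃ₐ[K] Kb} {b : GL (Fin n) Kb} (x : VadmRat σ b) : Vadm σ b :=
  ⟨x.1, VadmRat_subset σ b x.2⟩

/-- The matrix `g_{b,r}(x)` whose `i`-th column is `ϖ^(r(i-1)) (bσ)^(i-1)(x)`. -/
def gbr (σ : Kb ≃ₐ[K] Kb) (ϖ : Kbˣ) (b : GL (Fin n) Kb) (r : ℕ) (x : Fin n → Kb) :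
    Matrix (Fin n) (Fin n) Kb :=
  Matrix.of fun i j => (ϖ : Kb) ^ (r * (j : ℕ)) * ((bsig σ b)^[j] x) i

theorem gbr_eq (σ : Kb ≃ₐ[K] Kb) (ϖ : Kbˣ) (b : GL (Fin n) Kb) (r : ℕ) (x : Fin n → Kb) :
    gbr σ ϖ b r x = gb σ b x * Matrix.diagonal fun j : Fin n => (ϖ : Kb) ^ (r * (j : ℕ)) := by
  ext i j
  rw [Matrix.mul_diagonal, mul_comm]
  rfl

/-- `g_{b,r}(x)` as an element of `GL_n(K̆)`, for `x ∈ V_b^adm`. -/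
def gbrGL (σ : Kb ≃ₐ[K] Kb) (ϖ : Kbˣ) (b : GL (Fin n) Kb) (r : ℕ) (x : Vadm σ b) :
    GL (Fin n) Kb :=
  Matrix.GeneralLinearGroup.mkOfDetNeZero (gbr σ ϖ b r x) (by
    rw [gbr_eq, Matrix.det_mul, Matrix.det_diagonal]
    exact mul_ne_zero x.2 (Finset.prod_ne_zero_iff.2 fun j _ => pow_ne_zero _ ϖ.ne_zero))

theorem coe_gbrGL (σ : Kb ≃ₐ[K] Kb) (ϖ : Kbˣ) (b : GL (Fin n) Kb) (r : ℕ) (x : Vadm σ b) :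
    (gbrGL σ ϖ b r x).val = gbr σ ϖ b r x := rfl

theorem Jb.bsig {σ : Kb ≃ₐ[K] Kb} {b : GL (Fin n) Kb} (g : Jb σ b) (x : Fin n → Kb) :
    bsig σ b (g.1.val *ᵥ x) = g.1.val *ᵥ bsig σ b x := by
  have hg : g.1⁻¹ * b * frob σ g.1 = b := g.2
  have h : b * frob σ g.1 = g.1 * b := by
    rw [mul_assoc, inv_mul_eq_iff_eq_mul] at hg
    exact hg
  have h1 : (fun i => σ ((g.1.val *ᵥ x) i)) = (frob σ g.1).val *ᵥ fun i => σ (x i) := by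
    ext i
    simp only [Matrix.mulVec, dotProduct, map_sum, map_mul]
    rfl
  rw [CoxeterDL.bsig, CoxeterDL.bsig, h1, Matrix.mulVec_mulVec, Matrix.mulVec_mulVec,
    ← Units.val_mul, ← Units.val_mul, h]

theorem Jb.bsig_iterate {σ : Kb ≃ₐ[K] Kb} {b : GL (Fin n) Kb} (g : Jb σ b) (j : ℕ)
    (x : Fin n → Kb) :
    (CoxeterDL.bsig σ b)^[j] (g.1.val *ᵥ x) = g.1.val *ᵥ (CoxeterDL.bsig σ b)^[j] x := by
  induction j with
  | zero => rfl
  | succ j ih => rw [Function.iterate_succ_apply', Function.iterate_succ_apply', ih, Jb.bsig]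

theorem Jb.gbr {σ : Kb ≃ₐ[K] Kb} {b : GL (Fin n) Kb} (g : Jb σ b) (ϖ : Kbˣ) (r : ℕ)
    (x : Fin n → Kb) : gbr σ ϖ b r (g.1.val *ᵥ x) = g.1.val * gbr σ ϖ b r x := by
  ext i j
  rw [CoxeterDL.gbr, Matrix.of_apply, Jb.bsig_iterate, Matrix.mul_apply, Matrix.mulVec,
    dotProduct, Finset.mul_sum]
  refine Finset.sum_congr rfl fun k _ => ?_
  rw [CoxeterDL.gbr, Matrix.of_apply]
  ring

theorem gb_eq_gbr (σ : Kb ≃ₐ[K] Kb) (b : GL (Fin n) Kb) (x : Fin n → Kb) :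
    gb σ b x = gbr σ 1 b 0 x := by
  ext i j
  simp [gb, gbr]

/-- `J_b(K)` acts on `V_b^adm`. -/
instance (σ : Kb ≃ₐ[K] Kb) (b : GL (Fin n) Kb) : MulAction (Jb σ b) (Vadm σ b) where
  smul g x := ⟨g.1.val *ᵥ x.1, by
    change (gb σ b (g.1.val *ᵥ x.1)).det ≠ 0
    rw [gb_eq_gbr, Jb.gbr, Matrix.det_mul, ← gb_eq_gbr]
    exact mul_ne_zero ((Matrix.isUnit_iff_isUnit_det _).1 g.1.isUnit).ne_zero x.2⟩
  one_smul x := Subtype.ext (Matrix.one_mulVec x.1)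
  mul_smul g h x := Subtype.ext (Matrix.mulVec_mulVec x.1 g.1.val h.1.val).symm

theorem Jb.gbrGL {σ : Kb ≃ₐ[K] Kb} {b : GL (Fin n) Kb} (g : Jb σ b) (ϖ : Kbˣ) (r : ℕ)
    (x : Vadm σ b) : gbrGL σ ϖ b r (g • x) = g.1 * gbrGL σ ϖ b r x :=
  Units.ext (Jb.gbr g ϖ r x.1)

/-- For `Γ ≤ K̆ˣ`, the relation on `V_b^adm` of differing by a scalar in `Γ`. -/
def scaleSetoid (σ : Kb ≃ₐ[K] Kb) (b : GL (Fin n) Kb) (Γ : Subgroup Kbˣ) :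
    Setoid (Vadm σ b) where
  r x y := ∃ a ∈ Γ, y.1 = (a : Kb) • x.1
  iseqv :=
    { refl := fun x => ⟨1, Γ.one_mem, by simp⟩
      symm := by
        rintro x y ⟨a, ha, h⟩
        exact ⟨a⁻¹, Γ.inv_mem ha, by rw [h, smul_smul, Units.inv_mul, one_smul]⟩
      trans := by
        rintro x y z ⟨a, ha, h⟩ ⟨a', ha', h'⟩
        exact ⟨a' * a, Γ.mul_mem ha' ha, by rw [h', h, smul_smul, Units.val_mul]⟩ }

/-- `V_b^adm / Γ`. -/
abbrev VadmMod (σ : Kb ≃ₐ[K] Kb) (b : GL (Fin n) Kb) (Γ : Subgroup Kbˣ) : Type _ :=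
  Quotient (scaleSetoid σ b Γ)

/-- `J_b(K)` acts on `V_b^adm / Γ`. -/
instance (σ : Kb ≃ₐ[K] Kb) (b : GL (Fin n) Kb) (Γ : Subgroup Kbˣ) :
    MulAction (Jb σ b) (VadmMod σ b Γ) where
  smul g := Quotient.map (g • ·) fun x y ⟨a, ha, e⟩ => ⟨a, ha, by
    change g.1.val *ᵥ y.1 = (a : Kb) • (g.1.val *ᵥ x.1)
    rw [e, Matrix.mulVec_smul]⟩
  one_smul q := Quotient.inductionOn q fun x => congrArg (Quotient.mk _) (one_smul _ x)
  mul_smul g h q := Quotient.inductionOn q fun x => congrArg (Quotient.mk _) (mul_smul g h x)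

/-- The class of an element of `V_b^adm` in `V_b^adm / Γ`. -/
def VadmMod.mk {σ : Kb ≃ₐ[K] Kb} {b : GL (Fin n) Kb} (Γ : Subgroup Kbˣ) (x : Vadm σ b) :
    VadmMod σ b Γ :=
  Quotient.mk _ x

/-- The projection `V_b^adm / Γ → V_b^adm / Γ'` for `Γ ≤ Γ'`. -/
def VadmMod.proj {σ : Kb ≃ₐ[K] Kb} {b : GL (Fin n) Kb} {Γ Γ' : Subgroup Kbˣ} (h : Γ ≤ Γ') :
    VadmMod σ b Γ → VadmMod σ b Γ' :=
  Quotient.map id fun _ _ ⟨a, ha, e⟩ => ⟨a, h ha, e⟩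

theorem bsig_smul (σ : Kb ≃ₐ[K] Kb) (b : GL (Fin n) Kb) (a : Kb) (x : Fin n → Kb) :
    bsig σ b (a • x) = σ a • bsig σ b x := by
  have h : (fun i => σ ((a • x) i)) = σ a • fun i => σ (x i) := by
    ext i; simp
  rw [bsig, h, Matrix.mulVec_smul, bsig]

theorem bsig_iterate_smul (σ : Kb ≃ₐ[K] Kb) (b : GL (Fin n) Kb) (a : Kb) (x : Fin n → Kb)
    (j : ℕ) : (bsig σ b)^[j] (a • x) = σ^[j] a • (bsig σ b)^[j] x := by
  induction j with
  | zero => rfl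
  | succ j ih =>
    rw [Function.iterate_succ_apply', Function.iterate_succ_apply',
      Function.iterate_succ_apply', ih, bsig_smul]

theorem gbr_smul (σ : Kb ≃ₐ[K] Kb) (ϖ : Kbˣ) (b : GL (Fin n) Kb) (r : ℕ) (a : Kb)
    (x : Fin n → Kb) :
    gbr σ ϖ b r (a • x) = gbr σ ϖ b r x * Matrix.diagonal fun j : Fin n => σ^[(j : ℕ)] a := by
  ext i j
  rw [Matrix.mul_diagonal, gbr, Matrix.of_apply, gbr, Matrix.of_apply, bsig_iterate_smul,
    Pi.smul_apply, smul_eq_mul]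
  ring

theorem smul_mem_Vadm {σ : Kb ≃ₐ[K] Kb} {b : GL (Fin n) Kb} (a : Kbˣ) {x : Fin n → Kb}
    (hx : x ∈ Vadm σ b) : (a : Kb) • x ∈ Vadm σ b := by
  have hσ : ∀ j : ℕ, σ^[j] (a : Kb) ≠ 0 := by
    intro j
    induction j with
    | zero => exact a.ne_zero
    | succ j ih =>
      rw [Function.iterate_succ_apply']
      exact (map_ne_zero σ).2 ih
  change (gb σ b ((a : Kb) • x)).det ≠ 0
  rw [gb_eq_gbr, gbr_smul, Matrix.det_mul, ← gb_eq_gbr,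
    Matrix.det_diagonal]
  exact mul_ne_zero hx (Finset.prod_ne_zero_iff.2 fun j _ => hσ j)

/-- Scaling by `K̆ˣ` on `V_b^adm`. -/
def scale {σ : Kb ≃ₐ[K] Kb} {b : GL (Fin n) Kb} (a : Kbˣ) (x : Vadm σ b) : Vadm σ b :=
  ⟨(a : Kb) • x.1, smul_mem_Vadm a x.2⟩

section Coxeter

variable [NeZero n]

theorem Tw.iterate {σ : Kb ≃ₐ[K] Kb} {t : Fin n → Kbˣ} (ht : t ∈ Tw σ) (j : Fin n) :
    σ^[(j : ℕ)] (t 0) = t j := by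
  obtain ⟨j, hj⟩ := j
  induction j with
  | zero => rfl
  | succ j ih =>
    have hj' : j < n := Nat.lt_of_succ_lt hj
    have h := ih hj'
    simp only at h ⊢
    rw [Function.iterate_succ_apply', h, Tw.frob_apply ht]
    congr 2
    refine Fin.ext ?_
    rw [Fin.val_add_one_of_lt']
    exact hj

theorem Tw.gbrGL {σ : Kb ≃ₐ[K] Kb} {b : GL (Fin n) Kb} {t : Fin n → Kbˣ} (ht : t ∈ Tw σ)
    (ϖ : Kbˣ) (r : ℕ) (x : Vadm σ b) :
    gbrGL σ ϖ b r (scale (t 0) x) = gbrGL σ ϖ b r x * diagGL t := by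
  refine Units.ext ?_
  rw [Units.val_mul, coe_gbrGL, coe_gbrGL, coe_diagGL]
  change gbr σ ϖ b r ((t 0 : Kb) • x.1) = _
  rw [gbr_smul]
  simp only [Tw.iterate ht]

/-! ### The semi-infinite Deligne-Lusztig sets -/

/-- `X_w^DL(b)`. The Weyl group element `w` is represented by its lift `ẇ_0`. -/
abbrev XDL (σ : Kb ≃ₐ[K] Kb) (ϖ : Kbˣ) (κ : ℕ) (b : GL (Fin n) Kb) : Type _ :=
  dlSet σ upperBorel (wdot ϖ κ 0) b

/-- `Ẋ_w^DL(b)`, formed with the lift `ẇ_0` of `w`. -/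
abbrev XDLdot (σ : Kb ≃ₐ[K] Kb) (ϖ : Kbˣ) (κ : ℕ) (b : GL (Fin n) Kb) : Type _ :=
  dlSet σ unip (wdot ϖ κ 0) b

/-- `T_w(K)` acts on `Ẋ_w^DL(b)` by right multiplication. -/
instance (σ : Kb ≃ₐ[K] Kb) (ϖ : Kbˣ) (κ : ℕ) (b : GL (Fin n) Kb) :
    MulAction (Tw (n := n) σ) (XDLdot σ ϖ κ b) where
  smul t P := ⟨rightMul (diagGL t.1) (fun _ => diagGL_conj_unip t.1) P.1,
    rightMul_mem _ (by rw [frob_diagGL]; exact fun _ => diagGL_conj_unip _)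
      (Tw.conj_wdot t.2 ϖ κ 0) P.2⟩
  one_smul P := by
    obtain ⟨P, hP⟩ := P
    refine Subtype.ext ?_
    induction P using QuotientGroup.induction_on with
    | H g => exact congrArg QuotientGroup.mk (by simp)
  mul_smul s t P := by
    obtain ⟨P, hP⟩ := P
    refine Subtype.ext ?_
    induction P using QuotientGroup.induction_on with
    | H g =>
      refine congrArg QuotientGroup.mk ?_
      change g * diagGL (s.1 * t.1) = g * diagGL t.1 * diagGL s.1
      rw [mul_comm s.1, map_mul, mul_assoc]

/-! ### Affine Deligne-Lusztig sets of finite and infinite level -/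

/-- The pairs `(r, m)` with `r > m ≥ 0`, ordered componentwise. -/
abbrev Level : Type := {p : ℕ × ℕ // p.2 < p.1}

/-- For a family of subgroups `H m`, the affine Deligne-Lusztig set of level `H m` attached to
`ẇ_r`. This is `X^m_{ẇ_r}(b)` for `H m = I^m` and `Ẋ^m_{ẇ_r}(b)` for `H m = İ^m`. -/
abbrev LevelSet (H : ℕ → Subgroup (GL (Fin n) Kb)) (σ : Kb ≃ₐ[K] Kb) (ϖ : Kbˣ) (κ : ℕ)
    (b : GL (Fin n) Kb) (p : Level) : Type _ :=
  dlSet σ (H p.1.2) (wdot ϖ κ p.1.1) b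

/-- The transition map from level `(r', m')` to level `(r, m)` is induced by
`g_{b,r'}(x) ↦ g_{b,r}(x)`: this is its graph. -/
def IsTransition (H : ℕ → Subgroup (GL (Fin n) Kb)) (σ : Kb ≃ₐ[K] Kb) (ϖ : Kbˣ) (κ : ℕ)
    (b : GL (Fin n) Kb) {p' p : Level} (P' : LevelSet H σ ϖ κ b p') (P : LevelSet H σ ϖ κ b p) :
    Prop :=
  ∃ x : Vadm σ b, P'.1 = (gbrGL σ ϖ b p'.1.1 x : GL (Fin n) Kb ⧸ H p'.1.2) ∧
    P.1 = (gbrGL σ ϖ b p.1.1 x : GL (Fin n) Kb ⧸ H p.1.2)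

/-- The inverse limit of the sets `LevelSet H σ ϖ κ b (r, m)` over all `r > m ≥ 0` along the
transition maps. -/
def LimitSet (H : ℕ → Subgroup (GL (Fin n) Kb)) (σ : Kb ≃ₐ[K] Kb) (ϖ : Kbˣ) (κ : ℕ)
    (b : GL (Fin n) Kb) : Type _ :=
  {P : ∀ p : Level, LevelSet H σ ϖ κ b p //
    ∀ p p' : Level, p ≤ p' → IsTransition H σ ϖ κ b (P p') (P p)}

/-- `J_b(K)` acts on the inverse limit by left multiplication. -/
instance (H : ℕ → Subgroup (GL (Fin n) Kb)) (σ : Kb ≃ₐ[K] Kb) (ϖ : Kbˣ) (κ : ℕ)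
    (b : GL (Fin n) Kb) : MulAction (Jb σ b) (LimitSet H σ ϖ κ b) where
  smul g P := ⟨fun p => g • P.1 p, fun p p' h => by
    obtain ⟨x, h', h⟩ := P.2 p p' h
    refine ⟨g • x, ?_, ?_⟩
    · rw [Jb.gbrGL]
      exact congrArg (g.1 • ·) h'
    · rw [Jb.gbrGL]
      exact congrArg (g.1 • ·) h⟩
  one_smul P := Subtype.ext (funext fun p => one_smul _ (P.1 p))
  mul_smul g h P := Subtype.ext (funext fun p => mul_smul g h (P.1 p))

/-- The map of inverse limits induced by the projections, if `H m ≤ H' m` for all `m`. -/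
def LimitSet.proj {H H' : ℕ → Subgroup (GL (Fin n) Kb)} (hH : ∀ m, H m ≤ H' m)
    {σ : Kb ≃ₐ[K] Kb} {ϖ : Kbˣ} {κ : ℕ} {b : GL (Fin n) Kb} (P : LimitSet H σ ϖ κ b) :
    LimitSet H' σ ϖ κ b :=
  ⟨fun p => dlProj σ (hH p.1.2) _ _ (P.1 p), fun p p' h => by
    obtain ⟨x, h', h⟩ := P.2 p p' h
    exact ⟨x, congrArg (Subgroup.quotientMapOfLE (hH _)) h',
      congrArg (Subgroup.quotientMapOfLE (hH _)) h⟩⟩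

/-- `X_w^∞(b)`. -/
abbrev Xinf [ValuativeRel Kb] (σ : Kb ≃ₐ[K] Kb) (ϖ : Kbˣ) (κ : ℕ) (b : GL (Fin n) Kb) :
    Type _ :=
  LimitSet iwahoriLevel σ ϖ κ b

/-- `Ẋ_w^∞(b)`. -/
abbrev XinfDot [ValuativeRel Kb] (σ : Kb ≃ₐ[K] Kb) (ϖ : Kbˣ) (κ : ℕ) (b : GL (Fin n) Kb) :
    Type _ :=
  LimitSet iwahoriDotLevel σ ϖ κ b

theorem TwInt.coord {σ : Kb ≃ₐ[K] Kb} [ValuativeRel Kb] {t : Fin n → Kbˣ} (ht : t ∈ TwInt σ)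
    (i : Fin n) : t i ∈ intUnits Kb :=
  ht.2 i (Set.mem_univ i)

theorem TwInt.frobT_coord {σ : Kb ≃ₐ[K] Kb} [ValuativeRel Kb] {t : Fin n → Kbˣ}
    (ht : t ∈ TwInt σ) (i : Fin n) : frobT σ t i ∈ intUnits Kb := by
  have h : frobT σ t i = t (i + 1) := Units.ext (Tw.frob_apply ht.1 i)
  rw [h]
  exact TwInt.coord ht _

/-- `T_w(𝒪_K)` acts on `Ẋ^m_{ẇ_r}(b)` by right multiplication. -/
instance [ValuativeRel Kb] (σ : Kb ≃ₐ[K] Kb) (ϖ : Kbˣ) (κ : ℕ) (b : GL (Fin n) Kb)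
    (p : Level) : MulAction (TwInt (n := n) σ) (LevelSet iwahoriDotLevel σ ϖ κ b p) where
  smul t P := ⟨rightMul (diagGL t.1)
      (fun _ => diagGL_conj_iwahoriDotLevel (TwInt.coord t.2)) P.1,
    rightMul_mem _
      (by rw [frob_diagGL]; exact fun _ => diagGL_conj_iwahoriDotLevel (TwInt.frobT_coord t.2))
      (Tw.conj_wdot t.2.1 ϖ κ _) P.2⟩
  one_smul P := by
    obtain ⟨P, hP⟩ := P
    refine Subtype.ext ?_
    induction P using QuotientGroup.induction_on with
    | H g => exact congrArg QuotientGroup.mk (by simp)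
  mul_smul s t P := by
    obtain ⟨P, hP⟩ := P
    refine Subtype.ext ?_
    induction P using QuotientGroup.induction_on with
    | H g =>
      refine congrArg QuotientGroup.mk ?_
      change g * diagGL (s.1 * t.1) = g * diagGL t.1 * diagGL s.1
      rw [mul_comm s.1, map_mul, mul_assoc]

/-- `T_w(𝒪_K)` acts on `Ẋ_w^∞(b)` by right multiplication. -/
instance [ValuativeRel Kb] (σ : Kb ≃ₐ[K] Kb) (ϖ : Kbˣ) (κ : ℕ) (b : GL (Fin n) Kb) :
    MulAction (TwInt (n := n) σ) (XinfDot σ ϖ κ b) where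
  smul t P := ⟨fun p => t • P.1 p, fun p p' h => by
    obtain ⟨x, h', h⟩ := P.2 p p' h
    refine ⟨scale (t.1 0) x, ?_, ?_⟩
    · rw [Tw.gbrGL t.2.1]
      exact congrArg (rightMul (diagGL t.1)
        fun _ => diagGL_conj_iwahoriDotLevel (TwInt.coord t.2)) h'
    · rw [Tw.gbrGL t.2.1]
      exact congrArg (rightMul (diagGL t.1)
        fun _ => diagGL_conj_iwahoriDotLevel (TwInt.coord t.2)) h⟩
  one_smul P := Subtype.ext (funext fun p => one_smul _ (P.1 p))
  mul_smul s t P := Subtype.ext (funext fun p => mul_smul s t (P.1 p))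

end Coxeter

end Main

end CoxeterDL

end

open CoxeterDL

noncomputable section

namespace CoxeterDL

/-! Everything rests on cyclic vectors. In the basis formed by the columns of `g`, the operator `bσ`
has matrix `g⁻¹ b σ(g)`. For `g = g_{b,r}(x)` this matrix is `ẇ_r` times a companion matrix
(`cyclicPart_eq`), with `1` on the diagonal except for the last entry `detPart`. The entries above
that one are the coefficients of `(bσ)^n x` in the basis `x, bσ(x), …`, multiplied by positive
multiples of `r` as powers of `ϖ`. Since `b` is basic with determinant of nonnegative order, the
iterates of `bσ` are bounded, and this forces these coefficients to be integral
(`val_coeff_le_one`). Hence every admissible `x` gives a point of `X_w^DL(b)` and of all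
`X^m_{ẇ_r}(b)`. For the dotted sets the only obstruction is the determinant `detPart`: it must be
`1`, or congruent to `1` at finite level.

Conversely, suppose `g⁻¹ b σ(g) = ẇ_r i` with `i ∈ H`, where `H` is one of the groups `B`, `U`,
`I^m`, `İ^m`. Up to powers of `ϖ`, `ẇ_r` shifts columns cyclically, so `g⁻¹ g_{b,r}(g e_1)` again
lies in `H` (`hasEntries_gbr`). Thus every point is the class of some `g_{b,r}(x)`. The structure
`IsLevel` treats the four kinds of groups together. Two vectors `x, y` with the same class satisfy
`y = g_{b,r}(x) z`, where `z` is the first column of an element of `H`. For `B` and `U` this makes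
them proportional. For Iwahori levels it gives well-defined transition maps, and in the limit
proportionality again (`exists_smul_of_eq`). Surjectivity onto the limit follows by choosing
representatives successively closer to each other; their cyclic bases differ by integral matrices,
so the vectors converge (`exists_eq_toLimit`).

Finally, `det b · σ(det g_b(x)) = det g_b(x) · det ẇ_0 · detPart(x)`, so rationality of `det g_b(x)`
says that `detPart(x) = det b / det ẇ_0`. Scaling `x` by `a` multiplies `detPart` by `σ^n(a)/a`.
Lang's theorem for `σ^n` therefore yields the constant `c` and the surjectivity of the vertical
maps, and the scalars preserving `detPart = 1` are those in `Lˣ = T_w(K)`. -/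

theorem exists_seq_of_step {α : Type*} {P : ℕ → α → Prop} {R : ℕ → α → α → Prop}
    (h0 : ∃ a, P 0 a) (hs : ∀ k a, P k a → ∃ a', P (k + 1) a' ∧ R k a a') :
    ∃ f : ℕ → α, ∀ k, P k (f k) ∧ R k (f k) (f (k + 1)) := by
  choose! s hs using hs
  obtain ⟨a, ha⟩ := h0
  let f : ℕ → α := fun k => Nat.rec a (fun k a => s k a) k
  have hf : ∀ k, P k (f k) := by
    intro k
    induction k with
    | zero => exact ha
    | succ k ih => exact (hs k _ ih).1
  exact ⟨f, fun k => ⟨hf k, (hs k _ (hf k)).2⟩⟩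

/-! ### Valuation rings: powers of the maximal ideal, limits, residues -/

section ValuationRing

variable {F : Type*} [Field F] [ValuativeRel F]

theorem mem_maximalIdeal_iff {x : 𝒪[F]} : x ∈ 𝓂[F] ↔ valuation F (x : F) < 1 := by
  rw [IsLocalRing.mem_maximalIdeal, mem_nonunits_iff,
    (Valuation.integer.integers (valuation F)).isUnit_iff_valuation_eq_one]
  exact ⟨fun h => lt_of_le_of_ne x.2 h, fun h => h.ne⟩

/-- An element of largest value below `1` generates the maximal ideal, because divisibility in the
valuation ring is comparison of values. -/
theorem mem_maximalIdeal_pow_iff {p : F} (hp : valuation F p < 1)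
    (hmax : ∀ x : F, valuation F x < 1 → valuation F x ≤ valuation F p) (m : ℕ) {x : 𝒪[F]} :
    x ∈ 𝓂[F] ^ m ↔ valuation F (x : F) ≤ valuation F p ^ m := by
  have hI := Valuation.integer.integers (valuation F)
  have e : 𝓂[F] = Ideal.span {(⟨p, hp.le⟩ : 𝒪[F])} := by
    ext y
    rw [mem_maximalIdeal_iff, Ideal.mem_span_singleton, hI.dvd_iff_le]
    exact ⟨hmax _, fun h => h.trans_lt hp⟩
  rw [e, Ideal.span_singleton_pow, Ideal.mem_span_singleton, hI.dvd_iff_le, ← map_pow]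
  rfl

/-- Bounds on consecutive differences already give the Cauchy condition, by the ultrametric
inequality. This is the form in which adic completeness serves successive approximation. -/
theorem exists_limit [IsAdicComplete 𝓂[F] 𝒪[F]] {p : F} (hp : valuation F p < 1)
    (hmax : ∀ x : F, valuation F x < 1 → valuation F x ≤ valuation F p) (f : ℕ → F)
    (h0 : ∀ k, valuation F (f k) ≤ 1)
    (hf : ∀ k, valuation F (f (k + 1) - f k) ≤ valuation F p ^ k) :
    ∃ l : F, ∀ k, valuation F (l - f k) ≤ valuation F p ^ k := by
  have hmn : ∀ m n, m ≤ n → valuation F (f n - f m) ≤ valuation F p ^ m := by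
    intro m n hmn
    induction n, hmn using Nat.le_induction with
    | base => simp
    | succ n hn ih =>
      have e : f (n + 1) - f m = (f (n + 1) - f n) + (f n - f m) := by ring
      rw [e]
      exact Valuation.map_add_le _ ((hf n).trans (pow_le_pow_right_of_le_one' hp.le hn)) ih
  obtain ⟨l, hl⟩ := IsPrecomplete.prec (inferInstance : IsPrecomplete 𝓂[F] 𝒪[F])
    (f := fun k => (⟨f k, h0 k⟩ : 𝒪[F])) (by
      intro m n h
      rw [SModEq.comm, SModEq.sub_mem, smul_eq_mul, Ideal.mul_top,
        mem_maximalIdeal_pow_iff hp hmax]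
      exact hmn m n h)
  refine ⟨l, fun k => ?_⟩
  have h := (hl k).symm
  rw [SModEq.sub_mem, smul_eq_mul, Ideal.mul_top, mem_maximalIdeal_pow_iff hp hmax] at h
  exact h

theorem residue_eq_iff {x y : 𝒪[F]} :
    IsLocalRing.residue 𝒪[F] x = IsLocalRing.residue 𝒪[F] y ↔
      valuation F ((x : F) - y) < 1 := by
  rw [← sub_eq_zero, ← map_sub, IsLocalRing.residue_eq_zero_iff, mem_maximalIdeal_iff]
  rfl

end ValuationRing

/-- The properties of the valued field `K̆` and its Frobenius `σ` over `K` which are used in the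
study of Deligne-Lusztig sets; `lang` is Lang's theorem for the powers of `σ`. -/
structure UnramifiedFrobenius {K Kb : Type*} [Field K] [Field Kb] [ValuativeRel Kb]
    [Algebra K Kb] (σ : Kb ≃ₐ[K] Kb) (ϖ : Kbˣ) : Prop where
  val_lt_one : valuation Kb (ϖ : Kb) < 1
  val_le : ∀ x : Kb, valuation Kb x < 1 → valuation Kb x ≤ valuation Kb (ϖ : Kb)
  archimedean : ∀ x : Kb, x ≠ 0 → ∃ N : ℕ, valuation Kb (ϖ : Kb) ^ N < valuation Kb x
  frob_unif : σ (ϖ : Kb) = ϖ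
  val_frob : ∀ x : Kb, valuation Kb (σ x) = valuation Kb x
  complete : ∀ f : ℕ → Kb, (∀ k, valuation Kb (f k) ≤ 1) →
    (∀ k, valuation Kb (f (k + 1) - f k) ≤ valuation Kb (ϖ : Kb) ^ k) →
    ∃ l : Kb, ∀ k, valuation Kb (l - f k) ≤ valuation Kb (ϖ : Kb) ^ k
  lang : ∀ n : ℕ, n ≠ 0 → ∀ u : Kb, valuation Kb u = 1 →
    ∃ c : Kb, valuation Kb c = 1 ∧ σ^[n] c = u * c
  fixed : ∀ x : Kb, σ x = x → ∃ y : K, algebraMap K Kb y = x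

/-! ### Lang's theorem and the fixed field of Frobenius -/

section Base

variable {K : Type*} [Field K] [ValuativeRel K]
  {Kb : Type*} [Field Kb] [ValuativeRel Kb] [Algebra K Kb]

variable {σ : Kb ≃ₐ[K] Kb} {ϖ : Kbˣ}

theorem IsFrobenius.val_le_one (hσ : IsFrobenius K σ) {x : Kb} (hx : valuation Kb x ≤ 1) :
    valuation Kb (σ x) ≤ 1 := by
  have e : σ x = (σ x - x ^ Nat.card 𝓀[K]) + x ^ Nat.card 𝓀[K] := by ring
  rw [e]
  exact Valuation.map_add_le _ (hσ x hx).le (by rw [map_pow]; exact pow_le_one' hx _)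
theorem IsFrobenius.iterate (hσ : IsFrobenius K σ) (n : ℕ) {x : Kb} (hx : valuation Kb x ≤ 1) :
    valuation Kb (σ^[n] x) ≤ 1 ∧
      valuation Kb (σ^[n] x - x ^ (Nat.card 𝓀[K]) ^ n) < 1 := by
  induction n with
  | zero => simpa using hx
  | succ n ih =>
    rw [Function.iterate_succ_apply']
    refine ⟨hσ.val_le_one ih.1, ?_⟩
    set y := σ^[n] x
    have h1 := hσ y ih.1
    have h2 : valuation Kb (y ^ Nat.card 𝓀[K] - (x ^ (Nat.card 𝓀[K]) ^ n) ^ Nat.card 𝓀[K]) < 1 := by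
      have hxn : valuation Kb (x ^ (Nat.card 𝓀[K]) ^ n) ≤ 1 := by
        rw [map_pow]; exact pow_le_one' hx _
      have := (residue_eq_iff (x := ⟨y, ih.1⟩) (y := ⟨_, hxn⟩)).2 ih.2
      have h3 := congrArg (· ^ Nat.card 𝓀[K]) this
      simp only [← map_pow] at h3
      exact residue_eq_iff.1 h3
    have e : σ y - x ^ (Nat.card 𝓀[K]) ^ (n + 1)
        = (σ y - y ^ Nat.card 𝓀[K])
          + (y ^ Nat.card 𝓀[K] - (x ^ (Nat.card 𝓀[K]) ^ n) ^ Nat.card 𝓀[K]) := by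
      rw [pow_succ, pow_mul]; ring
    rw [e]
    exact Valuation.map_add_lt _ h1 h2

/-- This is the equation for the next digit in Lang's theorem. Its reduction is a nonconstant
polynomial over the algebraically closed residue field. -/
theorem exists_pow_sub_mul_add_lt_one (hmax : IsAlgClosed 𝓀[Kb]) {q : ℕ} (hq : 2 ≤ q) {u e : Kb}
    (hu : valuation Kb u ≤ 1) (he : valuation Kb e ≤ 1) :
    ∃ z : Kb, valuation Kb z ≤ 1 ∧ valuation Kb (z ^ q - u * z + e) < 1 := by
  let u' : 𝓀[Kb] := IsLocalRing.residue _ ⟨u, hu⟩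
  let e' : 𝓀[Kb] := IsLocalRing.residue _ ⟨e, he⟩
  let P : Polynomial 𝓀[Kb] := Polynomial.X ^ q - Polynomial.C u' * Polynomial.X + Polynomial.C e'
  have hcoeff : P.coeff q = 1 := by
    have h1 : q ≠ 0 := by omega
    have h2 : 1 ≠ q := by omega
    simp [P, Polynomial.coeff_X, Polynomial.coeff_C, h1, h2]
  have hdeg : P.degree ≠ 0 := by
    have h := Polynomial.le_degree_of_ne_zero (p := P) (n := q) (by rw [hcoeff]; exact one_ne_zero)
    intro h0
    rw [h0] at h
    have : q ≤ 0 := by exact_mod_cast h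
    omega
  obtain ⟨z, hz⟩ := IsAlgClosed.exists_root P hdeg
  obtain ⟨z, rfl⟩ := IsLocalRing.residue_surjective z
  refine ⟨z, z.2, ?_⟩
  simp only [P, u', e', Polynomial.IsRoot.def, Polynomial.eval_add, Polynomial.eval_sub,
    Polynomial.eval_pow, Polynomial.eval_X, Polynomial.eval_mul, Polynomial.eval_C, ← map_pow,
    ← map_mul, ← map_sub, ← map_add] at hz
  rw [IsLocalRing.residue_eq_zero_iff, mem_maximalIdeal_iff] at hz
  exact hz


variable [ValuativeExtension K Kb]

theorem valuation_algebraMap_le_iff {x y : K} :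
    valuation Kb (algebraMap K Kb x) ≤ valuation Kb (algebraMap K Kb y) ↔
      valuation K x ≤ valuation K y := by
  rw [← Valuation.Compatible.vle_iff_le (v := valuation Kb), ValuativeExtension.vle_iff_vle,
    Valuation.Compatible.vle_iff_le (v := valuation K)]

theorem valuation_algebraMap_lt_iff {x y : K} :
    valuation Kb (algebraMap K Kb x) < valuation Kb (algebraMap K Kb y) ↔
      valuation K x < valuation K y := by
  rw [← not_le, valuation_algebraMap_le_iff, not_le]

theorem valuation_algebraMap_le_one_iff {x : K} :
    valuation Kb (algebraMap K Kb x) ≤ 1 ↔ valuation K x ≤ 1 := by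
  simpa using valuation_algebraMap_le_iff (Kb := Kb) (x := x) (y := 1)

theorem valuation_algebraMap_lt_one_iff {x : K} :
    valuation Kb (algebraMap K Kb x) < 1 ↔ valuation K x < 1 := by
  simpa using valuation_algebraMap_lt_iff (Kb := Kb) (x := x) (y := 1)

/-- A unit and its inverse both stay integral under `σ`, so units go to units. Every value is
attained on `K`, which `σ` fixes pointwise. -/
theorem IsFrobenius.val_frob (hKb : IsCompletedMaximalUnramified K Kb) (hσ : IsFrobenius K σ)
    (x : Kb) : valuation Kb (σ x) = valuation Kb x := by
  by_cases hx : x = 0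
  · simp [hx]
  have h1 : ∀ u : Kb, valuation Kb u = 1 → valuation Kb (σ u) = 1 := by
    intro u hu
    refine le_antisymm (hσ.val_le_one hu.le) ?_
    have h := hσ.val_le_one (x := u⁻¹) (by rw [map_inv₀, hu, inv_one])
    rw [map_inv₀, map_inv₀] at h
    have hu0 : valuation Kb (σ u) ≠ 0 := by
      rw [map_ne_zero, map_ne_zero]
      rintro rfl
      simp at hu
    exact (inv_le_one₀ (zero_lt_iff.2 hu0)).1 h
  obtain ⟨y, hy⟩ := hKb.unramified x
  have hx' : valuation Kb x ≠ 0 := (map_ne_zero _).2 hx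
  have h := h1 (x / algebraMap K Kb y) (by rw [map_div₀, ← hy, div_self hx'])
  rw [map_div₀, AlgEquiv.commutes, map_div₀, ← hy, div_eq_one_iff_eq hx'] at h
  exact h

theorem IsFrobenius.val_frob_iterate (hKb : IsCompletedMaximalUnramified K Kb)
    (hσ : IsFrobenius K σ) (n : ℕ) (x : Kb) :
    valuation Kb (σ^[n] x) = valuation Kb x := by
  induction n with
  | zero => rfl
  | succ n ih => rw [Function.iterate_succ_apply', hσ.val_frob hKb, ih]

variable [TopologicalSpace K] [IsNonarchimedeanLocalField K]

theorem two_le_card_residue : 2 ≤ Nat.card 𝓀[K] := by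
  have := Fintype.ofFinite 𝓀[K]
  rw [Nat.card_eq_fintype_card]
  exact Fintype.one_lt_card

theorem IsUniformizerOf.val_lt_one (hϖ : IsUniformizerOf K ϖ) :
    valuation Kb (ϖ : Kb) < 1 := by
  obtain ⟨p, hp, hv⟩ := hϖ
  rw [← hp, valuation_algebraMap_lt_one_iff, hv]
  exact uniformizer_lt_one

theorem IsUniformizerOf.val_le (hKb : IsCompletedMaximalUnramified K Kb)
    (hϖ : IsUniformizerOf K ϖ) (x : Kb) (hx : valuation Kb x < 1) :
    valuation Kb x ≤ valuation Kb (ϖ : Kb) := by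
  obtain ⟨p, hp, hv⟩ := hϖ
  obtain ⟨y, hy⟩ := hKb.unramified x
  rw [hy] at hx ⊢
  rw [← hp, valuation_algebraMap_le_iff, hv, le_uniformizer_iff]
  exact valuation_algebraMap_lt_one_iff.1 hx

theorem IsUniformizerOf.archimedean (hKb : IsCompletedMaximalUnramified K Kb)
    (hϖ : IsUniformizerOf K ϖ) (x : Kb) (hx : x ≠ 0) :
    ∃ N : ℕ, valuation Kb (ϖ : Kb) ^ N < valuation Kb x := by
  obtain ⟨p, hp, hv⟩ := hϖ
  obtain ⟨y, hy⟩ := hKb.unramified x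
  have hy0 : y ≠ 0 := by
    rintro rfl
    rw [map_zero, map_zero, map_eq_zero] at hy
    exact hx hy
  have hp1 : valuation K p < 1 := hv ▸ uniformizer_lt_one
  obtain ⟨N, hN⟩ := exists_pow_lt₀ hp1 (Units.mk0 (valuation K y) ((map_ne_zero _).2 hy0))
  refine ⟨N, ?_⟩
  rw [hy, ← hp, ← map_pow, ← map_pow, valuation_algebraMap_lt_iff, map_pow]
  exact hN

/-- Successive approximation: modulo `ϖ` a solution is a `(q - 1)`-th root of `u`. If the error at
`c` is `ϖ ^ (k + 1) * e`, the correction `ϖ ^ (k + 1) * z` changes it to `ϖ ^ (k + 1) * (z ^ q - u *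
z + e)` up to a multiple of `ϖ ^ (k + 2)`, so `z` has only to solve an equation in the residue
field. -/
theorem exists_iterate_frob_eq_mul (hKb : IsCompletedMaximalUnramified K Kb)
    (hσ : IsFrobenius K σ) (hϖ : IsUniformizerOf K ϖ) (n : ℕ) (hn : n ≠ 0) (u : Kb)
    (hu : valuation Kb u = 1) : ∃ c : Kb, valuation Kb c = 1 ∧ σ^[n] c = u * c := by
  have hp := hϖ.val_lt_one
  have hmax := hϖ.val_le hKb
  have hcompl := hKb.complete
  have hσϖ : ∀ k : ℕ, σ^[n] ((ϖ : Kb) ^ k) = (ϖ : Kb) ^ k := by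
    intro k
    obtain ⟨p, hp, -⟩ := hϖ
    rw [← hp, ← map_pow]
    exact Function.iterate_fixed (AlgEquiv.commutes σ _) n
  have hq : 2 ≤ Nat.card 𝓀[K] ^ n := two_le_card_residue.trans (Nat.le_self_pow hn _)
  set q := Nat.card 𝓀[K] ^ n
  have hadd : ∀ x y : Kb, σ^[n] (x + y) = σ^[n] x + σ^[n] y := fun x y => iterate_map_add σ n x y
  have hmul : ∀ x y : Kb, σ^[n] (x * y) = σ^[n] x * σ^[n] y := fun x y => iterate_map_mul σ n x y
  obtain ⟨f, hf⟩ := exists_seq_of_step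
    (P := fun k c => valuation Kb c = 1 ∧
      valuation Kb (σ^[n] c - u * c) ≤ valuation Kb (ϖ : Kb) ^ (k + 1))
    (R := fun k c c' => valuation Kb (c' - c) ≤ valuation Kb (ϖ : Kb) ^ k) (by
      have := hKb.maximal
      obtain ⟨z, hz⟩ := IsAlgClosed.exists_pow_nat_eq
        (IsLocalRing.residue 𝒪[Kb] ⟨u, hu.le⟩) (n := q - 1) (by omega)
      obtain ⟨z, rfl⟩ := IsLocalRing.residue_surjective z
      have hz1 : valuation Kb (z : Kb) = 1 := by
        refine le_antisymm z.2 (not_lt.1 fun h => ?_)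
        rw [← mem_maximalIdeal_iff, ← IsLocalRing.residue_eq_zero_iff] at h
        rw [h, zero_pow (by omega), eq_comm, IsLocalRing.residue_eq_zero_iff,
          mem_maximalIdeal_iff] at hz
        exact hz.ne hu
      refine ⟨z, hz1, ?_⟩
      rw [zero_add, pow_one]
      refine hmax _ ?_
      have h1 := (hσ.iterate n z.2).2
      rw [← map_pow, residue_eq_iff] at hz
      have e : σ^[n] (z : Kb) - u * z
          = (σ^[n] (z : Kb) - (z : Kb) ^ q) + ((z : Kb) ^ (q - 1) - u) * z := by
        have : (z : Kb) ^ q = (z : Kb) ^ (q - 1) * z := by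
          rw [← pow_succ]; congr 1; omega
        rw [this]; ring
      rw [e]
      refine Valuation.map_add_lt _ h1 ?_
      rw [map_mul, hz1, mul_one]
      exact hz) (by
      rintro k c ⟨hc, hk⟩
      have hϖk : (ϖ : Kb) ^ (k + 1) ≠ 0 := pow_ne_zero _ ϖ.ne_zero
      have hvk : valuation Kb ((ϖ : Kb) ^ (k + 1)) ≠ 0 := (map_ne_zero _).2 hϖk
      obtain ⟨e, he⟩ : ∃ e, σ^[n] c - u * c = (ϖ : Kb) ^ (k + 1) * e :=
        ⟨(σ^[n] c - u * c) / (ϖ : Kb) ^ (k + 1), by field_simp⟩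
      have he1 : valuation Kb e ≤ 1 := by
        rw [he, map_mul, ← map_pow] at hk
        exact (mul_le_iff_le_one_right (zero_lt_iff.2 hvk)).1 hk
      obtain ⟨z, hz, hz'⟩ := exists_pow_sub_mul_add_lt_one hKb.maximal hq hu.le he1
      have hsmall : valuation Kb ((ϖ : Kb) ^ (k + 1) * z) ≤ valuation Kb (ϖ : Kb) ^ (k + 1) := by
        rw [map_mul, map_pow]
        exact mul_le_of_le_one_right' hz
      refine ⟨c + (ϖ : Kb) ^ (k + 1) * z, ⟨?_, ?_⟩, ?_⟩
      · rw [Valuation.map_add_eq_of_lt_left, hc]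
        rw [hc]
        exact hsmall.trans_lt (pow_lt_one' hp (Nat.succ_ne_zero _))
      · have e2 : σ^[n] (c + (ϖ : Kb) ^ (k + 1) * z) - u * (c + (ϖ : Kb) ^ (k + 1) * z)
            = (ϖ : Kb) ^ (k + 1) * ((σ^[n] z - z ^ q) + (z ^ q - u * z + e)) := by
          rw [hadd, hmul, hσϖ]
          linear_combination he
        rw [e2, map_mul, map_pow, pow_succ _ (k + 1)]
        exact mul_le_mul_right (hmax _ (Valuation.map_add_lt _ (hσ.iterate n hz).2 hz')) _
      · rw [add_sub_cancel_left]
        exact hsmall.trans (pow_le_pow_right_of_le_one' hp.le (Nat.le_succ k)))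
  obtain ⟨c, hc⟩ := exists_limit hp hmax f (fun k => (hf k).1.1.le) fun k => (hf k).2
  have hval := hσ.val_frob_iterate hKb n
  refine ⟨c, ?_, ?_⟩
  · have h := hc 1
    have e : c = f 1 + (c - f 1) := by ring
    rw [e, Valuation.map_add_eq_of_lt_left, (hf 1).1.1]
    rw [(hf 1).1.1]
    rw [pow_one] at h
    exact h.trans_lt hp
  -- The error at the limit is smaller than every power of `ϖ`, hence zero.
  · by_contra hne
    obtain ⟨N, hN⟩ := hϖ.archimedean hKb _ (sub_ne_zero.2 hne)
    refine hN.not_ge ?_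
    have e : σ^[n] c - u * c
        = σ^[n] (c - f N) + ((σ^[n] (f N) - u * f N) - u * (c - f N)) := by
      rw [iterate_map_sub]; ring
    rw [e]
    refine Valuation.map_add_le _ ?_ (Valuation.map_sub_le _ ?_ ?_)
    · rw [hval]; exact hc N
    · exact (hf N).1.2.trans (pow_le_pow_right_of_le_one' hp.le (Nat.le_succ N))
    · rw [map_mul, hu, one_mul]; exact hc N

/-- The polynomial `X ^ q - X` has at most `q` roots in the residue field of `Kb`, and the residue
field of `K` already supplies `q` of them. -/
theorem exists_sub_algebraMap_lt_one {e : Kb} (he : valuation Kb e ≤ 1)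
    (h : valuation Kb (e ^ Nat.card 𝓀[K] - e) < 1) :
    ∃ z : K, valuation K z ≤ 1 ∧ valuation Kb (e - algebraMap K Kb z) < 1 := by
  classical
  have := Fintype.ofFinite 𝓀[K]
  let f : 𝒪[K] →+* 𝒪[Kb] :=
    { toFun := fun x => ⟨algebraMap K Kb x, valuation_algebraMap_le_one_iff.2 x.2⟩
      map_one' := Subtype.ext (map_one _)
      map_mul' := fun x y => Subtype.ext (map_mul _ _ _)
      map_zero' := Subtype.ext (map_zero _)
      map_add' := fun x y => Subtype.ext (map_add _ _ _) }
  let ι : 𝓀[K] →+* 𝓀[Kb] := Ideal.Quotient.lift 𝓂[K] ((IsLocalRing.residue _).comp f) (by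
    intro a ha
    rw [RingHom.comp_apply, IsLocalRing.residue_eq_zero_iff, mem_maximalIdeal_iff]
    rw [mem_maximalIdeal_iff] at ha
    exact valuation_algebraMap_lt_one_iff.2 ha)
  set q := Nat.card 𝓀[K] with hq
  have hqc : Fintype.card 𝓀[K] = q := by rw [hq, Nat.card_eq_fintype_card]
  have hq1 : 1 < q := two_le_card_residue
  let P : Polynomial 𝓀[Kb] := Polynomial.X ^ q - Polynomial.X
  have hP0 : P ≠ 0 := FiniteField.X_pow_card_sub_X_ne_zero _ hq1
  have hroots : Finset.univ.image ι = P.roots.toFinset := by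
    refine Finset.eq_of_subset_of_card_le (fun y hy => ?_) ?_
    · obtain ⟨a, -, rfl⟩ := Finset.mem_image.1 hy
      rw [Multiset.mem_toFinset, Polynomial.mem_roots hP0]
      simp only [P, Polynomial.IsRoot.def, Polynomial.eval_sub, Polynomial.eval_pow,
        Polynomial.eval_X]
      rw [← map_pow, ← hqc, FiniteField.pow_card, sub_self]
    · rw [Finset.card_image_of_injective _ ι.injective, Finset.card_univ, hqc]
      refine (Multiset.toFinset_card_le _).trans ((Polynomial.card_roots' P).trans ?_)
      rw [FiniteField.X_pow_card_sub_X_natDegree_eq _ hq1]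
  have hmem : IsLocalRing.residue 𝒪[Kb] ⟨e, he⟩ ∈ P.roots.toFinset := by
    rw [Multiset.mem_toFinset, Polynomial.mem_roots hP0]
    simp only [P, Polynomial.IsRoot.def, Polynomial.eval_sub, Polynomial.eval_pow,
      Polynomial.eval_X]
    rw [← map_pow, ← map_sub, IsLocalRing.residue_eq_zero_iff, mem_maximalIdeal_iff]
    exact h
  rw [← hroots] at hmem
  obtain ⟨a, -, ha⟩ := Finset.mem_image.1 hmem
  obtain ⟨z, rfl⟩ := IsLocalRing.residue_surjective a
  exact ⟨z, z.2, residue_eq_iff.1 ha.symm⟩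

/-- A fixed integral element satisfies `e ^ q ≡ e`, so it is congruent to an element of `K`. After
subtracting this element and dividing by `ϖ` the result is still fixed; repeating this gives an
expansion that converges in `K`. -/
theorem exists_algebraMap_eq_of_frob_eq (hKb : IsCompletedMaximalUnramified K Kb)
    (hσ : IsFrobenius K σ) (hϖ : IsUniformizerOf K ϖ) (x : Kb) (hx : σ x = x) :
    ∃ y : K, algebraMap K Kb y = x := by
  -- All values of `Kb` occur on `K`, so dividing by an element of `K` makes `x` a unit.
  wlog hx1 : valuation Kb x ≤ 1 generalizing x
  · obtain ⟨y, hy⟩ := hKb.unramified x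
    have hx0 : valuation Kb x ≠ 0 := by
      intro h
      rw [h] at hx1
      exact hx1 zero_le_one
    have hy0 : algebraMap K Kb y ≠ 0 := by
      rw [hy] at hx0
      exact (map_ne_zero _).1 hx0
    obtain ⟨z, hz⟩ := this (x / algebraMap K Kb y) (by rw [map_div₀, AlgEquiv.commutes, hx])
      (by rw [map_div₀, ← hy, div_self hx0])
    exact ⟨z * y, by rw [map_mul, hz, div_mul_cancel₀ _ hy0]⟩
  obtain ⟨p, hp, hpv⟩ := id hϖ
  have hp1 : valuation K p < 1 := hpv ▸ uniformizer_lt_one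
  have hp0 : (ϖ : Kb) ≠ 0 := ϖ.ne_zero
  obtain ⟨f, hf⟩ := exists_seq_of_step
    (P := fun k y => valuation K y ≤ 1 ∧
      valuation Kb (x - algebraMap K Kb y) ≤ valuation Kb (ϖ : Kb) ^ k)
    (R := fun k y y' => valuation K (y' - y) ≤ valuation K p ^ k)
    ⟨0, by simp, by simpa using hx1⟩ (by
      rintro k y ⟨hy, hk⟩
      have hϖk : (ϖ : Kb) ^ k ≠ 0 := pow_ne_zero _ ϖ.ne_zero
      have hvk : valuation Kb ((ϖ : Kb) ^ k) ≠ 0 := (map_ne_zero _).2 hϖk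
      obtain ⟨e, he⟩ : ∃ e, x - algebraMap K Kb y = (ϖ : Kb) ^ k * e :=
        ⟨(x - algebraMap K Kb y) / (ϖ : Kb) ^ k, by field_simp⟩
      have he1 : valuation Kb e ≤ 1 := by
        rw [he, map_mul, ← map_pow] at hk
        exact (mul_le_iff_le_one_right (zero_lt_iff.2 hvk)).1 hk
      have heσ : σ e = e := by
        have h := congrArg σ he
        rw [map_sub, map_mul, map_pow, AlgEquiv.commutes, hx, he, ← hp, AlgEquiv.commutes, hp] at h
        exact (mul_left_cancel₀ hϖk h).symm
      obtain ⟨z, hz, hz'⟩ := exists_sub_algebraMap_lt_one (K := K) he1 (by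
        have h := hσ e he1
        rwa [heσ, Valuation.map_sub_swap] at h)
      have hsmall : valuation K (p ^ k * z) ≤ valuation K p ^ k := by
        rw [map_mul, map_pow]
        exact mul_le_of_le_one_right' hz
      refine ⟨y + p ^ k * z, ⟨?_, ?_⟩, ?_⟩
      · exact Valuation.map_add_le _ hy (hsmall.trans (pow_le_one' hp1.le k))
      · have e2 : x - algebraMap K Kb (y + p ^ k * z)
            = (ϖ : Kb) ^ k * (e - algebraMap K Kb z) := by
          rw [map_add, map_mul, map_pow, hp]
          linear_combination he
        rw [e2, map_mul, map_pow, pow_succ]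
        exact mul_le_mul_right (hϖ.val_le hKb _ hz') _
      · rw [add_sub_cancel_left]
        exact hsmall)
  -- The uniform structure of the additive group of `K` gives access to the completeness of `𝒪[K]`
  -- used for the limit.
  let _ : UniformSpace K := IsTopologicalAddGroup.rightUniformSpace K
  have _ : IsUniformAddGroup K := isUniformAddGroup_of_addCommGroup
  obtain ⟨l, hl⟩ := exists_limit hp1
    (fun y hy => by rw [hpv, le_uniformizer_iff]; exact hy) f (fun k => (hf k).1.1)
    fun k => (hf k).2
  refine ⟨l, ?_⟩
  by_contra hne
  obtain ⟨N, hN⟩ := hϖ.archimedean hKb _ (sub_ne_zero.2 hne)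
  refine hN.not_ge ?_
  have e : algebraMap K Kb l - x
      = algebraMap K Kb (l - f N) - (x - algebraMap K Kb (f N)) := by
    rw [map_sub]; ring
  rw [e]
  refine Valuation.map_sub_le _ ?_ (hf N).1.2
  rw [← hp, ← map_pow, ← map_pow, valuation_algebraMap_le_iff, map_pow]
  exact hl N

theorem unramifiedFrobenius (hKb : IsCompletedMaximalUnramified K Kb)
    (hσ : IsFrobenius K σ) (hϖ : IsUniformizerOf K ϖ) : UnramifiedFrobenius σ ϖ where
  val_lt_one := hϖ.val_lt_one
  val_le := hϖ.val_le hKb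
  archimedean := hϖ.archimedean hKb
  frob_unif := by
    obtain ⟨p, hp, -⟩ := hϖ
    rw [← hp, AlgEquiv.commutes]
  val_frob := hσ.val_frob hKb
  complete := by
    have := hKb.complete
    exact exists_limit hϖ.val_lt_one (hϖ.val_le hKb)
  lang := exists_iterate_frob_eq_mul hKb hσ hϖ
  fixed := exists_algebraMap_eq_of_frob_eq hKb hσ hϖ

end Base

/-! ### Level subgroups defined by entries, and cyclic representatives of cosets -/

section Levels

variable {K Kb : Type*} [Field K] [Field Kb] [Algebra K Kb] {n : ℕ}

/-- Change of basis: it replaces `b` by its `σ`-conjugate `g⁻¹ b σ(g)`, so that questions about `b`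
become questions about `ẇ_r i`. -/
theorem bsig_mulVec (σ : Kb ≃ₐ[K] Kb) (b g : GL (Fin n) Kb) (y : Fin n → Kb) :
    bsig σ b (g.val *ᵥ y) = g.val *ᵥ bsig σ (g⁻¹ * b * frob σ g) y := by
  have h1 : (fun i => σ ((g.val *ᵥ y) i)) = (frob σ g).val *ᵥ fun i => σ (y i) := by
    ext i
    simp only [Matrix.mulVec, dotProduct, map_sum, map_mul]
    rfl
  rw [bsig, bsig, h1, Matrix.mulVec_mulVec, Matrix.mulVec_mulVec, ← Units.val_mul,
    ← Units.val_mul]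
  congr 2
  group

theorem bsig_iterate_mulVec (σ : Kb ≃ₐ[K] Kb) (b g : GL (Fin n) Kb) (j : ℕ) (y : Fin n → Kb) :
    (bsig σ b)^[j] (g.val *ᵥ y) = g.val *ᵥ (bsig σ (g⁻¹ * b * frob σ g))^[j] y := by
  induction j with
  | zero => rfl
  | succ j ih => rw [Function.iterate_succ_apply', Function.iterate_succ_apply', ih, bsig_mulVec]

theorem gbr_mulVec (σ : Kb ≃ₐ[K] Kb) (ϖ : Kbˣ) (b g : GL (Fin n) Kb) (r : ℕ)
    (y : Fin n → Kb) :
    gbr σ ϖ b r (g.val *ᵥ y) = g.val * gbr σ ϖ (g⁻¹ * b * frob σ g) r y := by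
  ext i j
  rw [gbr, Matrix.of_apply, bsig_iterate_mulVec, Matrix.mul_apply, Matrix.mulVec,
    dotProduct, Finset.mul_sum]
  refine Finset.sum_congr rfl fun k _ => ?_
  rw [gbr, Matrix.of_apply]
  ring

theorem det_gbr_ne_zero_iff (σ : Kb ≃ₐ[K] Kb) (ϖ : Kbˣ) (b : GL (Fin n) Kb) (r : ℕ)
    (x : Fin n → Kb) : (gbr σ ϖ b r x).det ≠ 0 ↔ x ∈ Vadm σ b := by
  rw [gbr_eq, Matrix.det_mul, Matrix.det_diagonal, mul_ne_zero_iff]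
  exact and_iff_left (Finset.prod_ne_zero_iff.2 fun j _ => pow_ne_zero _ ϖ.ne_zero)

section

variable [NeZero n]

/-- Separates the wraparound of the cyclic shift on `Fin n` from the ordinary step; computations
with `ẇ_r` go through this case split. -/
theorem exists_eq_add_one (k' : Fin n) : ∃ k : Fin n, k' = k + 1 ∧
    ((k : ℕ) + 1 = n ∧ (k' : ℕ) = 0 ∨ (k : ℕ) + 1 ≠ n ∧ (k' : ℕ) = k + 1) := by
  refine ⟨k' - 1, by simp, ?_⟩
  obtain ⟨k, hk⟩ : ∃ k, k = k' - 1 := ⟨_, rfl⟩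
  have hk' : k' = k + 1 := by simp [hk]
  rw [← hk, hk']
  by_cases h : (k : ℕ) + 1 = n
  · exact Or.inl ⟨h, by rw [Fin.val_add, Fin.val_one', Nat.add_mod_mod, h, Nat.mod_self]⟩
  · exact Or.inr ⟨h, Fin.val_add_one_of_lt' (by omega)⟩

theorem b₀_mulVec_apply (y : Fin n → Kb) (k : Fin n) :
    ((b₀ : GL (Fin n) Kb).val *ᵥ y) (k + 1) = y k := by
  rw [Matrix.mulVec, dotProduct, Finset.sum_eq_single k]
  · simp [b₀]
  · intro l _ hl
    simp [b₀, hl.symm]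
  · simp

/-- The factor `ϖ ^ r` cancels the exponents `-r` and raises the last one, `κ + (n - 1) r`, to `κ +
n r`. What remains is a cyclic shift with one nontrivial factor, at the wraparound. -/
theorem wdot_mulVec_apply (ϖ : Kbˣ) (κ r : ℕ) (y : Fin n → Kb) (k : Fin n) :
    (ϖ : Kb) ^ r * ((wdot ϖ κ r).val *ᵥ y) (k + 1)
      = (if (k : ℕ) + 1 = n then (ϖ : Kb) ^ (κ + n * r) else 1) * y k := by
  rw [wdot, Units.val_mul, ← Matrix.mulVec_mulVec, b₀_mulVec_apply, coe_diagGL,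
    Matrix.mulVec_diagonal, ← mul_assoc]
  congr 1
  split_ifs with h
  · rw [Units.val_zpow_eq_zpow_val, ← zpow_natCast, ← zpow_natCast,
      ← zpow_add₀ ϖ.ne_zero]
    congr 1
    push_cast
    ring
  · rw [Units.val_zpow_eq_zpow_val, _root_.zpow_neg, zpow_natCast,
      mul_inv_cancel₀ (pow_ne_zero _ ϖ.ne_zero)]

end

/-- Matrices with entries above the diagonal in `S`, below the diagonal in `T`, and on the
diagonal in `D`. -/
def HasEntries (S T : AddSubgroup Kb) (D : Set Kb) (A : Matrix (Fin n) (Fin n) Kb) : Prop :=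
  (∀ i j, i < j → A i j ∈ S) ∧ (∀ i j, j < i → A i j ∈ T) ∧ ∀ i, A i i ∈ D

/-- `H` is a `σ`-stable group of invertible matrices defined by conditions on the entries: they
lie in `S` above the diagonal, in `T` below the diagonal, and in `D` on the diagonal. Here
`T ⊆ S ⊆ R` are modules over the ring `R`. -/
structure IsLevel (σ : Kb ≃ₐ[K] Kb) (R S T : AddSubgroup Kb) (D : Set Kb)
    (H : Subgroup (GL (Fin n) Kb)) : Prop where
  S_le : S ≤ R
  T_le : T ≤ S
  mul_S : ∀ a ∈ R, ∀ s ∈ S, a * s ∈ S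
  mul_T : ∀ a ∈ R, ∀ s ∈ T, a * s ∈ T
  one_mem : 1 ∈ D
  D_le : ∀ d ∈ D, d ∈ R
  mul_D : ∀ d ∈ D, ∀ d' ∈ D, d * d' ∈ D
  add_D : ∀ d ∈ D, ∀ t ∈ T, d + t ∈ D
  frob_S : ∀ s ∈ S, σ s ∈ S
  frob_T : ∀ s ∈ T, σ s ∈ T
  frob_D : ∀ s ∈ D, σ s ∈ D
  mem_iff : ∀ g : GL (Fin n) Kb, g ∈ H ↔ HasEntries S T D g.val
  det_ne_zero : ∀ A : Matrix (Fin n) (Fin n) Kb, HasEntries S T D A → A.det ≠ 0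

namespace IsLevel

variable {σ : Kb ≃ₐ[K] Kb} {R S T : AddSubgroup Kb} {D : Set Kb} {H : Subgroup (GL (Fin n) Kb)}

theorem frob_mem (hH : IsLevel σ R S T D H) {g : GL (Fin n) Kb} (hg : g ∈ H) :
    frob σ g ∈ H := by
  rw [hH.mem_iff] at hg ⊢
  exact ⟨fun i j h => hH.frob_S _ (hg.1 i j h), fun i j h => hH.frob_T _ (hg.2.1 i j h),
    fun i => hH.frob_D _ (hg.2.2 i)⟩

theorem mul_S' (hH : IsLevel σ R S T D H) {s a : Kb} (hs : s ∈ S) (ha : a ∈ R) : s * a ∈ S :=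
  mul_comm a s ▸ hH.mul_S a ha s hs

theorem mul_T' (hH : IsLevel σ R S T D H) {s a : Kb} (hs : s ∈ T) (ha : a ∈ R) : s * a ∈ T :=
  mul_comm a s ▸ hH.mul_T a ha s hs

/-- The shape of the `j`-th column of a matrix as in `HasEntries`. -/
def ColumnHasEntries (S T : AddSubgroup Kb) (D : Set Kb) (j : ℕ) (y : Fin n → Kb) : Prop :=
  (∀ k : Fin n, (k : ℕ) < j → y k ∈ S) ∧ (∀ k : Fin n, j < k → y k ∈ T) ∧
    ∀ k : Fin n, (k : ℕ) = j → y k ∈ D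

theorem entry_mem (hH : IsLevel σ R S T D H) {A : Matrix (Fin n) (Fin n) Kb}
    (hA : HasEntries S T D A) (i j : Fin n) : A i j ∈ R := by
  rcases lt_trichotomy i j with h | h | h
  · exact hH.S_le (hA.1 i j h)
  · exact h ▸ hH.D_le _ (hA.2.2 i)
  · exact hH.S_le (hH.T_le (hA.2.1 i j h))

theorem column_entry_mem (hH : IsLevel σ R S T D H) {j : ℕ} {y : Fin n → Kb}
    (hy : ColumnHasEntries S T D j y) (k : Fin n) : y k ∈ R := by
  rcases lt_trichotomy (k : ℕ) j with h | h | h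
  · exact hH.S_le (hy.1 k h)
  · exact hH.D_le _ (hy.2.2 k h)
  · exact hH.S_le (hH.T_le (hy.2.1 k h))

/-- In every term of an off-diagonal entry one factor comes from the required module. In the
diagonal entry, the term `l = k` is a product of elements of `D` and the other terms lie in `T`. -/
theorem columnHasEntries_mulVec (hH : IsLevel σ R S T D H) {A : Matrix (Fin n) (Fin n) Kb}
    (hA : HasEntries S T D A) {j : ℕ} {y : Fin n → Kb} (hy : ColumnHasEntries S T D j y) :
    ColumnHasEntries S T D j (A *ᵥ y) := by
  have hAR := hH.entry_mem hA
  have hyR := hH.column_entry_mem hy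
  refine ⟨fun k hk => ?_, fun k hk => ?_, fun k hk => ?_⟩
  · rw [Matrix.mulVec, dotProduct]
    refine S.sum_mem fun l _ => ?_
    rcases le_or_gt (l : ℕ) k with h | h
    · exact hH.mul_S _ (hAR k l) _ (hy.1 l (by omega))
    · exact hH.mul_S' (hA.1 k l h) (hyR l)
  · rw [Matrix.mulVec, dotProduct]
    refine T.sum_mem fun l _ => ?_
    rcases lt_or_ge (l : ℕ) k with h | h
    · exact hH.mul_T' (hA.2.1 k l h) (hyR l)
    · exact hH.mul_T _ (hAR k l) _ (hy.2.1 l (by omega))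
  · rw [Matrix.mulVec, dotProduct, ← Finset.add_sum_erase _ _ (Finset.mem_univ k)]
    refine hH.add_D _ (hH.mul_D _ (hA.2.2 k) _ (hy.2.2 k hk)) _ (T.sum_mem fun l hl => ?_)
    have hl : (l : ℕ) ≠ k := fun h => Finset.ne_of_mem_erase hl (Fin.ext h)
    rcases lt_or_gt_of_ne hl with h | h
    · exact hH.mul_T' (hA.2.1 k l h) (hyR l)
    · exact hH.mul_T _ (hAR k l) _ (hy.2.1 l (by omega))

variable [NeZero n]

/-- Induction on columns: `σ` and `i` preserve the shape of a column, and `ϖ ^ r ẇ_r` moves it one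
step down. The entry that wraps around to the top is multiplied by `ϖ ^ (κ + n r)`, which by `hr`
puts it in `S`. -/
theorem hasEntries_gbr (hH : IsLevel σ R S T D H) {ϖ : Kbˣ} (hϖ : σ (ϖ : Kb) = ϖ) {κ r : ℕ}
    (hr : ∀ a ∈ R, (ϖ : Kb) ^ (κ + n * r) * a ∈ S) {i : GL (Fin n) Kb} (hi : i ∈ H)
    {y : Fin n → Kb} (hy : ColumnHasEntries S T D 0 y) :
    HasEntries S T D (gbr σ ϖ (wdot ϖ κ r * i) r y) := by
  have hi := (hH.mem_iff i).1 hi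
  have key : ∀ j : ℕ, j < n → ColumnHasEntries S T D j
      fun k => (ϖ : Kb) ^ (r * j) * ((bsig σ (wdot ϖ κ r * i))^[j] y) k := by
    intro j
    induction j with
    | zero => intro _; simpa using hy
    | succ j ih =>
      intro hj
      have ih := ih (by omega)
      set z : Fin n → Kb := fun k => (ϖ : Kb) ^ (r * j) * ((bsig σ (wdot ϖ κ r * i))^[j] y) k
      have hσz : ColumnHasEntries S T D j fun k => σ (z k) :=
        ⟨fun k h => hH.frob_S _ (ih.1 k h), fun k h => hH.frob_T _ (ih.2.1 k h),
          fun k h => hH.frob_D _ (ih.2.2 k h)⟩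
      have hz := hH.columnHasEntries_mulVec hi hσz
      have hstep : ∀ k, (ϖ : Kb) ^ (r * (j + 1))
          * ((bsig σ (wdot ϖ κ r * i))^[j + 1] y) (k + 1)
          = (if (k : ℕ) + 1 = n then (ϖ : Kb) ^ (κ + n * r) else 1)
            * (i.val *ᵥ fun k => σ (z k)) k := by
        intro k
        have e : z = (ϖ : Kb) ^ (r * j) • (bsig σ (wdot ϖ κ r * i))^[j] y := rfl
        have e' := bsig_smul σ (wdot ϖ κ r * i) ((ϖ : Kb) ^ (r * j))
          ((bsig σ (wdot ϖ κ r * i))^[j] y)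
        rw [← wdot_mulVec_apply, Matrix.mulVec_mulVec, ← Units.val_mul]
        change _ = _ * bsig σ (wdot ϖ κ r * i) z (k + 1)
        rw [e, e', Function.iterate_succ_apply', map_pow, hϖ, Pi.smul_apply, smul_eq_mul,
          mul_add, mul_one, pow_add]
        ring
      refine ⟨fun k' h => ?_, fun k' h => ?_, fun k' h => ?_⟩ <;>
        obtain ⟨k, rfl, ⟨h1, h2⟩ | ⟨h1, h2⟩⟩ := exists_eq_add_one k' <;>
        beta_reduce
      · rw [hstep, if_pos h1]
        exact hr _ (hH.column_entry_mem hz k)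
      · rw [hstep, if_neg h1, one_mul]
        exact hz.1 k (by omega)
      · omega
      · rw [hstep, if_neg h1, one_mul]
        exact hz.2.1 k (by omega)
      · omega
      · rw [hstep, if_neg h1, one_mul]
        exact hz.2.2 k (by omega)
  exact ⟨fun k j h => (key j j.2).1 k h, fun k j h => (key j j.2).2.1 k h,
    fun k => (key k k.2).2.2 k rfl⟩

variable {b : GL (Fin n) Kb}

/-- In the basis `g` the operator is `ẇ_r i σ`, to which `hasEntries_gbr` applies. Allowing any `y`
shaped like a first column, and not only `e_1`, makes it possible to compare representatives and to
perturb them. -/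
theorem exists_gbrGL (hH : IsLevel σ R S T D H) {ϖ : Kbˣ} (hϖ : σ (ϖ : Kb) = ϖ) {κ r : ℕ}
    (hr : ∀ a ∈ R, (ϖ : Kb) ^ (κ + n * r) * a ∈ S) {g i : GL (Fin n) Kb} (hi : i ∈ H)
    (hg : g⁻¹ * b * frob σ g = wdot ϖ κ r * i)
    {y : Fin n → Kb} (hy : ColumnHasEntries S T D 0 y) :
    ∃ x : Vadm σ b, x.1 = g.val *ᵥ y ∧ (gbrGL σ ϖ b r x : GL (Fin n) Kb ⧸ H) = g := by
  have h := hH.hasEntries_gbr hϖ hr hi hy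
  have hdet := hH.det_ne_zero _ h
  have e : gbr σ ϖ b r (g.val *ᵥ y) = g.val * gbr σ ϖ (wdot ϖ κ r * i) r y := by
    rw [gbr_mulVec, hg]
  refine ⟨⟨g.val *ᵥ y, ?_⟩, rfl, ?_⟩
  · rw [← det_gbr_ne_zero_iff σ ϖ b r, e, Matrix.det_mul]
    exact mul_ne_zero ((Matrix.isUnit_iff_isUnit_det _).1 g.isUnit).ne_zero hdet
  · rw [eq_comm, QuotientGroup.eq, hH.mem_iff]
    convert! h
    rw [Units.val_mul, coe_gbrGL, e, ← mul_assoc, ← Units.val_mul, inv_mul_cancel, Units.val_one,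
      one_mul]

/-- Moving the left factor `u` of the double coset into `g` does not change the class and leaves
`ẇ_r` times an element of `H`. Then `g u e_1` is a suitable vector. -/
theorem exists_eq_gbrGL (hH : IsLevel σ R S T D H) {ϖ : Kbˣ} (hϖ : σ (ϖ : Kb) = ϖ) {κ r : ℕ}
    (hr : ∀ a ∈ R, (ϖ : Kb) ^ (κ + n * r) * a ∈ S) {P : GL (Fin n) Kb ⧸ H}
    (hP : P ∈ dlSet σ H (wdot ϖ κ r) b) :
    ∃ x : Vadm σ b, P = (gbrGL σ ϖ b r x : GL (Fin n) Kb ⧸ H) := by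
  obtain ⟨g, rfl, h⟩ := hP
  obtain ⟨u, hu, v, hv, e⟩ := DoubleCoset.mem_doubleCoset.1 h
  have hg : (g * u)⁻¹ * b * frob σ (g * u) = wdot ϖ κ r * (v * frob σ u) := by
    have e1 : (g * u)⁻¹ * b * frob σ (g * u) = u⁻¹ * (g⁻¹ * b * frob σ g) * frob σ u := by
      rw [map_mul]; group
    rw [e1, e]; group
  obtain ⟨x, -, hx⟩ := hH.exists_gbrGL hϖ hr (H.mul_mem hv (hH.frob_mem hu)) hg
    (y := Pi.single 0 1) ⟨fun k hk => by omega, fun k hk => by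
      rw [Pi.single_eq_of_ne (by rintro rfl; simp at hk)]; exact T.zero_mem, fun k hk => by
      obtain rfl : k = 0 := Fin.ext hk
      rw [Pi.single_eq_same]; exact hH.one_mem⟩
  refine ⟨x, ?_⟩
  rw [hx, QuotientGroup.eq]
  simpa using hu

/-- The first column of `g_{b,r}(y)` is `y` itself, so `z` is the first column of the element of `H`
linking the two matrices. -/
theorem exists_mulVec_of_eq (hH : IsLevel σ R S T D H) {ϖ : Kbˣ} {r : ℕ} {x y : Vadm σ b}
    (h : (gbrGL σ ϖ b r x : GL (Fin n) Kb ⧸ H) = gbrGL σ ϖ b r y) :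
    ∃ z : Fin n → Kb, ColumnHasEntries S T D 0 z ∧ y.1 = gbr σ ϖ b r x.1 *ᵥ z := by
  rw [QuotientGroup.eq, hH.mem_iff] at h
  set A := (gbrGL σ ϖ b r x)⁻¹ * gbrGL σ ϖ b r y with hA
  refine ⟨fun k => A k 0, ⟨fun k hk => by omega, fun k hk => h.2.1 k 0 hk, fun k hk => ?_⟩, ?_⟩
  · obtain rfl : k = 0 := Fin.ext hk
    exact h.2.2 0
  · have e : gbrGL σ ϖ b r x * A = gbrGL σ ϖ b r y := by rw [hA, mul_inv_cancel_left]
    have e2 := congrArg (fun g : GL (Fin n) Kb => fun k => g k 0) e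
    have e3 : (fun k => gbrGL σ ϖ b r y k 0) = y.1 := by
      ext k
      simp [coe_gbrGL, gbr]
    rw [← e3, ← e2]
    rfl

end IsLevel

end Levels

/-! ### The Borel, unipotent and Iwahori groups as levels -/

section LevelInstances

variable {K Kb : Type*} [Field K] [Field Kb] [Algebra K Kb] {n : ℕ}

theorem HasEntries.det_of_bot {S : AddSubgroup Kb} {D : Set Kb} {A : Matrix (Fin n) (Fin n) Kb}
    (hA : HasEntries S ⊥ D A) : A.det = ∏ i, A i i :=
  Matrix.det_of_isUpperTriangular fun i j h => AddSubgroup.mem_bot.1 (hA.2.1 i j h)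

theorem isLevel_upperBorel (σ : Kb ≃ₐ[K] Kb) :
    IsLevel (n := n) σ ⊤ ⊤ ⊥ {x | x ≠ 0} upperBorel where
  S_le := le_rfl
  T_le := bot_le
  mul_S _ _ _ _ := trivial
  mul_T a _ s hs := by simp [AddSubgroup.mem_bot.1 hs]
  one_mem := one_ne_zero
  D_le _ _ := trivial
  mul_D _ h _ h' := mul_ne_zero h h'
  add_D d hd t ht := by simpa [AddSubgroup.mem_bot.1 ht] using hd
  frob_S _ _ := trivial
  frob_T s hs := by simp [AddSubgroup.mem_bot.1 hs]
  frob_D s hs := (map_ne_zero σ).2 hs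
  mem_iff g := by
    refine ⟨fun h => ⟨fun _ _ _ => trivial, fun i j hij => AddSubgroup.mem_bot.2 (h i j hij),
      fun i => ?_⟩, fun h i j hij => AddSubgroup.mem_bot.1 (h.2.1 i j hij)⟩
    have hdet := ((Matrix.isUnit_iff_isUnit_det _).1 g.isUnit).ne_zero
    rw [Matrix.det_of_isUpperTriangular fun i j hij => h i j hij] at hdet
    exact Finset.prod_ne_zero_iff.1 hdet i (Finset.mem_univ i)
  det_ne_zero A hA := by
    rw [hA.det_of_bot]
    exact Finset.prod_ne_zero_iff.2 fun i _ => hA.2.2 i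

theorem isLevel_unip (σ : Kb ≃ₐ[K] Kb) : IsLevel (n := n) σ ⊤ ⊤ ⊥ {1} unip where
  S_le := le_rfl
  T_le := bot_le
  mul_S _ _ _ _ := trivial
  mul_T a _ s hs := by simp [AddSubgroup.mem_bot.1 hs]
  one_mem := rfl
  D_le _ _ := trivial
  mul_D d h d' h' := by
    rw [Set.mem_singleton_iff] at *
    rw [h, h', one_mul]
  add_D d hd t ht := by simpa [AddSubgroup.mem_bot.1 ht] using hd
  frob_S _ _ := trivial
  frob_T s hs := by simp [AddSubgroup.mem_bot.1 hs]
  frob_D s hs := by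
    rw [Set.mem_singleton_iff] at *
    rw [hs, map_one]
  mem_iff g := ⟨fun h => ⟨fun _ _ _ => trivial, fun i j hij => AddSubgroup.mem_bot.2 (h.1 i j hij),
      h.2⟩, fun h => ⟨fun i j hij => AddSubgroup.mem_bot.1 (h.2.1 i j hij), h.2.2⟩⟩
  det_ne_zero A hA := by
    rw [hA.det_of_bot, Finset.prod_eq_one fun i _ => hA.2.2 i]
    exact one_ne_zero

theorem det_eq_one_of_mem_unip {g : GL (Fin n) Kb} (hg : g ∈ unip) : g.val.det = 1 := by
  rw [Matrix.det_of_isUpperTriangular fun i j hij => hg.1 i j hij]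
  exact Finset.prod_eq_one fun i _ => hg.2 i

variable [ValuativeRel Kb]

/-- The fractional ideal `ϖ ^ m 𝒪`, as an additive group. -/
def ball (ϖ : Kbˣ) (m : ℕ) : AddSubgroup Kb where
  carrier := {x | valuation Kb x ≤ valuation Kb (ϖ : Kb) ^ m}
  zero_mem' := by simp
  add_mem' {x y} h h' := by
    rw [Set.mem_ofPred_eq] at *
    exact Valuation.map_add_le _ h h'
  neg_mem' h := by simpa using h

theorem mem_ball {ϖ : Kbˣ} {m : ℕ} {x : Kb} :
    x ∈ ball ϖ m ↔ valuation Kb x ≤ valuation Kb (ϖ : Kb) ^ m := Iff.rfl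

theorem mul_mem_ball {ϖ : Kbˣ} {m m' : ℕ} {x y : Kb} (hx : x ∈ ball ϖ m) (hy : y ∈ ball ϖ m') :
    x * y ∈ ball ϖ (m + m') := by
  rw [mem_ball, map_mul, pow_add]
  exact mul_le_mul' hx hy

theorem pow_mem_ball (ϖ : Kbˣ) (m : ℕ) : (ϖ : Kb) ^ m ∈ ball ϖ m := by
  rw [mem_ball, map_pow]

namespace UnramifiedFrobenius

variable {σ : Kb ≃ₐ[K] Kb} {ϖ : Kbˣ}

theorem ball_anti (hF : UnramifiedFrobenius σ ϖ) {m m' : ℕ} (h : m ≤ m') :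
    ball ϖ m' ≤ ball ϖ m := fun _ hx =>
  mem_ball.2 ((mem_ball.1 hx).trans <| pow_le_pow_right_of_le_one' hF.val_lt_one.le h)

theorem mem_maximalIdeal_pow_iff (hF : UnramifiedFrobenius σ ϖ) {m : ℕ} {x : 𝒪[Kb]} :
    x ∈ 𝓂[Kb] ^ m ↔ (x : Kb) ∈ ball ϖ m :=
  CoxeterDL.mem_maximalIdeal_pow_iff hF.val_lt_one hF.val_le m

theorem val_eq_one_of_sub_one_mem (hF : UnramifiedFrobenius σ ϖ) {m : ℕ} {x : Kb}
    (hx : x - 1 ∈ ball ϖ (m + 1)) : valuation Kb x = 1 := by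
  have e : x = 1 + (x - 1) := by ring
  have h : valuation Kb (x - 1) < 1 :=
    lt_of_le_of_lt hx (pow_lt_one' hF.val_lt_one (Nat.succ_ne_zero m))
  rw [e, Valuation.map_add_eq_of_lt_left _ (by rwa [map_one]), map_one]

/-- Modulo the maximal ideal the matrix is upper triangular, since the exponent `m + 1` is positive.
-/
theorem _root_.CoxeterDL.isUnit_det_iff {m : ℕ}
    {A : Matrix (Fin n) (Fin n) 𝒪[Kb]} (hA : ∀ i j, j < i → A i j ∈ 𝓂[Kb] ^ (m + 1)) :
    IsUnit A.det ↔ ∀ i, valuation Kb (A i i : Kb) = 1 := by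
  have h1 : IsLocalRing.residue 𝒪[Kb] A.det = ∏ i, IsLocalRing.residue 𝒪[Kb] (A i i) := by
    rw [RingHom.map_det, Matrix.det_of_isUpperTriangular]
    · rfl
    · intro i j hij
      exact (IsLocalRing.residue_eq_zero_iff _).2 (Ideal.pow_le_self (Nat.succ_ne_zero m) (hA i j hij))
  rw [← IsLocalRing.residue_ne_zero_iff_isUnit, h1, Finset.prod_ne_zero_iff]
  refine forall_congr' fun i => ?_
  simp only [Finset.mem_univ, true_imp_iff, IsLocalRing.residue_ne_zero_iff_isUnit]
  exact (Valuation.integer.integers (valuation Kb)).isUnit_iff_valuation_eq_one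

theorem _root_.CoxeterDL.val_eq_one_of_mem_iwahori {m : ℕ} {g : GL (Fin n) 𝒪[Kb]}
    (hg : g ∈ iwahori 𝓂[Kb] m) (i : Fin n) : valuation Kb (g i i : Kb) = 1 :=
  (isUnit_det_iff hg.2).1 ((Matrix.isUnit_iff_isUnit_det _).1 g.isUnit) i

theorem exists_lift (hF : UnramifiedFrobenius σ ϖ) {m : ℕ} {A : Matrix (Fin n) (Fin n) Kb}
    (hA : HasEntries (ball ϖ m) (ball ϖ (m + 1)) {x | valuation Kb x = 1} A) :
    ∃ g ∈ iwahori (n := n) 𝓂[Kb] m,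
      (Matrix.GeneralLinearGroup.map (algebraMap 𝒪[Kb] Kb) g).val = A := by
  have hint : ∀ i j, valuation Kb (A i j) ≤ 1 := by
    intro i j
    rcases lt_trichotomy i j with h | rfl | h
    · exact le_trans (hA.1 i j h) (pow_le_one' hF.val_lt_one.le _)
    · exact (hA.2.2 i).le
    · exact le_trans (hA.2.1 i j h) (pow_le_one' hF.val_lt_one.le _)
  let A' : Matrix (Fin n) (Fin n) 𝒪[Kb] := Matrix.of fun i j => ⟨A i j, hint i j⟩
  have h2 : ∀ i j, j < i → A' i j ∈ 𝓂[Kb] ^ (m + 1) := fun i j h =>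
    hF.mem_maximalIdeal_pow_iff.2 (hA.2.1 i j h)
  have hu : IsUnit A'.det := (isUnit_det_iff h2).2 hA.2.2
  exact ⟨Matrix.GeneralLinearGroup.mk'' A' hu,
    ⟨fun i j h => hF.mem_maximalIdeal_pow_iff.2 (hA.1 i j h), h2⟩, rfl⟩

theorem isLevel_iwahoriLevel (hF : UnramifiedFrobenius σ ϖ) (m : ℕ) :
    IsLevel (n := n) σ (ball ϖ 0) (ball ϖ m) (ball ϖ (m + 1)) {x | valuation Kb x = 1}
      (iwahoriLevel m) where
  S_le := hF.ball_anti (Nat.zero_le m)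
  T_le := hF.ball_anti (Nat.le_succ m)
  mul_S a ha s hs := by simpa using mul_mem_ball ha hs
  mul_T a ha s hs := by simpa using mul_mem_ball ha hs
  one_mem := map_one _
  D_le d hd := by
    rw [mem_ball, pow_zero]
    exact le_of_eq hd
  mul_D d h d' h' := by
    rw [Set.mem_ofPred_eq] at *
    rw [map_mul, h, h', one_mul]
  add_D d hd t ht := by
    rw [Set.mem_ofPred_eq] at *
    rw [Valuation.map_add_eq_of_lt_left, hd]
    rw [hd]
    exact lt_of_le_of_lt ht (pow_lt_one' hF.val_lt_one (Nat.succ_ne_zero m))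
  frob_S s hs := by rwa [mem_ball, hF.val_frob]
  frob_T s hs := by rwa [mem_ball, hF.val_frob]
  frob_D s hs := by rwa [Set.mem_ofPred_eq, hF.val_frob]
  mem_iff g := by
    constructor
    · rintro ⟨g, hg, rfl⟩
      exact ⟨fun i j h => hF.mem_maximalIdeal_pow_iff.1 (hg.1 i j h),
        fun i j h => hF.mem_maximalIdeal_pow_iff.1 (hg.2 i j h),
        fun i => val_eq_one_of_mem_iwahori hg i⟩
    · intro h
      obtain ⟨g', hg', e⟩ := hF.exists_lift h
      exact ⟨g', hg', Units.ext e⟩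
  det_ne_zero A hA := by
    obtain ⟨g', -, rfl⟩ := hF.exists_lift hA
    exact ((Matrix.isUnit_iff_isUnit_det _).1 (Units.isUnit _)).ne_zero

theorem hasEntries_of_dot (hF : UnramifiedFrobenius σ ϖ) {m : ℕ} {A : Matrix (Fin n) (Fin n) Kb}
    (hA : HasEntries (ball ϖ m) (ball ϖ (m + 1)) {x | x - 1 ∈ ball ϖ (m + 1)} A) :
    HasEntries (ball ϖ m) (ball ϖ (m + 1)) {x | valuation Kb x = 1} A :=
  ⟨hA.1, hA.2.1, fun i => hF.val_eq_one_of_sub_one_mem (hA.2.2 i)⟩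

theorem isLevel_iwahoriDotLevel (hF : UnramifiedFrobenius σ ϖ) (m : ℕ) :
    IsLevel (n := n) σ (ball ϖ 0) (ball ϖ m) (ball ϖ (m + 1)) {x | x - 1 ∈ ball ϖ (m + 1)}
      (iwahoriDotLevel m) where
  S_le := hF.ball_anti (Nat.zero_le m)
  T_le := hF.ball_anti (Nat.le_succ m)
  mul_S a ha s hs := by simpa using mul_mem_ball ha hs
  mul_T a ha s hs := by simpa using mul_mem_ball ha hs
  one_mem := by
    rw [Set.mem_ofPred_eq, sub_self]
    exact zero_mem _
  D_le d hd := by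
    rw [mem_ball, pow_zero]
    exact (hF.val_eq_one_of_sub_one_mem hd).le
  mul_D d h d' h' := by
    have e : d * d' - 1 = d * (d' - 1) + (d - 1) := by ring
    rw [Set.mem_ofPred_eq, e]
    refine add_mem ?_ h
    have := mul_mem_ball (ϖ := ϖ) (m := 0) (x := d)
      (by rw [mem_ball, pow_zero, hF.val_eq_one_of_sub_one_mem h]) h'
    simpa using this
  add_D d hd t ht := by
    have e : d + t - 1 = (d - 1) + t := by ring
    rw [Set.mem_ofPred_eq, e]
    exact add_mem hd ht
  frob_S s hs := by rwa [mem_ball, hF.val_frob]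
  frob_T s hs := by rwa [mem_ball, hF.val_frob]
  frob_D s hs := by
    have e : σ s - 1 = σ (s - 1) := by rw [map_sub, map_one]
    rw [Set.mem_ofPred_eq, e, mem_ball, hF.val_frob]
    exact hs
  mem_iff g := by
    constructor
    · rintro ⟨g, hg, rfl⟩
      exact ⟨fun i j h => hF.mem_maximalIdeal_pow_iff.1 (hg.1.1 i j h),
        fun i j h => hF.mem_maximalIdeal_pow_iff.1 (hg.1.2 i j h),
        fun i => hF.mem_maximalIdeal_pow_iff.1 (hg.2 i)⟩
    · intro h
      obtain ⟨g', hg', e⟩ := hF.exists_lift (hF.hasEntries_of_dot h)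
      refine ⟨g', ⟨hg', fun i => hF.mem_maximalIdeal_pow_iff.2 ?_⟩, Units.ext e⟩
      have := h.2.2 i
      rw [← e] at this
      exact this
  det_ne_zero A hA := (hF.isLevel_iwahoriLevel m).det_ne_zero A (hF.hasEntries_of_dot hA)

/-- Modulo `𝔭 ^ (m + 1)` the matrix is upper triangular with ones on the diagonal. -/
theorem det_sub_one_mem (hF : UnramifiedFrobenius σ ϖ) {m : ℕ} {g : GL (Fin n) Kb}
    (hg : g ∈ iwahoriDotLevel m) : g.val.det - 1 ∈ ball ϖ (m + 1) := by
  obtain ⟨g, hg, rfl⟩ := hg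
  have h : Ideal.Quotient.mk (𝓂[Kb] ^ (m + 1)) (g.val.det) = 1 := by
    rw [RingHom.map_det, Matrix.det_of_isUpperTriangular]
    · refine Finset.prod_eq_one fun i _ => ?_
      rw [← map_one (Ideal.Quotient.mk (𝓂[Kb] ^ (m + 1)))]
      exact Ideal.Quotient.eq.2 (hg.2 i)
    · intro i j hij
      exact Ideal.Quotient.eq_zero_iff_mem.2 (hg.1.2 i j hij)
  rw [← map_one (Ideal.Quotient.mk (𝓂[Kb] ^ (m + 1))), Ideal.Quotient.eq,
    hF.mem_maximalIdeal_pow_iff] at h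
  have e : (Matrix.GeneralLinearGroup.map (algebraMap 𝒪[Kb] Kb) g).val.det
      = algebraMap 𝒪[Kb] Kb g.val.det := (RingHom.map_det _ _).symm
  rw [e]
  exact h

end UnramifiedFrobenius

end LevelInstances

/-! ### Boundedness of the iterates of `bσ` and integrality -/

section Integrality

variable {K Kb : Type*} [Field K] [Field Kb] [Algebra K Kb] {n : ℕ}

theorem frob_mulVec (σ : Kb ≃ₐ[K] Kb) (g : GL (Fin n) Kb) (y : Fin n → Kb) :
    (fun i => σ ((g.val *ᵥ y) i)) = (frob σ g).val *ᵥ fun i => σ (y i) := by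
  ext i
  simp only [Matrix.mulVec, dotProduct, map_sum, map_mul]
  rfl

theorem frob_iterate_mulVec (σ : Kb ≃ₐ[K] Kb) (j : ℕ) (g : GL (Fin n) Kb) (y : Fin n → Kb) :
    (fun i => σ^[j] ((g.val *ᵥ y) i)) = ((frob σ)^[j] g).val *ᵥ fun i => σ^[j] (y i) := by
  induction j generalizing g y with
  | zero => rfl
  | succ j ih =>
    simp only [Function.iterate_succ_apply]
    rw [← ih, ← frob_mulVec]

theorem bsig_iterate_eq (σ : Kb ≃ₐ[K] Kb) (b : GL (Fin n) Kb) (s : ℕ) (x : Fin n → Kb) :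
    (bsig σ b)^[s] x =
      ((List.range s).map fun i => (frob σ)^[i] b).prod.val *ᵥ fun i => σ^[s] (x i) := by
  induction s generalizing x with
  | zero => simp
  | succ s ih =>
    rw [Function.iterate_succ_apply, ih, bsig, frob_iterate_mulVec, Matrix.mulVec_mulVec,
      List.range_succ, List.map_append, List.prod_append, ← Units.val_mul]
    simp [Function.iterate_succ_apply]

variable [ValuativeRel Kb] {σ : Kb ≃ₐ[K] Kb} {ϖ : Kbˣ}

theorem exists_bound_mulVec (A : Matrix (Fin n) (Fin n) Kb) :
    ∃ α : ValueGroupWithZero Kb, 1 ≤ α ∧ ∀ (y : Fin n → Kb) (B : ValueGroupWithZero Kb),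
      (∀ i, valuation Kb (y i) ≤ B) → ∀ i, valuation Kb ((A *ᵥ y) i) ≤ α * B := by
  obtain ⟨M, hM⟩ := (Set.finite_range fun p : Fin n × Fin n => valuation Kb (A p.1 p.2)).bddAbove
  refine ⟨max 1 M, le_max_left _ _, fun y B hy i => ?_⟩
  rw [Matrix.mulVec, dotProduct]
  refine Valuation.map_sum_le _ fun j _ => ?_
  rw [map_mul]
  exact mul_le_mul' ((hM ⟨(i, j), rfl⟩).trans (le_max_right _ _)) (hy j)

namespace UnramifiedFrobenius

theorem val_frob_iterate (hF : UnramifiedFrobenius σ ϖ) (j : ℕ) (x : Kb) :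
    valuation Kb (σ^[j] x) = valuation Kb x := by
  induction j with
  | zero => rfl
  | succ j ih => rw [Function.iterate_succ_apply', hF.val_frob, ih]

theorem exists_pow_mul_lt_one (hF : UnramifiedFrobenius σ ϖ) (B : ValueGroupWithZero Kb) :
    ∃ N : ℕ, valuation Kb (ϖ : Kb) ^ N * B < 1 := by
  obtain ⟨β, rfl⟩ := valuation_surjective B
  by_cases hβ : β = 0
  · exact ⟨0, by simp [hβ]⟩
  obtain ⟨N, hN⟩ := hF.archimedean β⁻¹ (inv_ne_zero hβ)
  have hv : valuation Kb β ≠ 0 := (map_ne_zero _).2 hβ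
  exact ⟨N, by rwa [map_inv₀, lt_inv_comm₀ (pow_pos (zero_lt_iff.2 ((map_ne_zero _).2 ϖ.ne_zero)) N)
    (zero_lt_iff.2 hv), ← one_div, lt_div_iff₀' (pow_pos (zero_lt_iff.2
      ((map_ne_zero _).2 ϖ.ne_zero)) N)] at hN⟩

theorem val_le_mul_of_lt (hF : UnramifiedFrobenius σ ϖ) {x y : Kb}
    (h : valuation Kb x < valuation Kb y) :
    valuation Kb x ≤ valuation Kb (ϖ : Kb) * valuation Kb y := by
  have hy : 0 < valuation Kb y := lt_of_le_of_lt zero_le h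
  have := hF.val_le (x / y) (by rwa [map_div₀, div_lt_one₀ hy])
  rwa [map_div₀, div_le_iff₀ hy] at this

/-- Bounded solutions of a recurrence with coefficients the Frobenius twists of `a` force `a` to
be integral. -/
theorem val_le_one_of_recurrence (hF : UnramifiedFrobenius σ ϖ) {a : Fin n → Kb}
    {y : ℕ → Fin n → Kb} (hy : ∀ j : Fin n, y j = Pi.single j 1)
    (hrec : ∀ l, y (n + l) = ∑ i : Fin n, σ^[l] (a i) • y (i + l))
    {B : ValueGroupWithZero Kb} (hB : ∀ j i, valuation Kb (y j i) ≤ B) (k : Fin n) :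
    valuation Kb (a k) ≤ 1 := by
  by_contra hk
  -- Lexicographic choice: `k₀` is the last index among the coefficients of largest value.
  obtain ⟨k₀, -, hk₀⟩ := Finset.exists_max_image Finset.univ
    (fun i => toLex (valuation Kb (a i), i)) ⟨k, Finset.mem_univ k⟩
  have hk₀ : ∀ i, valuation Kb (a i) < valuation Kb (a k₀) ∨
      valuation Kb (a i) = valuation Kb (a k₀) ∧ i ≤ k₀ := fun i =>
    Prod.Lex.le_iff.1 (hk₀ i (Finset.mem_univ i))
  have hle : ∀ i, valuation Kb (a i) ≤ valuation Kb (a k₀) := fun i =>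
    (hk₀ i).elim le_of_lt fun h => h.1.le
  have h1 : 1 < valuation Kb (a k₀) := (not_le.1 hk).trans_le (hle k)
  have h1' : 1 ≤ valuation Kb (ϖ : Kb) * valuation Kb (a k₀) := by
    simpa using hF.val_le_mul_of_lt (x := 1) (y := a k₀) (by simpa using h1)
  -- The recurrence is solved for the term with coefficient `a k₀`. The left side and the terms with
  -- smaller coefficients gain a factor `ϖ` over the bound for `N`. Terms with an equally large
  -- coefficient have `i < k₀`, so the inner induction on `j` covers them. Thus the bound improves
  -- indefinitely, although `y k₀` has `k₀`-th coordinate `1`.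
  have key : ∀ N j, valuation Kb (y j k₀) ≤ valuation Kb (ϖ : Kb) ^ N * B := by
    intro N
    induction N with
    | zero => intro j; simpa using hB j k₀
    | succ N ihN =>
      intro j
      induction j using Nat.strong_induction_on with
      | _ j ih =>
        rcases lt_or_ge j k₀ with hj | hj
        · have h0 : y j k₀ = 0 := by
            have := congrFun (hy ⟨j, hj.trans k₀.2⟩) k₀
            rwa [Pi.single_eq_of_ne (fun h => hj.ne' (congrArg Fin.val h))] at this
          rw [h0, map_zero]
          exact zero_le
        · obtain ⟨l, rfl⟩ := Nat.exists_eq_add_of_le hj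
          have hr := congrFun (hrec l) k₀
          simp only [Finset.sum_apply, Pi.smul_apply, smul_eq_mul] at hr
          rw [← Finset.add_sum_erase _ _ (Finset.mem_univ k₀), ← sub_eq_iff_eq_add] at hr
          have hpos : 0 < valuation Kb (a k₀) := zero_lt_one.trans h1
          refine le_of_mul_le_mul_left ?_ hpos
          rw [← hF.val_frob_iterate l (a k₀), ← map_mul, ← hr, hF.val_frob_iterate]
          have hone : ∀ {t : Kb}, valuation Kb t ≤ valuation Kb (ϖ : Kb) * valuation Kb (a k₀) →
              ∀ j, valuation Kb t * valuation Kb (y j k₀)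
                ≤ valuation Kb (a k₀) * (valuation Kb (ϖ : Kb) ^ (N + 1) * B) := by
            intro t ht j
            calc _ ≤ (valuation Kb (ϖ : Kb) * valuation Kb (a k₀))
                  * (valuation Kb (ϖ : Kb) ^ N * B) := mul_le_mul' ht (ihN j)
              _ = _ := by rw [pow_succ]; ac_rfl
          refine Valuation.map_sub_le _ ?_ (Valuation.map_sum_le _ fun i hi => ?_)
          · simpa using hone (t := 1) (by simpa using h1') (n + l)
          · rw [map_mul, hF.val_frob_iterate]
            have hik : i ≠ k₀ := Finset.ne_of_mem_erase hi
            rcases hk₀ i with h | ⟨h, h'⟩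
            · exact hone (hF.val_le_mul_of_lt h) _
            · have : (i : ℕ) < k₀ := lt_of_le_of_ne h' fun e => hik (Fin.ext e)
              exact mul_le_mul' h.le (ih (i + l) (by omega))
  obtain ⟨N, hN⟩ := hF.exists_pow_mul_lt_one B
  have h := (key N k₀).trans_lt hN
  rw [hy, Pi.single_eq_same, map_one] at h
  exact lt_irrefl _ h

end UnramifiedFrobenius

namespace UnramifiedFrobenius

theorem val_det_frob_iterate (hF : UnramifiedFrobenius σ ϖ) (j : ℕ) (g : GL (Fin n) Kb) :
    valuation Kb ((frob σ)^[j] g).val.det = valuation Kb g.val.det := by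
  induction j with
  | zero => rfl
  | succ j ih =>
    have e : ∀ g : GL (Fin n) Kb, (frob σ g).val.det = σ g.val.det := fun g =>
      (RingHom.map_det (σ : Kb →+* Kb) g.val).symm
    rw [Function.iterate_succ_apply', e, hF.val_frob, ih]

variable {b : GL (Fin n) Kb} {κ : ℕ} [NeZero n]

/-- After the change of basis `c`, the operator `(bσ)^s` is `ϖ ^ d σ^s`. Comparing determinants
shows that `ϖ ^ d` is integral, so `(bσ)^s` does not increase values in that basis. The fewer than
`s` remaining steps cost a bounded factor. -/
theorem exists_bound_iterate (hF : UnramifiedFrobenius σ ϖ) (hb : IsBasic σ ϖ b)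
    (hbκ : valuation Kb b.val.det = valuation Kb (ϖ : Kb) ^ κ) (x : Fin n → Kb) :
    ∃ B : ValueGroupWithZero Kb, ∀ j i, valuation Kb (((bsig σ b)^[j] x) i) ≤ B := by
  obtain ⟨s, d, c, hs, hc⟩ := hb
  set P := ((List.range s).map fun i => (frob σ)^[i] b).prod with hP
  rw [mul_inv_eq_iff_eq_mul] at hc
  have hd : valuation Kb ((ϖ ^ d : Kbˣ) : Kb) ≤ 1 := by
    have hdet := congrArg (fun g : GL (Fin n) Kb => valuation Kb g.val.det) hc
    simp only [Units.val_mul, Matrix.det_mul, map_mul, hF.val_det_frob_iterate, coe_diagGL,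
      Matrix.det_diagonal, Finset.prod_const, Finset.card_univ, Fintype.card_fin, map_pow] at hdet
    have hPdet : ∀ t, valuation Kb ((List.range t).map fun i => (frob σ)^[i] b).prod.val.det
        = (valuation Kb (ϖ : Kb) ^ κ) ^ t := by
      intro t
      induction t with
      | zero => simp
      | succ t ih =>
        rw [List.range_succ, List.map_append, List.prod_append, Units.val_mul, Matrix.det_mul,
          map_mul, ih, pow_succ]
        simp [hF.val_det_frob_iterate, hbκ]
    have hc0 : valuation Kb c.val.det ≠ 0 :=
      (map_ne_zero _).2 ((Matrix.isUnit_iff_isUnit_det _).1 c.isUnit).ne_zero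
    rw [hPdet, mul_comm] at hdet
    have h2 := mul_right_cancel₀ hc0 hdet
    by_contra hlt
    have h3 := one_lt_pow₀ (not_le.1 hlt) (NeZero.ne n)
    rw [← h2] at h3
    exact h3.not_ge (pow_le_one' (pow_le_one' hF.val_lt_one.le _) _)
  have hstep : ∀ y : Fin n → Kb, ∀ i, (c.val *ᵥ ((bsig σ b)^[s] y)) i
      = ((ϖ ^ d : Kbˣ) : Kb) * σ^[s] ((c.val *ᵥ y) i) := by
    intro y i
    rw [bsig_iterate_eq, Matrix.mulVec_mulVec, ← hP, ← Units.val_mul, hc, Units.val_mul,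
      ← Matrix.mulVec_mulVec, ← frob_iterate_mulVec, coe_diagGL, Matrix.mulVec_diagonal]
  obtain ⟨α, hα, hαb⟩ := exists_bound_mulVec b.val
  obtain ⟨α', -, hα'⟩ := exists_bound_mulVec (c⁻¹).val
  obtain ⟨B, hB⟩ := (Set.finite_range fun i => valuation Kb ((c.val *ᵥ x) i)).bddAbove
  have h1 : ∀ t i, valuation Kb ((c.val *ᵥ ((bsig σ b)^[s * t] x)) i) ≤ B := by
    intro t
    induction t with
    | zero => exact fun i => hB ⟨i, rfl⟩
    | succ t ih =>
      intro i
      rw [mul_add, mul_one, add_comm, Function.iterate_add_apply, hstep, map_mul,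
        hF.val_frob_iterate]
      exact (mul_le_of_le_one_left' hd).trans (ih i)
  have h2 : ∀ t i, valuation Kb (((bsig σ b)^[s * t] x) i) ≤ α' * B := by
    intro t i
    have := hα' _ B (h1 t) i
    rwa [Matrix.mulVec_mulVec, ← Units.val_mul, inv_mul_cancel, Units.val_one,
      Matrix.one_mulVec] at this
  have h3 : ∀ (l : ℕ) (y : Fin n → Kb) (B : ValueGroupWithZero Kb),
      (∀ i, valuation Kb (y i) ≤ B) → ∀ i, valuation Kb (((bsig σ b)^[l] y) i) ≤ α ^ l * B := by
    intro l y B hy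
    induction l with
    | zero => simpa using hy
    | succ l ih =>
      intro i
      rw [Function.iterate_succ_apply', pow_succ', mul_assoc]
      exact hαb _ _ (fun i => by rw [hF.val_frob]; exact ih i) i
  refine ⟨α ^ s * (α' * B), fun j i => ?_⟩
  rw [← Nat.mod_add_div j s, Function.iterate_add_apply]
  exact (h3 _ _ _ (h2 _) i).trans
    (mul_le_mul_left (pow_le_pow_right₀ hα (Nat.mod_lt _ (by omega)).le) _)

end UnramifiedFrobenius

end Integrality

/-! ### The matrix of `bσ` in a cyclic basis -/

section Companion

variable {K Kb : Type*} [Field K] [Field Kb] [Algebra K Kb] {n : ℕ}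

/-- The coefficients of `(bσ) ^ n x` in the basis `x, bσ(x), …, (bσ)^(n-1)(x)`. -/
def coeff (σ : Kb ≃ₐ[K] Kb) (b : GL (Fin n) Kb) (x : Vadm σ b) : Fin n → Kb :=
  (gb σ b x.1)⁻¹ *ᵥ (bsig σ b)^[n] x.1

theorem isUnit_det_gb {σ : Kb ≃ₐ[K] Kb} {b : GL (Fin n) Kb} (x : Vadm σ b) :
    IsUnit (gb σ b x.1).det := isUnit_iff_ne_zero.2 x.2

theorem gb_mulVec_coeff (σ : Kb ≃ₐ[K] Kb) (b : GL (Fin n) Kb) (x : Vadm σ b) :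
    gb σ b x.1 *ᵥ coeff σ b x = (bsig σ b)^[n] x.1 := by
  rw [coeff, Matrix.mulVec_mulVec, Matrix.mul_nonsing_inv _ (isUnit_det_gb x), Matrix.one_mulVec]

theorem gb_mulVec (σ : Kb ≃ₐ[K] Kb) (b : GL (Fin n) Kb) (x y : Fin n → Kb) :
    gb σ b x *ᵥ y = ∑ k, y k • (bsig σ b)^[k] x := by
  ext i
  simp [Matrix.mulVec, dotProduct, gb, mul_comm]

theorem bsig_sum {ι : Type*} (σ : Kb ≃ₐ[K] Kb) (b : GL (Fin n) Kb) (s : Finset ι)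
    (y : ι → Fin n → Kb) : bsig σ b (∑ k ∈ s, y k) = ∑ k ∈ s, bsig σ b (y k) := by
  have h : (fun i => σ ((∑ k ∈ s, y k) i)) = ∑ k ∈ s, fun i => σ (y k i) := by
    ext i
    simp
  rw [bsig, h, Matrix.mulVec_sum]
  rfl

theorem bsig_iterate_sum {ι : Type*} (σ : Kb ≃ₐ[K] Kb) (b : GL (Fin n) Kb) (l : ℕ) (s : Finset ι)
    (y : ι → Fin n → Kb) :
    (bsig σ b)^[l] (∑ k ∈ s, y k) = ∑ k ∈ s, (bsig σ b)^[l] (y k) := by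
  induction l with
  | zero => rfl
  | succ l ih => simp only [Function.iterate_succ_apply', ih, bsig_sum]

theorem bsig_iterate_add_dim (σ : Kb ≃ₐ[K] Kb) (b : GL (Fin n) Kb) (x : Vadm σ b) (l : ℕ) :
    (bsig σ b)^[n + l] x.1 = ∑ k : Fin n, σ^[l] (coeff σ b x k) • (bsig σ b)^[k + l] x.1 := by
  rw [add_comm, Function.iterate_add_apply, ← gb_mulVec_coeff, gb_mulVec, bsig_iterate_sum]
  refine Finset.sum_congr rfl fun k _ => ?_
  rw [bsig_iterate_smul, ← Function.iterate_add_apply, add_comm]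

/-- In the cyclic basis the iterates of `bσ` on `x` are bounded, start with the unit vectors and
satisfy a recurrence whose coefficients are Frobenius twists of `coeff`. -/
theorem UnramifiedFrobenius.val_coeff_le_one [ValuativeRel Kb] {σ : Kb ≃ₐ[K] Kb} {ϖ : Kbˣ}
    [NeZero n] (hF : UnramifiedFrobenius σ ϖ) {b : GL (Fin n) Kb} {κ : ℕ} (hb : IsBasic σ ϖ b)
    (hbκ : valuation Kb b.val.det = valuation Kb (ϖ : Kb) ^ κ) (x : Vadm σ b) (k : Fin n) :
    valuation Kb (coeff σ b x k) ≤ 1 := by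
  obtain ⟨B, hB⟩ := hF.exists_bound_iterate hb hbκ x.1
  obtain ⟨α, -, hα⟩ := exists_bound_mulVec (gb σ b x.1)⁻¹
  refine hF.val_le_one_of_recurrence (y := fun j => (gb σ b x.1)⁻¹ *ᵥ (bsig σ b)^[j] x.1)
    (fun j => ?_) (fun l => ?_) (B := α * B) (fun j i => hα _ B (hB j) i) k
  · have e : (bsig σ b)^[(j : ℕ)] x.1 = gb σ b x.1 *ᵥ Pi.single j 1 := by
      ext i
      simp [gb]
    simp only [e]
    rw [Matrix.mulVec_mulVec, Matrix.nonsing_inv_mul _ (isUnit_det_gb x), Matrix.one_mulVec]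
  · rw [bsig_iterate_add_dim, Matrix.mulVec_sum]
    simp only [Matrix.mulVec_smul]

variable [NeZero n]

/-- The element `i` with `g⁻¹ b σ(g) = ẇ_r i` for `g = g_{b,r}(x)`. -/
def cyclicPart (σ : Kb ≃ₐ[K] Kb) (ϖ : Kbˣ) (κ : ℕ) (b : GL (Fin n) Kb) (r : ℕ) (x : Vadm σ b) :
    GL (Fin n) Kb :=
  (wdot ϖ κ r)⁻¹ * ((gbrGL σ ϖ b r x)⁻¹ * b * frob σ (gbrGL σ ϖ b r x))

theorem wdot_mul_cyclicPart (σ : Kb ≃ₐ[K] Kb) (ϖ : Kbˣ) (κ : ℕ) (b : GL (Fin n) Kb) (r : ℕ)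
    (x : Vadm σ b) : (gbrGL σ ϖ b r x)⁻¹ * b * frob σ (gbrGL σ ϖ b r x)
      = wdot ϖ κ r * cyclicPart σ ϖ κ b r x := by
  rw [cyclicPart, mul_inv_cancel_left]

/-- The quotient of the constant coefficient by `ϖ ^ κ`. -/
def detPart (σ : Kb ≃ₐ[K] Kb) (ϖ : Kbˣ) (κ : ℕ) (b : GL (Fin n) Kb) (x : Vadm σ b) : Kb :=
  coeff σ b x 0 / (ϖ : Kb) ^ κ

/-- `bσ` sends each column of `g_{b,r}(x)` to `ϖ ^ (-r)` times the next, except for the last column,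
where `coeff` enters. Undoing `ẇ_r` moves the coefficient of index `k + 1` to row `k`. The constant
coefficient moves to the last row, where all powers of `ϖ` depending on `r` cancel; so `detPart`
does not involve `r`. -/
theorem cyclicPart_eq {σ : Kb ≃ₐ[K] Kb} {ϖ : Kbˣ} (hϖ : σ (ϖ : Kb) = ϖ) (κ : ℕ)
    (b : GL (Fin n) Kb) (r : ℕ) (x : Vadm σ b) :
    (cyclicPart σ ϖ κ b r x).val = Matrix.of fun k l : Fin n =>
      if (l : ℕ) + 1 = n then
        (if (k : ℕ) + 1 = n then detPart σ ϖ κ b x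
          else (ϖ : Kb) ^ (r * (n - 1 - k)) * coeff σ b x (k + 1))
      else if k = l then 1 else 0 := by
  set M : Matrix (Fin n) (Fin n) Kb := Matrix.of fun k l : Fin n =>
      if (l : ℕ) + 1 = n then
        (if (k : ℕ) + 1 = n then detPart σ ϖ κ b x
          else (ϖ : Kb) ^ (r * (n - 1 - k)) * coeff σ b x (k + 1))
      else if k = l then 1 else 0 with hM
  have hϖ0 : (ϖ : Kb) ≠ 0 := ϖ.ne_zero
  have main : (b * frob σ (gbrGL σ ϖ b r x)).val
      = (gbrGL σ ϖ b r x * wdot ϖ κ r).val * M := by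
    ext i l
    -- Multiplying by `ϖ ^ r` removes the negative exponents, so that `wdot_mulVec_apply` applies.
    refine mul_left_cancel₀ (pow_ne_zero r hϖ0) ?_
    have hL : (b * frob σ (gbrGL σ ϖ b r x)).val i l
        = (ϖ : Kb) ^ (r * (l : ℕ)) * ((bsig σ b)^[(l : ℕ) + 1] x.1) i := by
      have e := congrFun (bsig_smul σ b ((ϖ : Kb) ^ (r * (l : ℕ))) ((bsig σ b)^[(l : ℕ)] x.1)) i
      rw [map_pow, hϖ, Pi.smul_apply, smul_eq_mul,
        ← Function.iterate_succ_apply' (bsig σ b)] at e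
      rw [← e]
      rfl
    have hR : (ϖ : Kb) ^ r * ((gbrGL σ ϖ b r x * wdot ϖ κ r).val * M) i l
        = ∑ k, gbr σ ϖ b r x.1 i k * ((ϖ : Kb) ^ r * ((wdot ϖ κ r).val *ᵥ fun k => M k l) k) := by
      rw [Units.val_mul, mul_assoc, Matrix.mul_apply, Finset.mul_sum]
      refine Finset.sum_congr rfl fun k _ => ?_
      rw [coe_gbrGL, mul_left_comm]
      rfl
    rw [hL, hR]
    by_cases hl : (l : ℕ) + 1 = n
    · have hw : ∀ k' : Fin n, (ϖ : Kb) ^ r * ((wdot ϖ κ r).val *ᵥ fun k => M k l) k'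
          = (ϖ : Kb) ^ (r * (n - k')) * coeff σ b x k' := by
        intro k'
        obtain ⟨k, rfl, ⟨h1, h2⟩ | ⟨h1, h2⟩⟩ := exists_eq_add_one k' <;>
          rw [wdot_mulVec_apply, hM, Matrix.of_apply, if_pos hl]
        · have h3 : k + 1 = 0 := Fin.ext h2
          rw [if_pos h1, if_pos h1, h3, detPart, Fin.val_zero, Nat.sub_zero, pow_add]
          field_simp
          ring
        · rw [if_neg h1, if_neg h1, one_mul, h2, Nat.sub_sub, add_comm 1]
      have hn := congrFun (gb_mulVec_coeff σ b x) i
      rw [hl, ← hn, Matrix.mulVec, dotProduct, ← mul_assoc, ← pow_add, Finset.mul_sum]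
      refine Finset.sum_congr rfl fun k _ => ?_
      have hk := k.2
      have e : r + r * (l : ℕ) = r * (k : ℕ) + r * (n - k) := by
        rw [← mul_add, Nat.add_sub_cancel' hk.le, add_comm, ← Nat.mul_succ, Nat.succ_eq_add_one, hl]
      rw [hw, e, pow_add, gbr, Matrix.of_apply, gb, Matrix.of_apply]
      ring
    · have hl' : ((l + 1 : Fin n) : ℕ) = l + 1 := Fin.val_add_one_of_lt' (by omega)
      rw [Finset.sum_eq_single (l + 1), wdot_mulVec_apply, hM, Matrix.of_apply, if_neg hl,
        if_neg hl, if_pos rfl, mul_one, mul_one, gbr, Matrix.of_apply, hl', mul_add, mul_one,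
        pow_add]
      · ring
      · intro k' _ hk'
        obtain ⟨k, rfl, -⟩ := exists_eq_add_one k'
        have hkl : k ≠ l := fun h => hk' (by rw [h])
        rw [wdot_mulVec_apply, hM, Matrix.of_apply, if_neg hl, if_neg hkl, mul_zero, mul_zero]
      · simp
  have e : (cyclicPart σ ϖ κ b r x).val
      = ((gbrGL σ ϖ b r x * wdot ϖ κ r)⁻¹).val * (b * frob σ (gbrGL σ ϖ b r x)).val := by
    rw [← Units.val_mul, cyclicPart]
    congr 1
    group
  rw [e, main, ← mul_assoc, ← Units.val_mul, inv_mul_cancel, Units.val_one, one_mul]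

variable {σ : Kb ≃ₐ[K] Kb} {ϖ : Kbˣ} {κ : ℕ} {b : GL (Fin n) Kb}

theorem det_cyclicPart (hϖ : σ (ϖ : Kb) = ϖ) (r : ℕ) (x : Vadm σ b) :
    (cyclicPart σ ϖ κ b r x).val.det = detPart σ ϖ κ b x := by
  have hn := NeZero.pos n
  rw [cyclicPart_eq hϖ, Matrix.det_of_isUpperTriangular]
  · rw [Finset.prod_eq_single ⟨n - 1, by omega⟩]
    · have h : n - 1 + 1 = n := by omega
      simp [h]
    · intro k _ hk
      have h : (k : ℕ) + 1 ≠ n := fun h => hk (Fin.ext (by simp; omega))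
      simp [h]
    · simp
  · intro k l hkl
    have hkl : (l : ℕ) < k := hkl
    have h : (l : ℕ) + 1 ≠ n := by omega
    have h' : k ≠ l := by rintro rfl; omega
    simp [h, h']

theorem hasEntries_cyclicPart (hϖ : σ (ϖ : Kb) = ϖ) {r : ℕ} {x : Vadm σ b}
    {S T : AddSubgroup Kb} {D : Set Kb} (h1 : 1 ∈ D) (hD : detPart σ ϖ κ b x ∈ D)
    (hS : ∀ k, (ϖ : Kb) ^ r * coeff σ b x k ∈ S)
    (hS' : ∀ s ∈ S, ∀ j, (ϖ : Kb) ^ j * s ∈ S) :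
    HasEntries S T D (cyclicPart σ ϖ κ b r x).val := by
  rw [cyclicPart_eq hϖ]
  refine ⟨fun k l hkl => ?_, fun k l hkl => ?_, fun k => ?_⟩ <;> rw [Matrix.of_apply]
  · have hkl' : (k : ℕ) < l := hkl
    have hl := l.2
    have hk : (k : ℕ) + 1 ≠ n := by omega
    rw [if_neg hk, if_neg hkl.ne]
    split_ifs with h
    · obtain ⟨j, hj⟩ : ∃ j, n - 1 - (k : ℕ) = 1 + j := Nat.exists_eq_add_of_le (by omega)
      rw [hj, mul_add, mul_one, pow_add, mul_right_comm, mul_comm]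
      exact hS' _ (hS _) _
    · exact S.zero_mem
  · have hkl' : (l : ℕ) < k := hkl
    have hl : (l : ℕ) + 1 ≠ n := by omega
    rw [if_neg hl, if_neg hkl.ne']
    exact T.zero_mem
  · by_cases h : (k : ℕ) + 1 = n
    · rwa [if_pos h, if_pos h]
    · rwa [if_neg h, if_pos rfl]

/-- Determinants of `b σ(g) = g ẇ_0 i` for `g = g_b(x)`. This links the rationality of `det g_b(x)`
to `detPart`. -/
theorem frob_det_gb (hϖ : σ (ϖ : Kb) = ϖ) (x : Vadm σ b) :
    b.val.det * σ (gb σ b x.1).det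
      = (gb σ b x.1).det * ((wdot (n := n) ϖ κ 0).val.det * detPart σ ϖ κ b x) := by
  have h := wdot_mul_cyclicPart σ ϖ κ b 0 x
  rw [mul_assoc, inv_mul_eq_iff_eq_mul] at h
  have h2 := congrArg (fun g : GL (Fin n) Kb => g.val.det) h
  simp only [Units.val_mul, Matrix.det_mul, det_cyclicPart hϖ] at h2
  have e : (gbrGL σ ϖ b 0 x).val = gb σ b x.1 := by
    rw [coe_gbrGL, gbr_eq]
    simp
  have e' : (frob σ (gbrGL σ ϖ b 0 x)).val.det = σ (gb σ b x.1).det := by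
    rw [← e]
    exact (RingHom.map_det (σ : Kb →+* Kb) _).symm
  rwa [e', e] at h2

end Companion

/-! ### Which admissible vectors give points of which Deligne-Lusztig sets -/

section Membership

variable {K Kb : Type*} [Field K] [Field Kb] [Algebra K Kb] {n : ℕ}
  {σ : Kb ≃ₐ[K] Kb} {ϖ : Kbˣ} {κ : ℕ} {b : GL (Fin n) Kb}

theorem det_ne_zero (g : GL (Fin n) Kb) : g.val.det ≠ 0 :=
  ((Matrix.isUnit_iff_isUnit_det _).1 g.isUnit).ne_zero

theorem val_det_le_one [ValuativeRel Kb] {A : Matrix (Fin n) (Fin n) Kb}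
    (hA : ∀ i j, valuation Kb (A i j) ≤ 1) :
    valuation Kb A.det ≤ 1 := by
  have e : A.det = algebraMap 𝒪[Kb] Kb
      (Matrix.of fun i j => (⟨A i j, hA i j⟩ : 𝒪[Kb]) : Matrix (Fin n) (Fin n) 𝒪[Kb]).det := by
    rw [RingHom.map_det]
    rfl
  rw [e]
  exact (Matrix.det _ : 𝒪[Kb]).2

/-- Scaling `x` by `a` multiplies `g_{b,r}(x)` on the right by the diagonal matrix of the `σ^j(a)`,
which lies in the level. -/
theorem IsLevel.gbrGL_scale_eq {R S T : AddSubgroup Kb} {D : Set Kb}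
    {H : Subgroup (GL (Fin n) Kb)} (hH : IsLevel σ R S T D H) {a : Kbˣ} (ha : (a : Kb) ∈ D)
    (r : ℕ) (x : Vadm σ b) :
    (gbrGL σ ϖ b r (scale a x) : GL (Fin n) Kb ⧸ H) = gbrGL σ ϖ b r x := by
  have haD : ∀ j : ℕ, σ^[j] (a : Kb) ∈ D := by
    intro j
    induction j with
    | zero => exact ha
    | succ j ih =>
      rw [Function.iterate_succ_apply']
      exact hH.frob_D _ ih
  rw [eq_comm, QuotientGroup.eq, hH.mem_iff]
  have e : ((gbrGL σ ϖ b r x)⁻¹ * gbrGL σ ϖ b r (scale a x)).val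
      = Matrix.diagonal fun j : Fin n => σ^[(j : ℕ)] (a : Kb) := by
    have h : (gbrGL σ ϖ b r (scale a x)).val
        = (gbrGL σ ϖ b r x).val * Matrix.diagonal fun j : Fin n => σ^[(j : ℕ)] (a : Kb) :=
      gbr_smul σ ϖ b r a x.1
    rw [Units.val_mul, h, ← mul_assoc, ← Units.val_mul, inv_mul_cancel, Units.val_one, one_mul]
  rw [e]
  refine ⟨fun i j h => ?_, fun i j h => ?_, fun i => ?_⟩
  · rw [Matrix.diagonal_apply_ne _ h.ne]
    exact zero_mem _
  · rw [Matrix.diagonal_apply_ne _ h.ne']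
    exact zero_mem _
  · rw [Matrix.diagonal_apply_eq]
    exact haD i

variable [NeZero n]

theorem mem_dlSet_of_cyclicPart_mem {H : Subgroup (GL (Fin n) Kb)} {r : ℕ} {x : Vadm σ b}
    (h : cyclicPart σ ϖ κ b r x ∈ H) :
    (gbrGL σ ϖ b r x : GL (Fin n) Kb ⧸ H) ∈ dlSet σ H (wdot ϖ κ r) b :=
  ⟨_, rfl, DoubleCoset.mem_doubleCoset.2 ⟨1, H.one_mem, _, h, by
    rw [wdot_mul_cyclicPart σ ϖ κ, one_mul]⟩⟩

/-- Another representative of the class changes `g⁻¹ b σ(g)` by elements of `H` on both sides. In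
the comparison of determinants `det ẇ_r` cancels. -/
theorem exists_detPart_eq_det (hϖ : σ (ϖ : Kb) = ϖ) {H : Subgroup (GL (Fin n) Kb)}
    (hH : ∀ g ∈ H, frob σ g ∈ H) {r : ℕ} {x : Vadm σ b}
    (h : (gbrGL σ ϖ b r x : GL (Fin n) Kb ⧸ H) ∈ dlSet σ H (wdot ϖ κ r) b) :
    ∃ g ∈ H, detPart σ ϖ κ b x = g.val.det := by
  obtain ⟨g, hg, hx⟩ := h
  obtain ⟨u, hu, v, hv, e⟩ := DoubleCoset.mem_doubleCoset.1 hx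
  rw [eq_comm, QuotientGroup.eq] at hg
  set h := (gbrGL σ ϖ b r x)⁻¹ * g with hh
  refine ⟨h * u * v * (frob σ h)⁻¹,
    H.mul_mem (H.mul_mem (H.mul_mem hg hu) hv) (H.inv_mem (hH _ hg)), ?_⟩
  have e1 : g = gbrGL σ ϖ b r x * h := by rw [hh, mul_inv_cancel_left]
  have e2 : wdot ϖ κ r * cyclicPart σ ϖ κ b r x = h * (u * wdot ϖ κ r * v) * (frob σ h)⁻¹ := by
    rw [← e, e1, ← wdot_mul_cyclicPart, map_mul]
    group
  have e3 := congrArg (fun g : GL (Fin n) Kb => g.val.det) e2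
  simp only [Units.val_mul, Matrix.det_mul, det_cyclicPart hϖ] at e3 ⊢
  refine mul_left_cancel₀ (det_ne_zero (wdot (n := n) ϖ κ r)) ?_
  rw [e3]
  ring

theorem detPart_ne_zero (hϖ : σ (ϖ : Kb) = ϖ) (x : Vadm σ b) : detPart σ ϖ κ b x ≠ 0 := by
  rw [← det_cyclicPart hϖ 0]
  exact det_ne_zero _

theorem cyclicPart_mem_upperBorel (hϖ : σ (ϖ : Kb) = ϖ) (r : ℕ) (x : Vadm σ b) :
    cyclicPart σ ϖ κ b r x ∈ upperBorel :=
  ((isLevel_upperBorel σ).mem_iff _).2 <| hasEntries_cyclicPart hϖ one_ne_zero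
    (detPart_ne_zero hϖ x) (fun _ => trivial) fun _ _ _ => trivial

theorem gbrGL_mem_XDLdot_iff (hϖ : σ (ϖ : Kb) = ϖ) (r : ℕ) (x : Vadm σ b) :
    (gbrGL σ ϖ b r x : GL (Fin n) Kb ⧸ unip) ∈ dlSet σ unip (wdot ϖ κ r) b ↔
      detPart σ ϖ κ b x = 1 := by
  constructor
  · intro h
    obtain ⟨g, hg, e⟩ := exists_detPart_eq_det hϖ (fun _ => (isLevel_unip σ).frob_mem) h
    rw [e, det_eq_one_of_mem_unip hg]
  · intro h
    exact mem_dlSet_of_cyclicPart_mem <| ((isLevel_unip σ).mem_iff _).2 <|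
      hasEntries_cyclicPart hϖ rfl h (fun _ => trivial) fun _ _ _ => trivial

theorem wdot_zero_det : (wdot (n := n) ϖ κ 0).val.det
    = (b₀ : GL (Fin n) Kb).val.det * (ϖ : Kb) ^ κ := by
  have hn := NeZero.pos n
  rw [wdot, Units.val_mul, Matrix.det_mul, coe_diagGL, Matrix.det_diagonal,
    Finset.prod_eq_single ⟨n - 1, by omega⟩]
  · have h : n - 1 + 1 = n := by omega
    simp [h]
  · intro k _ hk
    have h : (k : ℕ) + 1 ≠ n := fun h => hk (Fin.ext (by simp; omega))
    simp [h]
  · simp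

variable [ValuativeRel Kb]

theorem val_det_b₀ : valuation Kb (b₀ : GL (Fin n) Kb).val.det = 1 := by
  have h1 : valuation Kb (b₀ : GL (Fin n) Kb).val.det ≤ 1 := val_det_le_one fun i j => by
    simp only [b₀, Matrix.of_apply]
    split_ifs <;> simp
  have h2 : valuation Kb (b₀⁻¹ : GL (Fin n) Kb).val.det ≤ 1 := val_det_le_one fun i j => by
    change valuation Kb (if j = i + 1 then 1 else 0) ≤ 1
    split_ifs <;> simp
  have h3 : valuation Kb (b₀ : GL (Fin n) Kb).val.det
      * valuation Kb (b₀⁻¹ : GL (Fin n) Kb).val.det = 1 := by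
    rw [← map_mul, ← Matrix.det_mul, ← Units.val_mul, mul_inv_cancel, Units.val_one,
      Matrix.det_one, map_one]
  refine le_antisymm h1 ?_
  rw [← h3]
  exact mul_le_of_le_one_right' h2

/-- Towers of levels `H m`, for which the classes of the matrices `g_{b,r}(x)` in the sets
`LevelSet` are compatible; `normalize` says that the scalars in `D m` are congruent to `1`, up to
scalars which do not matter. -/
structure IsTower (σ : Kb ≃ₐ[K] Kb) (ϖ : Kbˣ) (κ : ℕ) (b : GL (Fin n) Kb) (D : ℕ → Set Kb)
    (H : ℕ → Subgroup (GL (Fin n) Kb)) : Prop where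
  level : ∀ m, IsLevel σ (ball ϖ 0) (ball ϖ m) (ball ϖ (m + 1)) (D m) (H m)
  anti : ∀ m m', m ≤ m' → D m' ⊆ D m
  cyclicPart_mem : ∀ (p q : Level) (x : Vadm σ b), q ≤ p →
    (gbrGL σ ϖ b p.1.1 x : GL (Fin n) Kb ⧸ H p.1.2) ∈ dlSet σ (H p.1.2) (wdot ϖ κ p.1.1) b →
    cyclicPart σ ϖ κ b q.1.1 x ∈ H q.1.2
  normalize : ∀ m, ∀ d ∈ D m, ∃ a : Kbˣ, valuation Kb (a : Kb) = 1 ∧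
    (a : Kb) * d - 1 ∈ ball ϖ (m + 1) ∧ ∀ m' r (x : Vadm σ b),
      (gbrGL σ ϖ b r (scale a x) : GL (Fin n) Kb ⧸ H m') = gbrGL σ ϖ b r x

namespace UnramifiedFrobenius

/-- In `frob_det_gb` the map `σ` preserves values, and `det b` and `det ẇ_0` have the same value. -/
theorem val_detPart (hF : UnramifiedFrobenius σ ϖ)
    (hbκ : valuation Kb b.val.det = valuation Kb (ϖ : Kb) ^ κ) (x : Vadm σ b) :
    valuation Kb (detPart σ ϖ κ b x) = 1 := by
  have h := congrArg (valuation Kb) (frob_det_gb (κ := κ) hF.frob_unif x)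
  rw [map_mul, hF.val_frob, hbκ, map_mul, map_mul, wdot_zero_det, map_mul, val_det_b₀, map_pow,
    one_mul, mul_comm] at h
  have h1 : valuation Kb (gb σ b x.1).det ≠ 0 := (map_ne_zero _).2 x.2
  have h2 : valuation Kb (ϖ : Kb) ^ κ ≠ 0 := pow_ne_zero _ ((map_ne_zero _).2 ϖ.ne_zero)
  have h3 := mul_left_cancel₀ h1 h
  exact (mul_eq_left₀ h2).1 h3.symm

variable (hF : UnramifiedFrobenius σ ϖ) (hb : IsBasic σ ϖ b)
  (hbκ : valuation Kb b.val.det = valuation Kb (ϖ : Kb) ^ κ)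

include hF hb hbκ

theorem pow_mul_coeff_mem {m r : ℕ} (hm : m ≤ r) (x : Vadm σ b) (k : Fin n) :
    (ϖ : Kb) ^ r * coeff σ b x k ∈ ball ϖ m :=
  hF.ball_anti hm <| by
    simpa using mul_mem_ball (pow_mem_ball ϖ r) (y := coeff σ b x k) (m' := 0)
      (by simpa [mem_ball] using hF.val_coeff_le_one hb hbκ x k)

/-- The nonzero entries above the diagonal are integral coefficients times at least `ϖ ^ r`.
Basicness enters here, through the integrality. -/
theorem cyclicPart_mem_iwahoriLevel {m r : ℕ} (hm : m ≤ r) (x : Vadm σ b) :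
    cyclicPart σ ϖ κ b r x ∈ iwahoriLevel m :=
  ((hF.isLevel_iwahoriLevel m).mem_iff _).2 <| hasEntries_cyclicPart hF.frob_unif (map_one _)
    (hF.val_detPart hbκ x) (hF.pow_mul_coeff_mem hb hbκ hm x) fun _ hs j =>
      hF.ball_anti (Nat.le_add_left m j) (mul_mem_ball (pow_mem_ball ϖ j) hs)

theorem cyclicPart_mem_iwahoriDotLevel {m r : ℕ} (hm : m ≤ r) {x : Vadm σ b}
    (hx : detPart σ ϖ κ b x - 1 ∈ ball ϖ (m + 1)) :
    cyclicPart σ ϖ κ b r x ∈ iwahoriDotLevel m :=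
  ((hF.isLevel_iwahoriDotLevel m).mem_iff _).2 <| hasEntries_cyclicPart hF.frob_unif
    (hF.isLevel_iwahoriDotLevel (n := n) m).one_mem hx (hF.pow_mul_coeff_mem hb hbκ hm x)
      fun _ hs j => hF.ball_anti (Nat.le_add_left m j) (mul_mem_ball (pow_mem_ball ϖ j) hs)

omit hb hbκ in
theorem detPart_sub_one_mem {m r : ℕ} {x : Vadm σ b}
    (h : (gbrGL σ ϖ b r x : GL (Fin n) Kb ⧸ iwahoriDotLevel m)
      ∈ dlSet σ (iwahoriDotLevel m) (wdot ϖ κ r) b) :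
    detPart σ ϖ κ b x - 1 ∈ ball ϖ (m + 1) := by
  obtain ⟨g, hg, e⟩ := exists_detPart_eq_det hF.frob_unif
    (fun _ => (hF.isLevel_iwahoriDotLevel m).frob_mem) h
  rw [e]
  exact hF.det_sub_one_mem hg

/-- Here `normalize` uses `d⁻¹`, since units of `𝒪` do not change classes. For the dotted tower the
scalars are already congruent to `1`. -/
theorem isTower_iwahoriLevel :
    IsTower σ ϖ κ b (fun _ => {x | valuation Kb x = 1}) iwahoriLevel where
  level := hF.isLevel_iwahoriLevel
  anti _ _ _ := subset_rfl
  cyclicPart_mem _ q x _ _ := hF.cyclicPart_mem_iwahoriLevel hb hbκ q.2.le x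
  normalize m d hd := by
    have hd : valuation Kb d = 1 := hd
    have hd0 : d ≠ 0 := by
      rintro rfl
      simp at hd
    have ha : valuation Kb ((Units.mk0 d hd0)⁻¹ : Kbˣ).val = 1 := by simp [hd]
    refine ⟨(Units.mk0 d hd0)⁻¹, ha, ?_, fun m' => (hF.isLevel_iwahoriLevel m').gbrGL_scale_eq ha⟩
    simp [hd0]

theorem isTower_iwahoriDotLevel :
    IsTower σ ϖ κ b (fun m => {x | x - 1 ∈ ball ϖ (m + 1)}) iwahoriDotLevel where
  level := hF.isLevel_iwahoriDotLevel
  anti m m' h x hx := hF.ball_anti (Nat.succ_le_succ h) hx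
  cyclicPart_mem p q x hqp hx := hF.cyclicPart_mem_iwahoriDotLevel hb hbκ q.2.le
    (hF.ball_anti (Nat.succ_le_succ hqp.2) (hF.detPart_sub_one_mem hx))
  normalize m d hd := by
    refine ⟨1, by simp, by simpa using hd, fun m' r x => ?_⟩
    have e : scale 1 x = x := Subtype.ext (by simp [scale])
    rw [e]

end UnramifiedFrobenius

end Membership

/-! ### Transition maps and the points of the inverse limit -/

section Limits

variable {K Kb : Type*} [Field K] [Field Kb] [Algebra K Kb] {n : ℕ}
  {σ : Kb ≃ₐ[K] Kb} {ϖ : Kbˣ} {κ : ℕ} {b : GL (Fin n) Kb} {D : ℕ → Set Kb}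
  {H : ℕ → Subgroup (GL (Fin n) Kb)}

theorem gbr_mulVec_eq (r : ℕ) (x z : Fin n → Kb) :
    gbr σ ϖ b r x *ᵥ z = gb σ b x *ᵥ fun k => (ϖ : Kb) ^ (r * (k : ℕ)) * z k := by
  rw [gbr_eq, ← Matrix.mulVec_mulVec]
  congr 1
  ext k
  rw [Matrix.mulVec_diagonal]

theorem gb_mulVec_single [NeZero n] (x : Fin n → Kb) : gb σ b x *ᵥ Pi.single 0 1 = x := by
  ext i
  simp [gb]

variable [ValuativeRel Kb]

theorem mulVec_mem_ball {m : ℕ} {A : Matrix (Fin n) (Fin n) Kb} (hA : ∀ i j, A i j ∈ ball ϖ 0)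
    {w : Fin n → Kb} (hw : ∀ i, w i ∈ ball ϖ m) (i : Fin n) : (A *ᵥ w) i ∈ ball ϖ m := by
  rw [Matrix.mulVec, dotProduct]
  exact sum_mem fun j _ => by simpa using mul_mem_ball (hA i j) (hw j)

variable [NeZero n]

namespace UnramifiedFrobenius

theorem eq_zero_of_mem_ball (hF : UnramifiedFrobenius σ ϖ) {x : Kb}
    (h : ∀ m, x ∈ ball ϖ (m + 1)) : x = 0 := by
  by_contra hx
  obtain ⟨N, hN⟩ := hF.archimedean x hx
  exact (hN.trans_le (hF.ball_anti (Nat.le_succ N) (h N))).false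

theorem pow_mul_mem_ball (hF : UnramifiedFrobenius σ ϖ) {x : Kb} {m : ℕ} (hx : x ∈ ball ϖ m)
    (j : ℕ) : (ϖ : Kb) ^ j * x ∈ ball ϖ m :=
  hF.ball_anti (Nat.le_add_left m j) (mul_mem_ball (pow_mem_ball ϖ j) hx)

theorem mem_S (hF : UnramifiedFrobenius σ ϖ) {m r : ℕ} (hr : m ≤ r) :
    ∀ a ∈ ball ϖ 0, (ϖ : Kb) ^ (κ + n * r) * a ∈ ball ϖ m := fun a ha =>
  hF.ball_anti (hr.trans ((Nat.le_mul_of_pos_left r (NeZero.pos n)).trans (Nat.le_add_left _ _)))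
    (by simpa using mul_mem_ball (pow_mem_ball ϖ (κ + n * r)) ha)

end UnramifiedFrobenius

/-- The compatible system of the classes of the `g_{b,r}(x)`. -/
def toLimit (x : Vadm σ b)
    (hx : ∀ p : Level, cyclicPart σ ϖ κ b p.1.1 x ∈ H p.1.2) : LimitSet H σ ϖ κ b :=
  ⟨fun p => ⟨gbrGL σ ϖ b p.1.1 x, mem_dlSet_of_cyclicPart_mem (hx p)⟩,
    fun _ _ _ => ⟨x, rfl, rfl⟩⟩

namespace IsTower

theorem exists_eq (hF : UnramifiedFrobenius σ ϖ) (hT : IsTower σ ϖ κ b D H) {p : Level}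
    (P : LevelSet H σ ϖ κ b p) :
    ∃ x : Vadm σ b, P.1 = (gbrGL σ ϖ b p.1.1 x : GL (Fin n) Kb ⧸ H p.1.2) :=
  (hT.level p.1.2).exists_eq_gbrGL hF.frob_unif (hF.mem_S p.2.le) P.2

theorem cyclicPart_mem_of_eq (hT : IsTower σ ϖ κ b D H) {p q : Level} (hqp : q ≤ p)
    {P : LevelSet H σ ϖ κ b p} {x : Vadm σ b}
    (hx : P.1 = (gbrGL σ ϖ b p.1.1 x : GL (Fin n) Kb ⧸ H p.1.2)) :
    cyclicPart σ ϖ κ b q.1.1 x ∈ H q.1.2 :=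
  hT.cyclicPart_mem p q x hqp (hx ▸ P.2)

/-- If `z` are the coordinates of `y` with respect to `g_{b,r'}(x)`, those with respect to
`g_{b,r}(x)` are `ϖ ^ ((r' - r) k) z_k`. They are still shaped like a first column, so
`exists_gbrGL` at the lower level returns the class of `x`. -/
theorem gbrGL_eq_of_le (hF : UnramifiedFrobenius σ ϖ) (hT : IsTower σ ϖ κ b D H) {p q : Level}
    (hqp : q ≤ p) {P : LevelSet H σ ϖ κ b p} {x y : Vadm σ b}
    (hx : P.1 = (gbrGL σ ϖ b p.1.1 x : GL (Fin n) Kb ⧸ H p.1.2))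
    (hy : P.1 = (gbrGL σ ϖ b p.1.1 y : GL (Fin n) Kb ⧸ H p.1.2)) :
    (gbrGL σ ϖ b q.1.1 x : GL (Fin n) Kb ⧸ H q.1.2) = gbrGL σ ϖ b q.1.1 y := by
  obtain ⟨z, hz, e⟩ := (hT.level p.1.2).exists_mulVec_of_eq (hx.symm.trans hy)
  obtain ⟨d, hd⟩ := Nat.exists_eq_add_of_le hqp.1
  have hz' : IsLevel.ColumnHasEntries (ball ϖ q.1.2) (ball ϖ (q.1.2 + 1)) (D q.1.2) 0
      fun k => (ϖ : Kb) ^ (d * (k : ℕ)) * z k := by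
    refine ⟨fun k hk => by omega, fun k hk => ?_, fun k hk => ?_⟩
    · exact hF.pow_mul_mem_ball (hF.ball_anti (Nat.succ_le_succ hqp.2) (hz.2.1 k hk)) _
    · beta_reduce
      rw [hk, mul_zero, pow_zero, one_mul]
      exact hT.anti _ _ hqp.2 (hz.2.2 k hk)
  obtain ⟨y', hy', h⟩ := (hT.level q.1.2).exists_gbrGL hF.frob_unif (hF.mem_S q.2.le)
    (hT.cyclicPart_mem_of_eq hqp hx) (wdot_mul_cyclicPart σ ϖ κ b q.1.1 x) hz'
  have hyy' : y' = y := by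
    refine Subtype.ext ?_
    rw [hy', e, coe_gbrGL, gbr_mulVec_eq, gbr_mulVec_eq]
    congr 1
    ext k
    rw [hd, ← mul_assoc, ← pow_add, add_mul]
  rw [← h, hyy']

theorem existsUnique_isTransition (hF : UnramifiedFrobenius σ ϖ) (hT : IsTower σ ϖ κ b D H)
    {p p' : Level} (h : p ≤ p') (P' : LevelSet H σ ϖ κ b p') :
    ∃! P : LevelSet H σ ϖ κ b p, IsTransition H σ ϖ κ b P' P := by
  obtain ⟨x, hx⟩ := hT.exists_eq hF P'
  refine ⟨⟨gbrGL σ ϖ b p.1.1 x, mem_dlSet_of_cyclicPart_mem (hT.cyclicPart_mem_of_eq h hx)⟩,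
    ⟨x, hx, rfl⟩, ?_⟩
  rintro P ⟨y, hy, hP⟩
  exact Subtype.ext (hP.trans (hT.gbrGL_eq_of_le hF h hy hx))

/-- At level `(m + 1, m)` all coordinates of `y` in the cyclic basis of `x`, apart from the first,
lie in `𝔭 ^ (m + 1)`. For all `m` together they vanish. -/
theorem exists_smul_of_eq (hF : UnramifiedFrobenius σ ϖ) (hT : IsTower σ ϖ κ b D H)
    {x y : Vadm σ b} (h : ∀ p : Level,
      (gbrGL σ ϖ b p.1.1 x : GL (Fin n) Kb ⧸ H p.1.2) = gbrGL σ ϖ b p.1.1 y) :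
    ∃ u : Kb, (∀ m, u ∈ D m) ∧ y.1 = u • x.1 := by
  set c : Fin n → Kb := (gb σ b x.1)⁻¹ *ᵥ y.1 with hc
  have hy : gb σ b x.1 *ᵥ c = y.1 := by
    rw [hc, Matrix.mulVec_mulVec, Matrix.mul_nonsing_inv _ (isUnit_det_gb x), Matrix.one_mulVec]
  have key : ∀ m, c 0 ∈ D m ∧ ∀ k ≠ 0, c k ∈ ball ϖ (m + 1) := by
    intro m
    obtain ⟨z, hz, e⟩ := (hT.level m).exists_mulVec_of_eq (h ⟨(m + 1, m), Nat.lt_succ_self m⟩)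
    have hcz : ∀ k, c k = (ϖ : Kb) ^ ((m + 1) * (k : ℕ)) * z k := by
      intro k
      rw [hc, e, gbr_mulVec_eq, Matrix.mulVec_mulVec,
        Matrix.nonsing_inv_mul _ (isUnit_det_gb x), Matrix.one_mulVec]
    refine ⟨?_, fun k hk => ?_⟩
    · rw [hcz, Fin.val_zero, mul_zero, pow_zero, one_mul]
      exact hz.2.2 0 rfl
    · rw [hcz]
      exact hF.pow_mul_mem_ball
        (hz.2.1 k (Nat.pos_of_ne_zero fun h => hk (Fin.ext h))) _
  refine ⟨c 0, fun m => (key m).1, ?_⟩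
  have hc' : c = c 0 • Pi.single 0 1 := by
    ext k
    by_cases hk : k = 0
    · simp [hk]
    · rw [hF.eq_zero_of_mem_ball fun m => (key m).2 k hk]
      simp [hk]
  rw [← hy, hc', Matrix.mulVec_smul, gb_mulVec_single]
  simp

end IsTower

namespace UnramifiedFrobenius

/-- In the cyclic basis of `x` the operator has an integral matrix `C`, so the iterates of a small
`w` stay small. The quotient is `1 + g_C(w)`, which is congruent to `1`. -/
theorem inv_mul_gbrGL_mem (hF : UnramifiedFrobenius σ ϖ) (hb : IsBasic σ ϖ b)
    (hbκ : valuation Kb b.val.det = valuation Kb (ϖ : Kb) ^ κ) {m : ℕ} {x y : Vadm σ b}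
    {w : Fin n → Kb} (hw : ∀ i, w i ∈ ball ϖ (m + 1)) (hy : y.1 = x.1 + gb σ b x.1 *ᵥ w) :
    (gbrGL σ ϖ b 0 x)⁻¹ * gbrGL σ ϖ b 0 y ∈ iwahoriLevel 0 := by
  set C := (gbrGL σ ϖ b 0 x)⁻¹ * b * frob σ (gbrGL σ ϖ b 0 x) with hC
  have hCint : ∀ i j, C i j ∈ ball ϖ 0 := by
    intro i' j
    obtain ⟨i, rfl, -⟩ := exists_eq_add_one i'
    have h := wdot_mulVec_apply ϖ κ 0 (fun k => cyclicPart σ ϖ κ b 0 x k j) i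
    have hI := (hF.isLevel_iwahoriLevel 0).entry_mem
      (((hF.isLevel_iwahoriLevel 0).mem_iff _).1
        (hF.cyclicPart_mem_iwahoriLevel hb hbκ le_rfl x)) i j
    have e : C (i + 1) j = ((wdot ϖ κ 0).val *ᵥ fun k => cyclicPart σ ϖ κ b 0 x k j) (i + 1) := by
      rw [hC, wdot_mul_cyclicPart σ ϖ κ]
      rfl
    rw [e]
    rw [pow_zero, one_mul] at h
    rw [h]
    split_ifs
    · exact hF.pow_mul_mem_ball hI _
    · rwa [one_mul]
  have hx0 : (gbrGL σ ϖ b 0 x).val = gb σ b x.1 := by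
    rw [coe_gbrGL, gbr_eq]
    simp
  have hmul : ∀ v : Fin n → Kb, gb σ b ((gbrGL σ ϖ b 0 x).val *ᵥ v)
      = (gbrGL σ ϖ b 0 x).val * gb σ C v := fun v => by
    rw [gb_eq_gbr, gb_eq_gbr, gbr_mulVec]
  have hone : gb σ C (Pi.single 0 1) = 1 := by
    have h := hmul (Pi.single 0 1)
    rw [hx0, gb_mulVec_single] at h
    have h2 := congrArg ((gb σ b x.1)⁻¹ * ·) h
    simp only [← mul_assoc, Matrix.nonsing_inv_mul _ (isUnit_det_gb x), one_mul] at h2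
    exact h2.symm
  have hsmall : ∀ j i, ((bsig σ C)^[j] w) i ∈ ball ϖ (m + 1) := by
    intro j
    induction j with
    | zero => exact hw
    | succ j ih =>
      rw [Function.iterate_succ_apply']
      refine mulVec_mem_ball hCint fun i => ?_
      rw [mem_ball, hF.val_frob]
      exact ih i
  have hadd : gb σ C (Pi.single 0 1 + w) = 1 + gb σ C w := by
    rw [← hone]
    ext i j
    have h := bsig_iterate_sum σ C j Finset.univ
      (fun t : Bool => if t then Pi.single 0 1 else w)
    rw [Fintype.sum_bool, Fintype.sum_bool] at h
    exact congrFun h i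
  have e : ((gbrGL σ ϖ b 0 x)⁻¹ * gbrGL σ ϖ b 0 y).val = 1 + gb σ C w := by
    have hy0 : (gbrGL σ ϖ b 0 y).val = gb σ b y.1 := by
      rw [coe_gbrGL, gbr_eq]
      simp
    have hy' : y.1 = (gbrGL σ ϖ b 0 x).val *ᵥ (Pi.single 0 1 + w) := by
      rw [Matrix.mulVec_add, hx0, gb_mulVec_single, hy]
    rw [Units.val_mul, hy0, hy', hmul, hadd, ← mul_assoc, ← Units.val_mul, inv_mul_cancel,
      Units.val_one, one_mul]
  have hentry : ∀ i j, gb σ C w i j ∈ ball ϖ 1 := fun i j =>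
    hF.ball_anti (Nat.le_add_left 1 m) (hsmall j i)
  rw [(hF.isLevel_iwahoriLevel 0).mem_iff, e]
  refine ⟨fun i j h => ?_, fun i j h => ?_, fun i => ?_⟩
  · rw [Matrix.add_apply, Matrix.one_apply_ne h.ne, zero_add]
    exact hF.ball_anti zero_le_one (hentry i j)
  · rw [Matrix.add_apply, Matrix.one_apply_ne h.ne', zero_add (gb σ C w i j)]
    exact hentry i j
  · rw [Matrix.add_apply, Matrix.one_apply_eq]
    refine hF.val_eq_one_of_sub_one_mem (m := 0) ?_
    rw [add_sub_cancel_left]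
    exact hentry i i

/-- A sequence of admissible vectors, each of which is congruent to the previous one, converges. -/
theorem exists_limit_Vadm (hF : UnramifiedFrobenius σ ϖ) (hb : IsBasic σ ϖ b)
    (hbκ : valuation Kb b.val.det = valuation Kb (ϖ : Kb) ^ κ) {f : ℕ → Vadm σ b}
    (hf : ∀ k, ∃ w : Fin n → Kb, (∀ i, w i ∈ ball ϖ (k + 1)) ∧
      (f (k + 1)).1 = (f k).1 + gb σ b (f k).1 *ᵥ w) :
    ∃ x : Fin n → Kb, ∀ k, ∃ w : Fin n → Kb, (∀ i, w i ∈ ball ϖ k) ∧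
      x = (f k).1 + gb σ b (f k).1 *ᵥ w := by
  have hG : ∀ x : Vadm σ b, (gbrGL σ ϖ b 0 x).val = gb σ b x.1 := fun x => by
    rw [coe_gbrGL, gbr_eq]
    simp
  have hL := hF.isLevel_iwahoriLevel (n := n) 0
  -- All the cyclic bases lie in one coset of `iwahoriLevel 0`, so coordinates with respect to the
  -- first basis measure convergence uniformly.
  have hh : ∀ k, (gbrGL σ ϖ b 0 (f 0))⁻¹ * gbrGL σ ϖ b 0 (f k) ∈ iwahoriLevel 0 := by
    intro k
    induction k with
    | zero => rw [inv_mul_cancel]; exact one_mem _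
    | succ k ih =>
      obtain ⟨w, hw, e⟩ := hf k
      have := mul_mem ih (hF.inv_mul_gbrGL_mem hb hbκ hw e)
      rwa [mul_assoc, mul_inv_cancel_left] at this
  have hint : ∀ k i j, ((gbrGL σ ϖ b 0 (f 0))⁻¹ * gbrGL σ ϖ b 0 (f k)) i j ∈ ball ϖ 0 :=
    fun k => hL.entry_mem ((hL.mem_iff _).1 (hh k))
  let y : ℕ → Fin n → Kb := fun k => ((gbrGL σ ϖ b 0 (f 0))⁻¹).val *ᵥ (f k).1
  have hy : ∀ k, y k = ((gbrGL σ ϖ b 0 (f 0))⁻¹ * gbrGL σ ϖ b 0 (f k)).val *ᵥ Pi.single 0 1 := by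
    intro k
    rw [Units.val_mul, ← Matrix.mulVec_mulVec, hG, gb_mulVec_single]
  have hstep : ∀ k i, y (k + 1) i - y k i ∈ ball ϖ (k + 1) := by
    intro k i
    obtain ⟨w, hw, e⟩ := hf k
    have h : y (k + 1) = y k
        + ((gbrGL σ ϖ b 0 (f 0))⁻¹ * gbrGL σ ϖ b 0 (f k)).val *ᵥ w := by
      simp only [y]
      rw [e, Matrix.mulVec_add, Units.val_mul, ← Matrix.mulVec_mulVec, hG]
    rw [h, Pi.add_apply, add_sub_cancel_left]
    exact mulVec_mem_ball (hint k) hw i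
  have hlim : ∀ i, ∃ l : Kb, ∀ k, valuation Kb (l - y k i) ≤ valuation Kb (ϖ : Kb) ^ k := by
    refine fun i => hF.complete (fun k => y k i) (fun k => ?_) fun k =>
      hF.ball_anti (Nat.le_succ k) (hstep k i)
    have := mulVec_mem_ball (m := 0) (hint k) (w := Pi.single 0 1) (fun j => by
      rw [mem_ball, pow_zero]
      by_cases h : j = 0
      · simp [h]
      · simp [h]) i
    rw [← hy, mem_ball, pow_zero] at this
    exact this
  choose l hl using hlim
  refine ⟨(gbrGL σ ϖ b 0 (f 0)).val *ᵥ l, fun k => ?_⟩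
  refine ⟨((gbrGL σ ϖ b 0 (f k))⁻¹ * gbrGL σ ϖ b 0 (f 0)).val *ᵥ (l - y k),
    mulVec_mem_ball ?_ fun i => hl i k, ?_⟩
  · have := inv_mem (hh k)
    rw [_root_.mul_inv_rev, inv_inv] at this
    exact hL.entry_mem ((hL.mem_iff _).1 this)
  · rw [← hG, Matrix.mulVec_mulVec, ← Units.val_mul, mul_inv_cancel_left, Matrix.mulVec_sub]
    have e : (gbrGL σ ϖ b 0 (f 0)).val *ᵥ y k = (f k).1 := by
      rw [Matrix.mulVec_mulVec, ← Units.val_mul, mul_inv_cancel, Units.val_one, Matrix.one_mulVec]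
    rw [e, add_sub_cancel]

end UnramifiedFrobenius

theorem IsTower.exists_eq_toLimit (hF : UnramifiedFrobenius σ ϖ) (hb : IsBasic σ ϖ b)
    (hbκ : valuation Kb b.val.det = valuation Kb (ϖ : Kb) ^ κ) (hT : IsTower σ ϖ κ b D H)
    (P : LimitSet H σ ϖ κ b) :
    ∃ x : Vadm σ b, ∀ p : Level, (P.1 p).1 = (gbrGL σ ϖ b p.1.1 x : GL (Fin n) Kb ⧸ H p.1.2) := by
  -- A cofinal chain of levels.
  let lev : ℕ → Level := fun k => ⟨(k + 1, k), Nat.lt_succ_self k⟩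
  have hlev : ∀ {p : Level} {k : ℕ}, p.1.1 ≤ k → p ≤ lev k := fun {p k} h =>
    ⟨h.trans (Nat.le_succ k), p.2.le.trans h⟩
  obtain ⟨f, hf⟩ := exists_seq_of_step
    (P := fun k x => (P.1 (lev k)).1 = (gbrGL σ ϖ b (k + 1) x : GL (Fin n) Kb ⧸ H k))
    (R := fun k x x' => ∃ w : Fin n → Kb, (∀ i, w i ∈ ball ϖ (k + 1)) ∧
      x'.1 = x.1 + gb σ b x.1 *ᵥ w) (hT.exists_eq hF (P.1 (lev 0))) (by
    intro k x hx
    have hle : lev k ≤ lev (k + 1) := ⟨Nat.le_succ _, Nat.le_succ _⟩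
    obtain ⟨x₁, h₁, h₂⟩ := P.2 (lev k) (lev (k + 1)) hle
    obtain ⟨z, hz, e⟩ := (hT.level k).exists_mulVec_of_eq (hx.symm.trans h₂)
    -- Rescaling `x₁` by `a` keeps its classes and makes its first coordinate congruent to `1`, so
    -- that the new vector is close to `x`.
    obtain ⟨a, ha, had, hcl⟩ := hT.normalize k (z 0) (hz.2.2 0 rfl)
    refine ⟨scale a x₁, h₁.trans (hcl _ _ x₁).symm,
      fun i => (ϖ : Kb) ^ ((k + 1) * (i : ℕ)) * (a * z i) - (Pi.single 0 1 : Fin n → Kb) i,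
      fun i => ?_, ?_⟩
    · by_cases hi : i = 0
      · subst hi
        simpa using had
      · beta_reduce
        rw [Pi.single_eq_of_ne hi, sub_zero]
        refine hF.pow_mul_mem_ball ?_ _
        have := mul_mem_ball (ϖ := ϖ) (m := 0) (x := (a : Kb)) (by simp [mem_ball, ha])
          (hz.2.1 i (Nat.pos_of_ne_zero fun h => hi (Fin.ext h)))
        simpa using this
    · change (a : Kb) • x₁.1 = _
      have e2 : (fun i : Fin n => (ϖ : Kb) ^ ((k + 1) * (i : ℕ)) * ((a : Kb) * z i)
          - (Pi.single 0 1 : Fin n → Kb) i)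
          = (fun i : Fin n => (ϖ : Kb) ^ ((k + 1) * (i : ℕ)) * ((a : Kb) • z) i)
            - Pi.single 0 1 := rfl
      rw [e2, Matrix.mulVec_sub, gb_mulVec_single, add_sub_cancel, ← gbr_mulVec_eq,
        Matrix.mulVec_smul, ← e])
  obtain ⟨x, hx⟩ := hF.exists_limit_Vadm hb hbκ fun k => (hf k).2
  have key : ∀ p : Level, ∃ hx : x ∈ Vadm σ b,
      (P.1 p).1 = (gbrGL σ ϖ b p.1.1 ⟨x, hx⟩ : GL (Fin n) Kb ⧸ H p.1.2) := by
    intro p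
    -- Large enough that entries in `𝔭 ^ k`, divided by `ϖ ^ (r i)` with `i < n`, still lie in `𝔭 ^
    -- (m + 1)`.
    set k := p.1.1 * n + p.1.2 + 1 with hk
    have hpk : p.1.1 ≤ k := by
      have := Nat.le_mul_of_pos_right p.1.1 (NeZero.pos n)
      omega
    obtain ⟨z, h₁, h₂⟩ := P.2 p (lev k) (hlev hpk)
    have h₃ := h₂.trans (hT.gbrGL_eq_of_le hF (hlev hpk) h₁ (hf k).1)
    obtain ⟨w, hw, e⟩ := hx k
    have hϖ0 : (ϖ : Kb) ≠ 0 := ϖ.ne_zero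
    have hdiv : ∀ i : Fin n, ∃ v ∈ ball ϖ (p.1.2 + 1), (ϖ : Kb) ^ (p.1.1 * (i : ℕ)) * v = w i := by
      intro i
      refine ⟨w i / (ϖ : Kb) ^ (p.1.1 * (i : ℕ)), ?_, by field_simp⟩
      have hpos : 0 < valuation Kb (ϖ : Kb) ^ (p.1.1 * (i : ℕ)) :=
        pow_pos (zero_lt_iff.2 ((map_ne_zero _).2 hϖ0)) _
      rw [mem_ball, map_div₀, map_pow, div_le_iff₀ hpos, ← pow_add]
      refine hF.ball_anti ?_ (hw i)
      have := Nat.mul_le_mul_left p.1.1 i.2.le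
      omega
    choose v hv hvw using hdiv
    have hL := hT.level p.1.2
    -- In the basis `g_{b,r}(f k)` the limit has coordinates `e_1 + v`, shaped like a first column.
    -- This gives both its admissibility and its class.
    obtain ⟨x', hx', h₄⟩ := hL.exists_gbrGL hF.frob_unif (hF.mem_S p.2.le)
      (hT.cyclicPart_mem_of_eq (hlev hpk) (hf k).1)
      (wdot_mul_cyclicPart σ ϖ κ b p.1.1 (f k)) (y := Pi.single 0 1 + v)
      ⟨fun i hi => by omega, fun i hi => by
        rw [Pi.add_apply, Pi.single_eq_of_ne (by rintro rfl; simp at hi), zero_add]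
        exact hv i, fun i hi => by
        obtain rfl : i = 0 := Fin.ext hi
        rw [Pi.add_apply, Pi.single_eq_same]
        exact hL.add_D _ hL.one_mem _ (hv 0)⟩
    have hxx' : x'.1 = x := by
      rw [hx', e, coe_gbrGL, gbr_mulVec_eq]
      have e3 : (fun i : Fin n => (ϖ : Kb) ^ (p.1.1 * (i : ℕ))
          * (Pi.single 0 1 + v : Fin n → Kb) i) = Pi.single 0 1 + w := by
        ext i
        rw [Pi.add_apply, Pi.add_apply, mul_add, hvw]
        congr 1
        by_cases hi : i = 0
        · simp [hi]
        · simp [hi]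
      rw [e3, Matrix.mulVec_add, gb_mulVec_single]
    subst hxx'
    exact ⟨x'.2, h₃.trans h₄.symm⟩
  obtain ⟨hxV, -⟩ := key (lev 0)
  exact ⟨⟨x, hxV⟩, fun p => (key p).2⟩

end Limits

/-! ### The torus `T_w(K)` and the extension of degree `n` -/

section Torus

variable {K Kb : Type*} [Field K] [Field Kb] [Algebra K Kb] {n : ℕ} {σ : Kb ≃ₐ[K] Kb}

theorem mem_unramifiedExt {x : Kb} : x ∈ unramifiedExt σ n ↔ σ^[n] x = x := by
  have hpow : ∀ m : ℕ, (σ ^ m) x = σ^[m] x := fun m => by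
    rw [AlgEquiv.coe_pow]
  rw [unramifiedExt, IntermediateField.mem_fixedField_iff, ← hpow]
  constructor
  · exact fun h => h _ (Subgroup.mem_zpowers _)
  · intro h f hf
    have : f ∈ MulAction.stabilizer (Kb ≃ₐ[K] Kb) x :=
      (Subgroup.zpowers_le (H := MulAction.stabilizer (Kb ≃ₐ[K] Kb) x)).2 h hf
    exact this

variable [NeZero n]

theorem mem_Tw_iff {t : Fin n → Kbˣ} : t ∈ Tw σ ↔ ∀ j, σ (t j) = t (j + 1) := by
  refine ⟨Tw.frob_apply, fun h => ?_⟩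
  change (diagGL t)⁻¹ * b₀ * frob σ (diagGL t) = b₀
  rw [mul_assoc, inv_mul_eq_iff_eq_mul, frob_diagGL]
  refine Units.ext ?_
  rw [Units.val_mul, Units.val_mul, coe_diagGL, coe_diagGL]
  ext i j
  rw [Matrix.mul_diagonal, Matrix.diagonal_mul]
  simp only [b₀, Matrix.of_apply]
  split_ifs with hij
  · subst hij
    rw [one_mul, mul_one]
    exact h j
  · rw [zero_mul, mul_zero]

theorem Tw.iterate_dim {t : Fin n → Kbˣ} (ht : t ∈ Tw σ) : σ^[n] (t 0 : Kb) = t 0 := by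
  obtain ⟨k, hk, ⟨h, -⟩ | ⟨-, h⟩⟩ := exists_eq_add_one (0 : Fin n)
  · have e : ∀ m, (k : ℕ) + 1 = m → σ^[m] (t 0 : Kb) = t 0 := by
      rintro _ rfl
      rw [Function.iterate_succ_apply', Tw.iterate ht, Tw.frob_apply ht, ← hk]
    exact e n h
  · rw [Fin.val_zero] at h
    omega

theorem Tw.ext {t t' : Fin n → Kbˣ} (ht : t ∈ Tw σ) (ht' : t' ∈ Tw σ) (h : t 0 = t' 0) :
    t = t' := by
  ext j
  rw [← Tw.iterate ht, ← Tw.iterate ht', h]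

/-- The coordinates are forced to be `σ^j(a)`; the hypothesis is the condition at the wraparound. -/
theorem exists_mem_Tw {a : Kbˣ} (ha : σ^[n] (a : Kb) = a) : ∃ t ∈ Tw (n := n) σ, t 0 = a := by
  have hne : ∀ j : ℕ, σ^[j] (a : Kb) ≠ 0 := by
    intro j
    induction j with
    | zero => exact a.ne_zero
    | succ j ih =>
      rw [Function.iterate_succ_apply']
      exact (map_ne_zero σ).2 ih
  refine ⟨fun j => Units.mk0 (σ^[(j : ℕ)] (a : Kb)) (hne j), mem_Tw_iff.2 fun j => ?_,
    Units.ext rfl⟩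
  rw [Units.val_mk0, Units.val_mk0, ← Function.iterate_succ_apply' (⇑σ)]
  obtain ⟨k, hk, h⟩ := exists_eq_add_one (j + 1)
  obtain rfl : j = k := add_right_cancel hk
  rcases h with ⟨h1, h2⟩ | ⟨-, h2⟩
  · rw [h2, Nat.succ_eq_add_one, h1, ha]
    rfl
  · rw [h2]

/-- The isomorphism of `T_w(K)` with the units of the extension of degree `n`. -/
def twEquiv (σ : Kb ≃ₐ[K] Kb) (n : ℕ) [NeZero n] : Tw (n := n) σ ≃* (unramifiedExt σ n)ˣ :=
  MulEquiv.ofBijective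
    (⟨⟨fun t => Units.mk0 ⟨t.1 0, mem_unramifiedExt.2 (Tw.iterate_dim t.2)⟩
        fun h => (t.1 0).ne_zero (congrArg Subtype.val h),
      Units.ext (Subtype.ext rfl)⟩, fun _ _ => Units.ext (Subtype.ext rfl)⟩ :
      Tw (n := n) σ →* (unramifiedExt σ n)ˣ) (by
    constructor
    · intro t t' h
      refine Subtype.ext (Tw.ext t.2 t'.2 (Units.ext ?_))
      exact congrArg (fun u : (unramifiedExt σ n)ˣ => ((u : unramifiedExt σ n) : Kb)) h
    · intro u
      obtain ⟨t, ht, h⟩ := exists_mem_Tw (n := n) (σ := σ)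
        (a := Units.map (algebraMap (unramifiedExt σ n) Kb).toMonoidHom u)
        (mem_unramifiedExt.1 (u : unramifiedExt σ n).2)
      exact ⟨⟨t, ht⟩, Units.ext (Subtype.ext (congrArg Units.val h))⟩)

theorem coe_twEquiv (t : Tw (n := n) σ) :
    ((twEquiv σ n t : unramifiedExt σ n) : Kb) = t.1 0 := rfl

theorem UnramifiedFrobenius.mem_TwInt_iff [ValuativeRel Kb] {ϖ : Kbˣ}
    (hF : UnramifiedFrobenius σ ϖ) {t : Fin n → Kbˣ} (ht : t ∈ Tw σ) :
    t ∈ TwInt σ ↔ valuation Kb (t 0 : Kb) = 1 := by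
  refine ⟨fun h => mem_intUnits.1 (TwInt.coord h 0), fun h => ⟨ht, fun j _ => ?_⟩⟩
  change t j ∈ intUnits Kb
  rw [mem_intUnits, ← Tw.iterate ht, hF.val_frob_iterate, h]

end Torus

/-! ### Scaling of admissible vectors and rationality of determinants -/

section Scaling

variable {K Kb : Type*} [Field K] [Field Kb] [Algebra K Kb] {n : ℕ}
  {σ : Kb ≃ₐ[K] Kb} {ϖ : Kbˣ} {κ : ℕ} {b : GL (Fin n) Kb}

theorem scale_scale (a a' : Kbˣ) (x : Vadm σ b) : scale a (scale a' x) = scale (a * a') x :=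
  Subtype.ext (by simp [scale, smul_smul])

theorem scale_one (x : Vadm σ b) : scale 1 x = x := Subtype.ext (by simp [scale])

theorem det_gb_scale (a : Kbˣ) (x : Vadm σ b) : (gb σ b (scale a x).1).det
    = (gb σ b x.1).det * ∏ j ∈ Finset.range n, σ^[j] (a : Kb) := by
  change (gb σ b ((a : Kb) • x.1)).det = _
  rw [gb_eq_gbr, gbr_smul, Matrix.det_mul, ← gb_eq_gbr, Matrix.det_diagonal,
    Finset.prod_range fun j => σ^[j] (a : Kb)]

/-- Telescoping: applying `σ` to the product of the first `n` conjugates trades the factor `a` for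
`σ^n(a)`. -/
theorem frob_prod_iterate (σ : Kb ≃ₐ[K] Kb) (a : Kb) (n : ℕ) :
    σ (∏ j ∈ Finset.range n, σ^[j] a) * a = (∏ j ∈ Finset.range n, σ^[j] a) * σ^[n] a := by
  rw [map_prod, ← Finset.prod_range_succ, Finset.prod_range_succ']
  simp only [Function.iterate_succ_apply', Function.iterate_zero, id]

theorem UnramifiedFrobenius.mem_VadmRat_iff [ValuativeRel Kb]
    (hF : UnramifiedFrobenius σ ϖ) {x : Fin n → Kb} :
    x ∈ VadmRat σ b ↔ x ∈ Vadm σ b ∧ σ (gb σ b x).det = (gb σ b x).det := by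
  constructor
  · intro h
    refine ⟨VadmRat_subset σ b h, ?_⟩
    obtain ⟨d, -, h⟩ := h
    rw [h, AlgEquiv.commutes]
  · rintro ⟨h, hσ⟩
    obtain ⟨d, hd⟩ := hF.fixed _ hσ
    refine ⟨d, ?_, hd.symm⟩
    rintro rfl
    rw [map_zero] at hd
    exact h hd.symm

variable [NeZero n]

theorem ne_zero_of_mem_Vadm (x : Vadm σ b) : x.1 ≠ 0 := by
  intro h
  have hz : gb σ b x.1 = 0 := by
    ext i j
    have := congrFun (bsig_iterate_smul σ b 0 x.1 j) i
    rw [zero_smul, ← h, iterate_map_zero, zero_smul] at this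
    exact this
  exact x.2 (by rw [hz, Matrix.det_zero])

theorem scale_injective {a a' : Kbˣ} {x : Vadm σ b} (h : scale a x = scale a' x) : a = a' :=
  Units.ext (smul_left_injective Kb (ne_zero_of_mem_Vadm x) (congrArg Subtype.val h))

/-- Compare `frob_det_gb` for `x` and `a x`; the norm-like products telescope. -/
theorem detPart_scale (hϖ : σ (ϖ : Kb) = ϖ) (a : Kbˣ) (x : Vadm σ b) :
    detPart σ ϖ κ b (scale a x) * a = detPart σ ϖ κ b x * σ^[n] (a : Kb) := by
  have h1 := frob_det_gb (κ := κ) hϖ x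
  have h2 := frob_det_gb (κ := κ) hϖ (scale a x)
  rw [det_gb_scale, map_mul] at h2
  have h3 := frob_prod_iterate σ (a : Kb) n
  have hN : (∏ j ∈ Finset.range n, σ^[j] (a : Kb)) ≠ 0 := by
    intro h
    have := (scale a x).2
    exact this (by rw [det_gb_scale, h, mul_zero])
  have hD : (gb σ b x.1).det ≠ 0 := x.2
  refine mul_left_cancel₀ (mul_ne_zero (mul_ne_zero hD hN) (det_ne_zero (wdot (n := n) ϖ κ 0))) ?_
  linear_combination (-(a : Kb)) * h2 + (b.val.det * σ (gb σ b x.1).det) * h3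
    + (∏ j ∈ Finset.range n, σ^[j] (a : Kb)) * σ^[n] (a : Kb) * h1

theorem detPart_scale_eq_iff (hϖ : σ (ϖ : Kb) = ϖ) (a : Kbˣ) (x : Vadm σ b) :
    detPart σ ϖ κ b (scale a x) = 1 ↔ detPart σ ϖ κ b x * σ^[n] (a : Kb) = a := by
  rw [← detPart_scale hϖ]
  exact ⟨fun h => by rw [h, one_mul], fun h => (mul_eq_right₀ a.ne_zero).1 h⟩

variable [ValuativeRel Kb]

namespace UnramifiedFrobenius

theorem mem_VadmRat_iff_detPart (hF : UnramifiedFrobenius σ ϖ) (x : Vadm σ b) :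
    x.1 ∈ VadmRat σ b ↔ (wdot (n := n) ϖ κ 0).val.det * detPart σ ϖ κ b x = b.val.det := by
  rw [hF.mem_VadmRat_iff]
  have h := frob_det_gb (κ := κ) hF.frob_unif x
  have hD : (gb σ b x.1).det ≠ 0 := x.2
  constructor
  · rintro ⟨-, e⟩
    rw [e, mul_comm] at h
    exact (mul_left_cancel₀ hD h).symm
  · intro e
    rw [e, mul_comm] at h
    exact ⟨x.2, mul_right_cancel₀ (det_ne_zero b) h⟩

/-- Rationality fixes `detPart` as `det b / det ẇ_0`, and scaling by `c` multiplies it by `σ^n(c) /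
c`. So `c` has to satisfy `σ^n(c) = (det ẇ_0 / det b) c`, which Lang's theorem solves because the
ratio is a unit. If the determinants agree, `1` is a solution and is the one chosen. -/
theorem exists_scalar (hF : UnramifiedFrobenius σ ϖ)
    (hbκ : valuation Kb b.val.det = valuation Kb (ϖ : Kb) ^ κ) :
    ∃ c : Kbˣ, c ∈ intUnits Kb ∧ (b.val.det = (wdot (n := n) ϖ κ 0).val.det → c = 1) ∧
      ∀ x : Vadm σ b, x.1 ∈ VadmRat σ b ↔ detPart σ ϖ κ b (scale c x) = 1 := by
  have hw := det_ne_zero (wdot (n := n) ϖ κ 0)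
  have hb0 := det_ne_zero b
  have key : ∀ c : Kbˣ, b.val.det * σ^[n] (c : Kb) = (wdot (n := n) ϖ κ 0).val.det * c →
      ∀ x : Vadm σ b, x.1 ∈ VadmRat σ b ↔ detPart σ ϖ κ b (scale c x) = 1 := by
    intro c hc x
    rw [hF.mem_VadmRat_iff_detPart (κ := κ), detPart_scale_eq_iff hF.frob_unif]
    constructor
    · intro e
      rw [← e, mul_assoc] at hc
      exact mul_left_cancel₀ hw hc
    · intro e
      refine mul_right_cancel₀ (b := σ^[n] (c : Kb)) ?_ ?_
      · intro h0
        rw [h0, mul_zero] at e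
        exact c.ne_zero e.symm
      · rw [mul_assoc, e, hc]
  by_cases h : b.val.det = (wdot (n := n) ϖ κ 0).val.det
  · exact ⟨1, one_mem _, fun _ => rfl, key 1 (by
      rw [h, Units.val_one, iterate_map_one])⟩
  · obtain ⟨c, hc, e⟩ := hF.lang n (NeZero.ne n) ((wdot (n := n) ϖ κ 0).val.det / b.val.det) (by
      rw [map_div₀, wdot_zero_det, map_mul, val_det_b₀, one_mul, hbκ, map_pow]
      exact div_self (pow_ne_zero _ ((map_ne_zero _).2 ϖ.ne_zero)))
    have hc0 : c ≠ 0 := by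
      rintro rfl
      simp at hc
    refine ⟨Units.mk0 c hc0, mem_intUnits.2 hc, fun h' => absurd h' h, key _ ?_⟩
    rw [Units.val_mk0, e]
    field_simp

/-- Lang's theorem applied to the unit `detPart`. It says that every class modulo `𝒪ˣ` meets `Vone`,
whence the surjectivity of both torsors. -/
theorem exists_detPart_scale_eq_one (hF : UnramifiedFrobenius σ ϖ)
    (hbκ : valuation Kb b.val.det = valuation Kb (ϖ : Kb) ^ κ) (x : Vadm σ b) :
    ∃ a ∈ intUnits Kb, detPart σ ϖ κ b (scale a x) = 1 := by
  obtain ⟨c, hc, e⟩ := hF.lang n (NeZero.ne n) (detPart σ ϖ κ b x)⁻¹ (by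
    rw [map_inv₀, hF.val_detPart hbκ, inv_one])
  have hc0 : c ≠ 0 := by
    rintro rfl
    simp at hc
  refine ⟨Units.mk0 c hc0, mem_intUnits.2 hc, (detPart_scale_eq_iff hF.frob_unif _ _).2 ?_⟩
  rw [Units.val_mk0, e, mul_inv_cancel_left₀ (detPart_ne_zero hF.frob_unif x)]

theorem exists_zpow (hF : UnramifiedFrobenius σ ϖ) (a : Kbˣ) :
    ∃ k : ℤ, valuation Kb (a : Kb) = valuation Kb ((ϖ ^ k : Kbˣ) : Kb) := by
  have hϖ0 : 0 < valuation Kb (ϖ : Kb) := zero_lt_iff.2 ((map_ne_zero _).2 ϖ.ne_zero)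
  wlog ha : valuation Kb (a : Kb) ≤ 1 generalizing a
  · obtain ⟨k, hk⟩ := this a⁻¹ (by
      rw [Units.val_inv_eq_inv_val, map_inv₀]
      exact inv_le_one_of_one_le₀ (not_le.1 ha).le)
    refine ⟨-k, ?_⟩
    rw [_root_.zpow_neg, Units.val_inv_eq_inv_val, map_inv₀, ← hk, Units.val_inv_eq_inv_val,
      map_inv₀, inv_inv]
  classical
  have hex := hF.archimedean a a.ne_zero
  obtain ⟨N, hN⟩ : ∃ N, Nat.find hex = N + 1 := by
    refine Nat.exists_eq_succ_of_ne_zero fun h => ?_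
    have := Nat.find_spec hex
    rw [h, pow_zero] at this
    exact this.not_ge ha
  have h1 : valuation Kb (ϖ : Kb) ^ (N + 1) < valuation Kb (a : Kb) := hN ▸ Nat.find_spec hex
  have h2 : valuation Kb (a : Kb) ≤ valuation Kb (ϖ : Kb) ^ N :=
    not_lt.1 (Nat.find_min hex (by omega))
  refine ⟨N, ?_⟩
  rw [zpow_natCast, Units.val_pow_eq_pow_val]
  refine le_antisymm (h2.trans_eq (map_pow _ _ _).symm) (not_lt.1 fun h => ?_)
  have h3 := hF.val_le_mul_of_lt h
  rw [map_pow, ← pow_succ'] at h3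
  exact h1.not_ge h3

theorem zpow_injective (hF : UnramifiedFrobenius σ ϖ) {k l : ℤ}
    (h : valuation Kb ((ϖ ^ k : Kbˣ) : Kb) = valuation Kb ((ϖ ^ l : Kbˣ) : Kb)) : k = l := by
  have hϖ0 : 0 < valuation Kb (ϖ : Kb) := zero_lt_iff.2 ((map_ne_zero _).2 ϖ.ne_zero)
  simp only [Units.val_zpow_eq_zpow_val, map_zpow₀] at h
  exact (zpow_right_strictAnti₀ hϖ0 hF.val_lt_one).injective h

end UnramifiedFrobenius

end Scaling

/-- The permutation representation of `G` on a subset of `X` stable under an action of `G`. -/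
def permHomOfStable {G X : Type*} [Group G] (a : G → X → X) (one : ∀ x, a 1 x = x)
    (mul : ∀ g g' x, a (g * g') x = a g (a g' x)) {s : Set X} (hs : ∀ g, ∀ x ∈ s, a g x ∈ s) :
    G →* Equiv.Perm s :=
  letI : MulAction G s :=
    { smul := fun g x => ⟨a g x.1, hs g x.1 x.2⟩
      one_smul := fun x => Subtype.ext (one x.1)
      mul_smul := fun g g' x => Subtype.ext (mul g g' x.1) }
  MulAction.toPermHom G s

/-! ### Parametrizations, equivariance and torsors -/

section Diagram

variable {K Kb : Type*} [Field K] [Field Kb] [Algebra K Kb] {n : ℕ}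
  {σ : Kb ≃ₐ[K] Kb} {ϖ : Kbˣ} {κ : ℕ} {b : GL (Fin n) Kb}

theorem mk_eq_mk_iff {Γ : Subgroup Kbˣ} {x y : Vadm σ b} :
    VadmMod.mk Γ x = VadmMod.mk Γ y ↔ ∃ a ∈ Γ, y = scale a x :=
  Quotient.eq.trans <| exists_congr fun _ => and_congr_right fun _ =>
    ⟨fun h => Subtype.ext h, fun h => congrArg Subtype.val h⟩

theorem scale_smul_comm (c : Kbˣ) (g : Jb σ b) (x : Vadm σ b) :
    scale c (g • x) = g • scale c x :=
  Subtype.ext (Matrix.mulVec_smul g.1.val (c : Kb) x.1).symm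

theorem dlSet_smul_eq_of_eq {H : Subgroup (GL (Fin n) Kb)} {w : GL (Fin n) Kb} {r : ℕ}
    {P Q : dlSet σ H w b} {x : Vadm σ b} (g : Jb σ b)
    (hP : P.1 = (gbrGL σ ϖ b r x : GL (Fin n) Kb ⧸ H))
    (hQ : Q.1 = (gbrGL σ ϖ b r (g • x) : GL (Fin n) Kb ⧸ H)) : Q = g • P := by
  refine Subtype.ext ?_
  rw [hQ, Jb.gbrGL]
  exact (congrArg (g.1 • ·) hP).symm

/-- Determinants in `b σ(g) = g b` show that `det g` is fixed by `σ`. -/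
theorem UnramifiedFrobenius.mulVec_mem_VadmRat [ValuativeRel Kb]
    (hF : UnramifiedFrobenius σ ϖ) (g : Jb σ b) {x : Fin n → Kb}
    (hx : x ∈ VadmRat σ b) : g.1.val *ᵥ x ∈ VadmRat σ b := by
  obtain ⟨hx, e⟩ := hF.mem_VadmRat_iff.1 hx
  refine hF.mem_VadmRat_iff.2 ⟨(g • (⟨x, hx⟩ : Vadm σ b)).2, ?_⟩
  have hg : g.1⁻¹ * b * frob σ g.1 = b := g.2
  rw [mul_assoc, inv_mul_eq_iff_eq_mul] at hg
  have h := congrArg (fun A : GL (Fin n) Kb => A.val.det) hg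
  have hσ : (frob σ g.1).val.det = σ g.1.val.det := (σ.toRingEquiv.toRingHom.map_det _).symm
  beta_reduce at h
  rw [Units.val_mul, Units.val_mul, Matrix.det_mul, Matrix.det_mul, hσ, mul_comm] at h
  rw [gb_eq_gbr, Jb.gbr, ← gb_eq_gbr, Matrix.det_mul, map_mul, e,
    mul_right_cancel₀ (det_ne_zero b) h]

theorem dlProj_smul {H H' : Subgroup (GL (Fin n) Kb)} (h : H ≤ H') {w : GL (Fin n) Kb}
    (g : Jb σ b) (P : dlSet σ H w b) : dlProj σ h w b (g • P) = g • dlProj σ h w b P := by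
  obtain ⟨P, hP⟩ := P
  refine Subtype.ext ?_
  induction P using QuotientGroup.induction_on with
  | H a => rfl

variable [NeZero n]

/-- The admissible vectors whose classes lie in the Deligne-Lusztig sets for unipotent levels. -/
def Vone (σ : Kb ≃ₐ[K] Kb) (ϖ : Kbˣ) (κ : ℕ) (b : GL (Fin n) Kb) : Set (Vadm σ b) :=
  {x | detPart σ ϖ κ b x = 1}

theorem mem_Vone {x : Vadm σ b} : x ∈ Vone σ ϖ κ b ↔ detPart σ ϖ κ b x = 1 := Iff.rfl

theorem scale_mem_Vone_iff (hϖ : σ (ϖ : Kb) = ϖ) {x : Vadm σ b} (hx : x ∈ Vone σ ϖ κ b)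
    {a : Kbˣ} : scale a x ∈ Vone σ ϖ κ b ↔ σ^[n] (a : Kb) = a := by
  rw [mem_Vone, detPart_scale_eq_iff hϖ, mem_Vone.1 hx, one_mul]

theorem Tw.scale_mem_Vone (hϖ : σ (ϖ : Kb) = ϖ) {t : Fin n → Kbˣ} (ht : t ∈ Tw σ) {x : Vadm σ b}
    (hx : x ∈ Vone σ ϖ κ b) : scale (t 0) x ∈ Vone σ ϖ κ b :=
  (scale_mem_Vone_iff hϖ hx).2 (Tw.iterate_dim ht)

theorem exists_scale_eq {x y : Vadm σ b} {u : Kb} (h : y.1 = u • x.1) :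
    ∃ a : Kbˣ, (a : Kb) = u ∧ y = scale a x := by
  have hu : u ≠ 0 := by
    rintro rfl
    exact ne_zero_of_mem_Vadm y (h.trans (zero_smul _ _))
  exact ⟨Units.mk0 u hu, rfl, Subtype.ext h⟩

/-- When nothing is allowed below the diagonal, a first column is a multiple of `e_1`. -/
theorem IsLevel.exists_scale_eq {R S : AddSubgroup Kb} {D : Set Kb}
    {H : Subgroup (GL (Fin n) Kb)} (hH : IsLevel σ R S ⊥ D H) {r : ℕ} {x y : Vadm σ b}
    (h : (gbrGL σ ϖ b r x : GL (Fin n) Kb ⧸ H) = gbrGL σ ϖ b r y) :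
    ∃ a : Kbˣ, (a : Kb) ∈ D ∧ y = scale a x := by
  obtain ⟨z, hz, e⟩ := hH.exists_mulVec_of_eq h
  have hz' : (fun k : Fin n => (ϖ : Kb) ^ (r * (k : ℕ)) * z k) = z 0 • Pi.single 0 1 := by
    ext k
    by_cases hk : k = 0
    · simp [hk]
    · have h0 : z k = 0 := hz.2.1 k (Nat.pos_of_ne_zero fun h => hk (Fin.ext h))
      simp [hk, h0]
  rw [gbr_mulVec_eq, hz', Matrix.mulVec_smul, gb_mulVec_single] at e
  obtain ⟨a, ha, e⟩ := CoxeterDL.exists_scale_eq e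
  exact ⟨a, ha ▸ hz.2.2 0 rfl, e⟩

/-- The parametrization of `Ẋ_w^DL(b)`. -/
theorem exists_equiv_XDLdot (hϖ : σ (ϖ : Kb) = ϖ) :
    ∃ F : Vone σ ϖ κ b ≃ XDLdot σ ϖ κ b,
      ∀ x, (F x).1 = (gbrGL σ ϖ b 0 x.1 : GL (Fin n) Kb ⧸ unip) := by
  refine ⟨Equiv.ofBijective
    (fun x => ⟨gbrGL σ ϖ b 0 x.1, (gbrGL_mem_XDLdot_iff hϖ 0 x.1).2 x.2⟩) ⟨fun x y h => ?_,
    fun P => ?_⟩, fun _ => rfl⟩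
  · obtain ⟨a, ha, e⟩ := (isLevel_unip σ).exists_scale_eq (congrArg Subtype.val h)
    obtain rfl : a = 1 := Units.ext ha
    rw [scale_one] at e
    exact Subtype.ext e.symm
  · obtain ⟨x, hx⟩ := (isLevel_unip σ).exists_eq_gbrGL hϖ
      (fun _ _ => AddSubgroup.mem_top _) P.2
    exact ⟨⟨x, (gbrGL_mem_XDLdot_iff hϖ 0 x).1 (hx ▸ P.2)⟩, Subtype.ext hx.symm⟩

/-- The parametrization of `X_w^DL(b)`. -/
theorem exists_equiv_XDL (hϖ : σ (ϖ : Kb) = ϖ) :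
    ∃ F : VadmMod σ b ⊤ ≃ XDL σ ϖ κ b,
      ∀ x, (F (VadmMod.mk ⊤ x)).1 = (gbrGL σ ϖ b 0 x : GL (Fin n) Kb ⧸ upperBorel) := by
  let F₀ : Vadm σ b → XDL σ ϖ κ b := fun x =>
    ⟨gbrGL σ ϖ b 0 x, mem_dlSet_of_cyclicPart_mem (cyclicPart_mem_upperBorel hϖ 0 x)⟩
  refine ⟨Equiv.ofBijective (Quotient.lift F₀ ?_) ⟨fun q q' => ?_, fun P => ?_⟩, fun _ => rfl⟩
  · intro x y h
    obtain ⟨a, -, rfl⟩ := mk_eq_mk_iff.1 (Quotient.sound h)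
    exact Subtype.ext ((isLevel_upperBorel σ).gbrGL_scale_eq a.ne_zero 0 x).symm
  · induction q, q' using Quotient.inductionOn₂ with | h x y => ?_
    intro h
    obtain ⟨a, -, e⟩ := (isLevel_upperBorel σ).exists_scale_eq (congrArg Subtype.val h)
    exact mk_eq_mk_iff.2 ⟨a, Subgroup.mem_top a, e⟩
  · obtain ⟨x, hx⟩ := (isLevel_upperBorel σ).exists_eq_gbrGL hϖ
      (fun _ _ => AddSubgroup.mem_top _) P.2
    exact ⟨VadmMod.mk ⊤ x, Subtype.ext hx.symm⟩

/-- If `A` and `B` are parametrized by `Vone` and by a quotient of `V_b^adm`, then a map `A → B`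
compatible with the parametrizations is a torsor. -/
theorem isTorsor_of_param (hϖ : σ (ϖ : Kb) = ϖ) {T : Subgroup (Fin n → Kbˣ)} {A B : Type*}
    [MulAction T A] {π : A → B} {Γ : Subgroup Kbˣ} (F : Vone σ ϖ κ b ≃ A)
    (F' : VadmMod σ b Γ ≃ B) (hπ : ∀ x, π (F x) = F' (VadmMod.mk Γ x.1))
    (hT : ∀ t, t ∈ T ↔ t ∈ Tw σ ∧ t 0 ∈ Γ)
    (hsmul : ∀ (t : T) x, t • F x = F ⟨scale (t.1 0) x.1,
      Tw.scale_mem_Vone hϖ ((hT t.1).1 t.2).1 x.2⟩)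
    (hΓ : ∀ x : Vadm σ b, ∃ a ∈ Γ, scale a x ∈ Vone σ ϖ κ b) : IsTorsor T π := by
  refine ⟨fun P => ?_, fun t P => ?_, fun P P' h => ?_⟩
  · obtain ⟨q, rfl⟩ := F'.surjective P
    induction q using Quotient.inductionOn with | h x => ?_
    obtain ⟨a, ha, hx⟩ := hΓ x
    exact ⟨F ⟨_, hx⟩, (hπ _).trans (congrArg F' (mk_eq_mk_iff.2 ⟨a, ha, rfl⟩).symm)⟩
  · obtain ⟨x, rfl⟩ := F.surjective P
    rw [hsmul, hπ, hπ]
    exact congrArg F' (mk_eq_mk_iff.2 ⟨_, ((hT t.1).1 t.2).2, rfl⟩).symm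
  · obtain ⟨x, rfl⟩ := F.surjective P
    obtain ⟨y, rfl⟩ := F.surjective P'
    rw [hπ, hπ] at h
    obtain ⟨a, ha, e⟩ := mk_eq_mk_iff.1 (F'.injective h)
    -- Both vectors have `detPart = 1`, so the scalar is fixed by `σ^n` and is the first coordinate
    -- of a torus element.
    obtain ⟨t, ht, rfl⟩ := exists_mem_Tw ((scale_mem_Vone_iff hϖ x.2).1 (e ▸ y.2))
    refine ⟨⟨t, (hT t).2 ⟨ht, ha⟩⟩, ?_, fun t' h' => ?_⟩
    · beta_reduce
      rw [hsmul]
      exact congrArg F (Subtype.ext e)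
    · beta_reduce at h'
      rw [hsmul] at h'
      have h'' := congrArg Subtype.val (F.injective h')
      exact Subtype.ext (Tw.ext ((hT t'.1).1 t'.2).1 ht (scale_injective (h''.symm.trans e)))

theorem XDLdot_smul_eq_of_eq {P Q : XDLdot σ ϖ κ b} {x : Vadm σ b} (t : Tw (n := n) σ)
    (hP : P.1 = (gbrGL σ ϖ b 0 x : GL (Fin n) Kb ⧸ unip))
    (hQ : Q.1 = (gbrGL σ ϖ b 0 (scale (t.1 0) x) : GL (Fin n) Kb ⧸ unip)) : t • P = Q := by
  refine Subtype.ext ?_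
  rw [hQ, Tw.gbrGL t.2]
  exact congrArg (rightMul (diagGL t.1) fun _ => diagGL_conj_unip t.1) hP

theorem LimitSet.ext {H : ℕ → Subgroup (GL (Fin n) Kb)} {P Q : LimitSet H σ ϖ κ b}
    (h : ∀ p, (P.1 p).1 = (Q.1 p).1) : P = Q :=
  Subtype.ext (funext fun p => Subtype.ext (h p))

variable [ValuativeRel Kb]

theorem XinfDot_smul_eq_of_eq {P Q : XinfDot σ ϖ κ b} {x : Vadm σ b} (t : TwInt (n := n) σ)
    (hP : ∀ p, (P.1 p).1 = (gbrGL σ ϖ b p.1.1 x : GL (Fin n) Kb ⧸ iwahoriDotLevel p.1.2))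
    (hQ : ∀ p, (Q.1 p).1 =
      (gbrGL σ ϖ b p.1.1 (scale (t.1 0) x) : GL (Fin n) Kb ⧸ iwahoriDotLevel p.1.2)) :
    t • P = Q := by
  refine LimitSet.ext fun p => ?_
  rw [hQ, Tw.gbrGL t.2.1]
  exact congrArg (rightMul (diagGL t.1)
    fun _ => diagGL_conj_iwahoriDotLevel (TwInt.coord t.2)) (hP p)

namespace UnramifiedFrobenius

/-- The parametrization of `Ẋ_w^∞(b)`. -/
theorem exists_equiv_XinfDot (hF : UnramifiedFrobenius σ ϖ) (hb : IsBasic σ ϖ b)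
    (hbκ : valuation Kb b.val.det = valuation Kb (ϖ : Kb) ^ κ) :
    ∃ F : Vone σ ϖ κ b ≃ XinfDot σ ϖ κ b, ∀ x p, ((F x).1 p).1 =
      (gbrGL σ ϖ b p.1.1 x.1 : GL (Fin n) Kb ⧸ iwahoriDotLevel p.1.2) := by
  have hT := hF.isTower_iwahoriDotLevel hb hbκ
  refine ⟨Equiv.ofBijective (fun x => toLimit x.1 fun p =>
    hF.cyclicPart_mem_iwahoriDotLevel hb hbκ p.2.le (by
      rw [mem_Vone.1 x.2, sub_self]
      exact zero_mem _)) ⟨fun x y h => ?_, fun P => ?_⟩, fun _ _ => rfl⟩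
  · obtain ⟨u, hu, e⟩ := hT.exists_smul_of_eq hF fun p =>
      congrArg (fun Q : XinfDot σ ϖ κ b => (Q.1 p).1) h
    have hu1 : u = 1 := sub_eq_zero.1 (hF.eq_zero_of_mem_ball hu)
    rw [hu1, one_smul] at e
    exact Subtype.ext (Subtype.ext e.symm)
  · obtain ⟨x, hx⟩ := hT.exists_eq_toLimit hF hb hbκ P
    -- Membership at the levels `(m + 1, m)` makes `detPart` congruent to `1` modulo every power of
    -- `ϖ`.
    refine ⟨⟨x, sub_eq_zero.1 (hF.eq_zero_of_mem_ball fun m => ?_)⟩,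
      LimitSet.ext fun p => (hx p).symm⟩
    have hp := hx ⟨(m + 1, m), Nat.lt_succ_self m⟩
    exact hF.detPart_sub_one_mem (hp ▸ (P.1 ⟨(m + 1, m), Nat.lt_succ_self m⟩).2)

/-- The parametrization of `X_w^∞(b)`. -/
theorem exists_equiv_Xinf (hF : UnramifiedFrobenius σ ϖ) (hb : IsBasic σ ϖ b)
    (hbκ : valuation Kb b.val.det = valuation Kb (ϖ : Kb) ^ κ) :
    ∃ F : VadmMod σ b (intUnits Kb) ≃ Xinf σ ϖ κ b, ∀ x p,
      ((F (VadmMod.mk (intUnits Kb) x)).1 p).1 =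
        (gbrGL σ ϖ b p.1.1 x : GL (Fin n) Kb ⧸ iwahoriLevel p.1.2) := by
  have hT := hF.isTower_iwahoriLevel hb hbκ
  let F₀ : Vadm σ b → Xinf σ ϖ κ b := fun x =>
    toLimit x fun p => hF.cyclicPart_mem_iwahoriLevel hb hbκ p.2.le x
  refine ⟨Equiv.ofBijective (Quotient.lift F₀ ?_) ⟨fun q q' => ?_, fun P => ?_⟩, fun _ _ => rfl⟩
  · intro x y h
    obtain ⟨a, ha, rfl⟩ := mk_eq_mk_iff.1 (Quotient.sound h)
    exact LimitSet.ext fun p =>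
      ((hF.isLevel_iwahoriLevel p.1.2).gbrGL_scale_eq (mem_intUnits.1 ha) p.1.1 x).symm
  · induction q, q' using Quotient.inductionOn₂ with | h x y => ?_
    intro h
    obtain ⟨u, hu, e⟩ := hT.exists_smul_of_eq hF fun p =>
      congrArg (fun Q : Xinf σ ϖ κ b => (Q.1 p).1) h
    obtain ⟨a, rfl, e'⟩ := CoxeterDL.exists_scale_eq e
    exact mk_eq_mk_iff.2 ⟨a, mem_intUnits.2 (hu 0), e'⟩
  · obtain ⟨x, hx⟩ := hT.exists_eq_toLimit hF hb hbκ P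
    exact ⟨VadmMod.mk (intUnits Kb) x, LimitSet.ext fun p => (hx p).symm⟩

/-- Scaling by a suitable constant identifies `V_b^{adm,rat}` with `Vone`. -/
theorem exists_equiv_Vone (hF : UnramifiedFrobenius σ ϖ)
    (hbκ : valuation Kb b.val.det = valuation Kb (ϖ : Kb) ^ κ) :
    ∃ c : Kbˣ, c ∈ intUnits Kb ∧ (b.val.det = (wdot (n := n) ϖ κ 0).val.det → c = 1) ∧
      ∃ e : VadmRat σ b ≃ Vone σ ϖ κ b, ∀ x, (e x).1 = scale c (VadmRat.toVadm x) := by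
  obtain ⟨c, hc, hc1, h⟩ := hF.exists_scalar (n := n) (b := b) hbκ
  refine ⟨c, hc, hc1, Equiv.ofBijective
    (fun x => ⟨scale c (VadmRat.toVadm x), (h (VadmRat.toVadm x)).1 x.2⟩)
    ⟨fun x y e => ?_, fun y => ?_⟩, fun _ => rfl⟩
  · have e' : (c : Kb) • x.1 = (c : Kb) • y.1 :=
      congrArg (fun z : Vone σ ϖ κ b => z.1.1) e
    exact Subtype.ext (smul_right_injective _ c.ne_zero e')
  · have e : scale c (scale c⁻¹ y.1) = y.1 := by
      rw [scale_scale, mul_inv_cancel, scale_one]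
    exact ⟨⟨(scale c⁻¹ y.1).1, (h _).2 (by rw [e]; exact y.2)⟩, Subtype.ext e⟩

/-- The determinant changes by the product of the `n` conjugates of `t 0`, which `σ` fixes because
`σ^n` fixes `t 0`. -/
theorem smul_mem_VadmRat (hF : UnramifiedFrobenius σ ϖ) {t : Fin n → Kbˣ} (ht : t ∈ Tw σ)
    {x : Fin n → Kb} (hx : x ∈ VadmRat σ b) : (t 0 : Kb) • x ∈ VadmRat σ b := by
  obtain ⟨hx, e⟩ := hF.mem_VadmRat_iff.1 hx
  refine hF.mem_VadmRat_iff.2 ⟨smul_mem_Vadm (t 0) hx, ?_⟩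
  have h := det_gb_scale (t 0) (⟨x, hx⟩ : Vadm σ b)
  have hσ := frob_prod_iterate σ (t 0 : Kb) n
  rw [Tw.iterate_dim ht] at hσ
  change (gb σ b ((t 0 : Kb) • x)).det = _ at h
  rw [h, map_mul, e, mul_right_cancel₀ (t 0).ne_zero hσ]

/-- Scalars agree modulo `𝒪ˣ` exactly when their values agree, and each value is that of a unique
power of `ϖ`. -/
theorem existsUnique_zpow (hF : UnramifiedFrobenius σ ϖ) {x y : Vadm σ b} :
    VadmMod.mk ⊤ x = VadmMod.mk ⊤ y ↔
      ∃! k : ℤ, VadmMod.mk (intUnits Kb) y = VadmMod.mk (intUnits Kb) (scale (ϖ ^ k) x) := by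
  have key : ∀ (a : Kbˣ) (k : ℤ), VadmMod.mk (intUnits Kb) (scale a x)
      = VadmMod.mk (intUnits Kb) (scale (ϖ ^ k) x) ↔
        valuation Kb (a : Kb) = valuation Kb ((ϖ ^ k : Kbˣ) : Kb) := by
    intro a k
    rw [mk_eq_mk_iff]
    have ha : valuation Kb (a : Kb) ≠ 0 := (map_ne_zero _).2 a.ne_zero
    constructor
    · rintro ⟨d, hd, e⟩
      rw [scale_scale] at e
      rw [scale_injective e, Units.val_mul, map_mul, mem_intUnits.1 hd, one_mul]
    · intro h
      refine ⟨ϖ ^ k * a⁻¹, mem_intUnits.2 ?_, ?_⟩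
      · rw [Units.val_mul, map_mul, ← h, ← map_mul, Units.mul_inv, map_one]
      · rw [scale_scale, inv_mul_cancel_right]
  constructor
  · intro h
    obtain ⟨a, -, rfl⟩ := mk_eq_mk_iff.1 h
    obtain ⟨k, hk⟩ := hF.exists_zpow a
    exact ⟨k, (key a k).2 hk, fun l hl => hF.zpow_injective (((key a l).1 hl).symm.trans hk)⟩
  · rintro ⟨k, hk, -⟩
    obtain ⟨d, -, e⟩ := mk_eq_mk_iff.1 hk.symm
    rw [scale_scale] at e
    exact mk_eq_mk_iff.2 ⟨_, Subgroup.mem_top _, e⟩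

end UnramifiedFrobenius

end Diagram

end CoxeterDL

end

theorem mainTheorem1
    {K : Type*} [Field K] [ValuativeRel K] [TopologicalSpace K] [IsNonarchimedeanLocalField K]
    {Kb : Type*} [Field Kb] [ValuativeRel Kb] [Algebra K Kb] [ValuativeExtension K Kb]
    (hKb : IsCompletedMaximalUnramified K Kb)
    (σ : Kb ≃ₐ[K] Kb) (hσ : IsFrobenius K σ)
    (ϖ : Kbˣ) (hϖ : IsUniformizerOf K ϖ)
    (n : ℕ) [NeZero n] (κ : ℕ) (hκ : κ < n)
    (b : GL (Fin n) Kb) (hb : IsBasic σ ϖ b)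
    (hbκ : valuation Kb b.val.det = valuation Kb (ϖ : Kb) ^ κ) :
    -- the transition maps of the inverse systems are well defined
    (∀ p p' : Level, p ≤ p' →
      (∀ P' : LevelSet iwahoriLevel σ ϖ κ b p', ∃! P : LevelSet iwahoriLevel σ ϖ κ b p,
        IsTransition iwahoriLevel σ ϖ κ b P' P) ∧
      (∀ P' : LevelSet iwahoriDotLevel σ ϖ κ b p', ∃! P : LevelSet iwahoriDotLevel σ ϖ κ b p,
        IsTransition iwahoriDotLevel σ ϖ κ b P' P)) ∧
    -- `T_w(K) = Lˣ` and `T_w(𝒪_K) = 𝒪_Lˣ`, via the first coordinate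
    (∃ ι : Tw (n := n) σ ≃* (unramifiedExt σ n)ˣ,
      (∀ t, ((ι t : unramifiedExt σ n) : Kb) = t.1 0) ∧
      ∀ t, t.1 ∈ TwInt σ ↔ valuation Kb ((ι t : unramifiedExt σ n) : Kb) = 1) ∧
    -- `G = J_b(K)` and `T_w(K)` act on `V_b^{adm,rat}`
    ∃ (ρ : Jb σ b →* Equiv.Perm (VadmRat σ b)) (τ : Tw (n := n) σ →* Equiv.Perm (VadmRat σ b)),
      (∀ g x, (ρ g x).1 = g.1.val *ᵥ x.1) ∧
      (∀ t x, (τ t x).1 = (t.1 0 : Kb) • x.1) ∧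
    -- the horizontal maps, which are bijections, given by explicit formulas
    ∃ (c : Kbˣ) (f : VadmRat σ b ≃ XDLdot σ ϖ κ b) (f' : VadmMod σ b ⊤ ≃ XDL σ ϖ κ b)
      (h : VadmRat σ b ≃ XinfDot σ ϖ κ b) (h' : VadmMod σ b (intUnits Kb) ≃ Xinf σ ϖ κ b),
      (c ∈ intUnits Kb ∧ (b.val.det = (wdot (n := n) ϖ κ 0).val.det → c = 1)) ∧
      (∀ x, (f x).1 = (gbrGL σ ϖ b 0 (scale c (VadmRat.toVadm x)) : GL (Fin n) Kb ⧸ unip)) ∧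
      (∀ x, (f' (VadmMod.mk ⊤ x)).1 = (gbrGL σ ϖ b 0 x : GL (Fin n) Kb ⧸ upperBorel)) ∧
      (∀ x p, ((h x).1 p).1 = (gbrGL σ ϖ b p.1.1 (scale c (VadmRat.toVadm x)) :
        GL (Fin n) Kb ⧸ iwahoriDotLevel p.1.2)) ∧
      (∀ x p, ((h' (VadmMod.mk (intUnits Kb) x)).1 p).1 = (gbrGL σ ϖ b p.1.1 x :
        GL (Fin n) Kb ⧸ iwahoriLevel p.1.2)) ∧
      -- the diagram commutes
      (∀ x, dlProj σ unip_le_borel _ _ (f x) = f' (VadmMod.mk ⊤ (VadmRat.toVadm x))) ∧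
      (∀ x, LimitSet.proj iwahoriDotLevel_le (h x) =
        h' (VadmMod.mk (intUnits Kb) (VadmRat.toVadm x))) ∧
      (∀ x : VadmRat σ b, VadmMod.proj (le_top : intUnits Kb ≤ ⊤)
        (VadmMod.mk (intUnits Kb) (VadmRat.toVadm x)) = VadmMod.mk ⊤ (VadmRat.toVadm x)) ∧
      -- all maps of the diagram are `G`-equivariant
      (∀ g x, f (ρ g x) = g • f x) ∧
      (∀ (g : Jb σ b) y, f' (g • y) = g • f' y) ∧
      (∀ g x, h (ρ g x) = g • h x) ∧
      (∀ (g : Jb σ b) y, h' (g • y) = g • h' y) ∧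
      (∀ (g : Jb σ b) (P : XDLdot σ ϖ κ b),
        dlProj σ unip_le_borel _ _ (g • P) = g • dlProj σ unip_le_borel _ _ P) ∧
      (∀ (g : Jb σ b) (P : XinfDot σ ϖ κ b), LimitSet.proj iwahoriDotLevel_le (g • P) =
        g • LimitSet.proj iwahoriDotLevel_le P) ∧
      (∀ g x, VadmMod.mk ⊤ (VadmRat.toVadm (ρ g x)) =
        g • VadmMod.mk ⊤ (VadmRat.toVadm x)) ∧
      (∀ (g : Jb σ b) (y : VadmMod σ b (intUnits Kb)),
        VadmMod.proj (le_top : intUnits Kb ≤ ⊤) (g • y) =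
          g • VadmMod.proj (le_top : intUnits Kb ≤ ⊤) y) ∧
      -- the vertical maps are torsors under `T_w(K)` and `T_w(𝒪_K)`
      IsTorsor (Tw (n := n) σ)
        (dlProj σ unip_le_borel (wdot ϖ κ 0) b : XDLdot σ ϖ κ b → XDL σ ϖ κ b) ∧
      IsTorsor (TwInt (n := n) σ)
        (LimitSet.proj iwahoriDotLevel_le : XinfDot σ ϖ κ b → Xinf σ ϖ κ b) ∧
      -- the map `V_b^adm / 𝒪ˣ → V_b^adm / K̆ˣ` is a torsor under `ϖ^ℤ`
      Function.Surjective (VadmMod.proj (le_top : intUnits Kb ≤ ⊤) :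
        VadmMod σ b (intUnits Kb) → VadmMod σ b ⊤) ∧
      (∀ x y : Vadm σ b, VadmMod.proj (le_top : intUnits Kb ≤ ⊤) (VadmMod.mk (intUnits Kb) x) =
          VadmMod.proj (le_top : intUnits Kb ≤ ⊤) (VadmMod.mk (intUnits Kb) y) ↔
        ∃! k : ℤ, VadmMod.mk (intUnits Kb) y = VadmMod.mk (intUnits Kb) (scale (ϖ ^ k) x)) ∧
      -- the upper maps are equivariant for the torus
      (∀ t x, f (τ t x) = t • f x) ∧
      (∀ (t : TwInt (n := n) σ) x, h (τ ⟨t.1, t.2.1⟩ x) = t • h x) ∧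
      -- the action of `T_w(𝒪_K)` on `Ẋ_w^∞(b)` extends to an action of `T_w(K)`
      ∃ θ : Tw (n := n) σ →* Equiv.Perm (XinfDot σ ϖ κ b),
        (∀ (t : TwInt (n := n) σ) P, θ ⟨t.1, t.2.1⟩ P = t • P) ∧
        (∀ t x, h (τ t x) = θ t (h x)) ∧
        (∀ t (g : Jb σ b) P, θ t (g • P) = g • θ t P) := by
  have hF := unramifiedFrobenius hKb hσ hϖ
  have hT := hF.isTower_iwahoriLevel hb hbκ
  have hTdot := hF.isTower_iwahoriDotLevel hb hbκ
  refine ⟨fun p p' h => ⟨hT.existsUnique_isTransition hF h,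
    hTdot.existsUnique_isTransition hF h⟩, ⟨twEquiv σ n, coe_twEquiv,
    fun t => hF.mem_TwInt_iff t.2⟩, ?_⟩
  let ρ : Jb σ b →* Equiv.Perm (VadmRat σ b) :=
    permHomOfStable (fun g x => g.1.val *ᵥ x) Matrix.one_mulVec
      (fun g g' x => (Matrix.mulVec_mulVec x g.1.val g'.1.val).symm)
      fun g _ hx => hF.mulVec_mem_VadmRat g hx
  let τ : Tw (n := n) σ →* Equiv.Perm (VadmRat σ b) :=
    permHomOfStable (fun t x => (t.1 0 : Kb) • x) (one_smul Kb)
      (fun t t' x => mul_smul (t.1 0 : Kb) (t'.1 0 : Kb) x)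
      fun t _ hx => hF.smul_mem_VadmRat t.2 hx
  obtain ⟨c, hc, hc1, e, he⟩ := hF.exists_equiv_Vone (n := n) (b := b) hbκ
  obtain ⟨F, hFF⟩ := exists_equiv_XDLdot (n := n) (κ := κ) (b := b) hF.frob_unif
  obtain ⟨f', hf'⟩ := exists_equiv_XDL (n := n) (κ := κ) (b := b) hF.frob_unif
  obtain ⟨E, hE⟩ := hF.exists_equiv_XinfDot hb hbκ
  obtain ⟨h', hh'⟩ := hF.exists_equiv_Xinf hb hbκ
  have hρ : ∀ g x, VadmRat.toVadm (ρ g x) = g • VadmRat.toVadm x := fun _ _ => rfl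
  have heρ : ∀ g x, (e (ρ g x)).1 = g • (e x).1 := fun g x => by
    rw [he, he, hρ, scale_smul_comm]
  have heτ : ∀ t x, (e (τ t x)).1 = scale (t.1 0) (e x).1 := fun t x => by
    have : VadmRat.toVadm (τ t x) = scale (t.1 0) (VadmRat.toVadm x) := rfl
    rw [he, he, this, scale_scale, scale_scale, mul_comm]
  have hEτ : ∀ (t : TwInt (n := n) σ) x, E (e (τ ⟨t.1, t.2.1⟩ x)) = t • E (e x) :=
    fun t x => (XinfDot_smul_eq_of_eq t (hE _) fun p => (hE _ p).trans (by rw [heτ])).symm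
  have hEρ : ∀ g x, E (e (ρ g x)) = g • E (e x) := fun g x =>
    Subtype.ext <| funext fun p =>
      dlSet_smul_eq_of_eq g (hE _ p) ((hE _ p).trans (by rw [heρ]))
  have hFπ : ∀ x, dlProj σ unip_le_borel _ _ (F x) = f' (VadmMod.mk ⊤ x.1) := fun x =>
    Subtype.ext ((congrArg (Subgroup.quotientMapOfLE unip_le_borel) (hFF x)).trans (hf' _).symm)
  have hEπ : ∀ x, LimitSet.proj iwahoriDotLevel_le (E x) = h' (VadmMod.mk (intUnits Kb) x.1) :=
    fun x => LimitSet.ext fun p =>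
      (congrArg (Subgroup.quotientMapOfLE (iwahoriDotLevel_le _)) (hE x p)).trans (hh' _ p).symm
  -- Since `c` is a unit of `𝒪`, scaling by it disappears in the lower row, already modulo `𝒪ˣ`.
  have hmk : ∀ (Γ : Subgroup Kbˣ) x, c ∈ Γ →
      VadmMod.mk Γ (e x).1 = VadmMod.mk Γ (VadmRat.toVadm x) := fun Γ x h =>
    (mk_eq_mk_iff.2 ⟨c, h, he x⟩).symm
  refine ⟨ρ, τ, fun _ _ => rfl, fun _ _ => rfl, c, e.trans F, f', e.trans E, h', ⟨hc, hc1⟩,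
    fun x => (hFF _).trans (by rw [he]), hf', fun x p => (hE _ p).trans (by rw [he]), hh',
    fun x => (hFπ _).trans (by rw [hmk _ _ (Subgroup.mem_top c)]),
    fun x => (hEπ _).trans (by rw [hmk _ _ hc]), fun _ => rfl,
    fun g x => dlSet_smul_eq_of_eq g (hFF _) ((hFF _).trans (by rw [heρ])),
    fun g y => ?_, hEρ, fun g y => ?_, fun g P => ?_, fun g P => ?_, fun _ _ => rfl,
    fun g y => ?_, ?_, ?_, fun y => ?_, fun x y => hF.existsUnique_zpow,
    fun t x => (XDLdot_smul_eq_of_eq t (hFF _) ((hFF _).trans (by rw [heτ]))).symm, hEτ,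
    -- The extended action is that of `T_w(K)` on `V_b^{adm,rat}`, transported along the upper right
    -- bijection.
    (Equiv.permCongrHom (e.trans E)).toMonoidHom.comp τ, fun t P => ?_, fun t x => ?_,
    fun t g P => ?_⟩
  · induction y using Quotient.inductionOn with | h x => ?_
    exact dlSet_smul_eq_of_eq g (hf' x) (hf' (g • x))
  · induction y using Quotient.inductionOn with | h x => ?_
    exact Subtype.ext <| funext fun p => dlSet_smul_eq_of_eq g (hh' x p) (hh' (g • x) p)
  · exact dlProj_smul _ g P
  · exact Subtype.ext <| funext fun p => dlProj_smul _ g (P.1 p)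
  · induction y using Quotient.inductionOn with | h x => ?_
    rfl
  · refine isTorsor_of_param hF.frob_unif F f' hFπ
      (fun t => (and_iff_left (Subgroup.mem_top _)).symm)
      (fun t x => XDLdot_smul_eq_of_eq t (hFF x) (hFF _)) fun x => ?_
    obtain ⟨a, -, ha⟩ := hF.exists_detPart_scale_eq_one hbκ x
    exact ⟨a, Subgroup.mem_top a, ha⟩
  · exact isTorsor_of_param hF.frob_unif E h' hEπ
      (fun t => ⟨fun h => ⟨h.1, TwInt.coord h 0⟩,
        fun h => (hF.mem_TwInt_iff h.1).2 (mem_intUnits.1 h.2)⟩)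
      (fun t x => XinfDot_smul_eq_of_eq t (hE x) (hE _)) (hF.exists_detPart_scale_eq_one hbκ)
  · induction y using Quotient.inductionOn with | h x => ?_
    exact ⟨VadmMod.mk (intUnits Kb) x, rfl⟩
  · obtain ⟨x, rfl⟩ := (e.trans E).surjective P
    exact (congrArg (fun y => E (e (τ ⟨t.1, t.2.1⟩ y)))
      ((e.trans E).symm_apply_apply x)).trans (hEτ t x)
  · exact congrArg (fun y => E (e (τ t y))) ((e.trans E).symm_apply_apply x).symm
  · obtain ⟨x, rfl⟩ := (e.trans E).surjective P
    have hcomm : τ t (ρ g x) = ρ g (τ t x) :=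
      Subtype.ext (Matrix.mulVec_smul g.1.val (t.1 0 : Kb) x.1).symm
    have hθ : ∀ y, (Equiv.permCongrHom (e.trans E)) (τ t) ((e.trans E) y) = E (e (τ t y)) :=
      fun y => congrArg (fun y => E (e (τ t y))) ((e.trans E).symm_apply_apply y)
    calc _ = (Equiv.permCongrHom (e.trans E)) (τ t) ((e.trans E) (ρ g x)) :=
          congrArg _ (hEρ g x).symm
      _ = g • E (e (τ t x)) := by rw [hθ, hcomm, hEρ]
      _ = _ := congrArg (g • ·) (hθ x).symm
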